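/- Let $0<\lambda<1$ and $$H(x,y)=\tfrac12x^2+\lambda x^3+\tfrac12\lambda x^4+\tfrac12\lambda^{-1}y^2+xy+x^2y .$$ For real coefficients $a_{i,j},b_{i,j}$ put $f=\sum_{0\le i+j\le n}a_{i,j}x^iy^j$, $g=\sum_{0\le i+j\le n}b_{i,j}x^iy^j$ and consider the system $$\dot x=-\lambda^{-1}y-x-x^2+\varepsilon f(x,y),\qquad \dot y=x+y+2xy+3\lambda x^2+2\lambda x^3+\varepsilon g(x,y).\tag{$*_\varepsilon$}$$ For $\varepsilon=0$ it is Hamiltonian with an isochronous center at the origin, whose period annulus consists of the ovals $\Gamma_h=\{H=h\}$, $h\in(0,\infty)$. Let $I(h)=\oint_{\Gamma_h}g\,dx-f\,dy$ for $h>0$, with $\Gamma_h$ oriented counterclockwise. The multiplicity of a limit cycle is the order of the zero of the displacement function $s\mapsto P(s)-s$ of its Poincaré return map $P$ on a transversal segment. (i) Let $n\ge2$ and suppose that $I$ does not vanish identically on $(0,\infty)$. Then $I$ has at most $n-1$ zeros in $(0,\infty)$, counted with multiplicity. Moreover at most $n-1$ limit cycles, counted with multiplicity, bifurcate from the period annulus: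 for all $0<c\le d$ there is $\varepsilon_0>0$ such that for $0<|\varepsilon|<\varepsilon_0$ the system $(*_\varepsilon)$ has only finitely many limit cycles contained in $\{c\le H\le d\}$, and the sum of their multiplicities is at most $n-1$. (ii) This bound is sharp: for every $n\ge2$ there are coefficients $a_{i,j},b_{i,j}$ such that $I$ has exactly $n-1$ zeros in $(0,\infty)$, all of them simple, and exactly $n-1$ limit cycles bifurcate from the period annulus: there are $0<c_0\le d_0$ such that for all $c\in(0,c_0]$ and $d\ge d_0$ there is $\varepsilon_0>0$ such that for $0<|\varepsilon|<\varepsilon_0$ exactly $n-1$ limit cycles of $(*_\varepsilon)$ are contained in $\{c\le H\le d\}$. (iii) For $n=1$ the system $(*_\varepsilon)$ has no limit cycle, for any coefficients and any $\varepsilon\in\mathbb R$. -/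

import Mathlib

open Set Filter Topology

noncomputable section

namespace IsochronousCubic

/-! ### Planar vector fields: closed orbits, limit cycles, multiplicity -/

/-- `γ` is a periodic solution, of least period `T > 0`, of the autonomous planar system `z' = X z`.
Equilibria are excluded, since `γ t ≠ γ 0` for `0 < t < T`. -/
def IsPeriodicSolution (X : ℝ × ℝ → ℝ × ℝ) (γ : ℝ → ℝ × ℝ) (T : ℝ) : Prop :=
  (∀ t, HasDerivAt γ (X (γ t)) t) ∧ 0 < T ∧ Function.Periodic γ T ∧
    ∀ t ∈ Ioo 0 T, γ t ≠ γ 0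

/-- A closed orbit: the trace of a (nonconstant) periodic solution. -/
def IsClosedOrbit (X : ℝ × ℝ → ℝ × ℝ) (Γ : Set (ℝ × ℝ)) : Prop :=
  ∃ γ T, IsPeriodicSolution X γ T ∧ Γ = range γ

/-- A limit cycle: a closed orbit with a neighbourhood that contains no other closed orbit. -/
def IsLimitCycle (X : ℝ × ℝ → ℝ × ℝ) (Γ : Set (ℝ × ℝ)) : Prop :=
  IsClosedOrbit X Γ ∧
    ∃ U, IsOpen U ∧ Γ ⊆ U ∧ ∀ Γ', IsClosedOrbit X Γ' → Γ' ⊆ U → Γ' = Γ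

/-- `P` is (a representative of the germ at `0` of) the Poincaré return map of the system `z' = X z`
on the transversal segment `s ↦ p + s • v`, where `p` lies on a closed orbit of least period `T`:
the solution that starts at `p + s • v` is at `p + P s • v` after a time `τ s`, where
`(τ s, P s) → (T, 0)` as `s → 0`. -/
def IsReturnMap (X : ℝ × ℝ → ℝ × ℝ) (p v : ℝ × ℝ) (T : ℝ) (P : ℝ → ℝ) : Prop :=
  (X p).1 * v.2 - (X p).2 * v.1 ≠ 0 ∧ P 0 = 0 ∧ ContinuousAt P 0 ∧
    ∃ τ : ℝ → ℝ, τ 0 = T ∧ ContinuousAt τ 0 ∧ ∀ᶠ s in 𝓝 (0 : ℝ), ∃ γ : ℝ → ℝ × ℝ,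
      (∀ t ∈ Icc 0 (τ s), HasDerivWithinAt γ (X (γ t)) (Icc 0 (τ s)) t) ∧
      γ 0 = p + s • v ∧ γ (τ s) = p + P s • v

/-- `x` is a zero of order exactly `m` of `f` (for `m = 0`: `f x ≠ 0`). -/
def HasZeroOfOrder (f : ℝ → ℝ) (x : ℝ) (m : ℕ) : Prop :=
  ContDiffAt ℝ m f x ∧ (∀ j < m, iteratedDeriv j f x = 0) ∧ iteratedDeriv m f x ≠ 0

/-- The closed orbit `Γ` has multiplicity `m`: the displacement function `s ↦ P s - s` of its
Poincaré return map has a zero of order `m` at `s = 0`. (As `P 0 = 0`, necessarily `1 ≤ m`.) -/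
def HasMultiplicity (X : ℝ × ℝ → ℝ × ℝ) (Γ : Set (ℝ × ℝ)) (m : ℕ) : Prop :=
  ∃ γ T v P, IsPeriodicSolution X γ T ∧ Γ = range γ ∧ IsReturnMap X (γ 0) v T P ∧
    HasZeroOfOrder (fun s => P s - s) 0 m

/-! ### The cubic isochronous Hamiltonian system and its perturbation -/

/-- The Hamiltonian `H`. -/
def ham (lam : ℝ) (p : ℝ × ℝ) : ℝ :=
  1 / 2 * p.1 ^ 2 + lam * p.1 ^ 3 + 1 / 2 * lam * p.1 ^ 4 + 1 / 2 * lam⁻¹ * p.2 ^ 2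
    + p.1 * p.2 + p.1 ^ 2 * p.2

/-- The polynomial `∑_{0 ≤ i + j ≤ n} a i j x^i y^j`. -/
def poly (n : ℕ) (a : ℕ → ℕ → ℝ) (p : ℝ × ℝ) : ℝ :=
  ∑ i ∈ Finset.range (n + 1), ∑ j ∈ Finset.range (n + 1 - i), a i j * p.1 ^ i * p.2 ^ j

/-- The perturbed system, with perturbation `ε (f, g)` where `f = poly n a` and `g = poly n b`. -/
def field (lam : ℝ) (n : ℕ) (a b : ℕ → ℕ → ℝ) (ε : ℝ) (p : ℝ × ℝ) : ℝ × ℝ :=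
  (-lam⁻¹ * p.2 - p.1 - p.1 ^ 2 + ε * poly n a p,
   p.1 + p.2 + 2 * p.1 * p.2 + 3 * lam * p.1 ^ 2 + 2 * lam * p.1 ^ 3 + ε * poly n b p)

/-- The closed subannulus `{c ≤ H ≤ d}` of the period annulus `⋃_{h > 0} {H = h}`. -/
def subannulus (lam c d : ℝ) : Set (ℝ × ℝ) := {p | c ≤ ham lam p ∧ ham lam p ≤ d}

/-- Counterclockwise parametrization, by `θ ∈ [0, 2π]`, of the oval `Γ_h = {H = h}`: it is the union
of the arcs `y = -λ x² - λ x ± √((λ² - λ) x² + 2 λ h)` over `|x| ≤ √(2 h / (1 - λ))`. -/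
def oval (lam h θ : ℝ) : ℝ × ℝ :=
  let x := √(2 * h / (1 - lam)) * Real.cos θ
  (x, -lam * x ^ 2 - lam * x + √(2 * lam * h) * Real.sin θ)

/-- The Abelian integral `I(h) = ∮_{Γ_h} g dx - f dy`, with `f = poly n a` and `g = poly n b`. -/
def abelianIntegral (lam : ℝ) (n : ℕ) (a b : ℕ → ℕ → ℝ) (h : ℝ) : ℝ :=
  ∫ θ in (0 : ℝ)..(2 * Real.pi),
    (poly n b (oval lam h θ) * deriv (fun s => (oval lam h s).1) θ
      - poly n a (oval lam h θ) * deriv (fun s => (oval lam h s).2) θ)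

/-! ### Checks on the parametrization of the ovals -/

theorem ham_eq {lam : ℝ} (h0 : 0 < lam) (p : ℝ × ℝ) :
    ham lam p = (p.2 + lam * p.1 + lam * p.1 ^ 2) ^ 2 / (2 * lam)
      + (1 - lam) / 2 * p.1 ^ 2 := by
  unfold ham
  field_simp
  ring

/-- The curve `oval lam h` traces out exactly the level curve `{H = h}`. -/
theorem range_oval {lam h : ℝ} (h0 : 0 < lam) (h1 : lam < 1) (hh : 0 < h) :
    range (oval lam h) = {p | ham lam p = h} := by
  have h1' : 0 < 1 - lam := by linarith
  have hA : 0 < 2 * h / (1 - lam) := by positivity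
  have hB : 0 < 2 * lam * h := by positivity
  have sA := Real.sq_sqrt hA.le
  have sB := Real.sq_sqrt hB.le
  have pA := Real.sqrt_pos.2 hA
  have pB := Real.sqrt_pos.2 hB
  ext p
  constructor
  · rintro ⟨θ, rfl⟩
    rw [mem_ofPred_eq, ham_eq h0]
    simp only [oval]
    generalize √(2 * h / (1 - lam)) = A at *
    generalize √(2 * lam * h) = B at *
    have e : (-lam * (A * Real.cos θ) ^ 2 - lam * (A * Real.cos θ) + B * Real.sin θ
        + lam * (A * Real.cos θ) + lam * (A * Real.cos θ) ^ 2) = B * Real.sin θ := by ring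
    rw [e, mul_pow, mul_pow, sA, sB, Real.sin_sq]
    field_simp
    ring
  · intro hp
    rw [mem_ofPred_eq, ham_eq h0] at hp
    simp only [mem_range, oval]
    generalize √(2 * h / (1 - lam)) = A at *
    generalize √(2 * lam * h) = B at *
    obtain ⟨x, y⟩ := p
    simp only at hp
    set z : ℂ := ⟨x / A, (y + lam * x + lam * x ^ 2) / B⟩ with hz
    have hn : Complex.normSq z = 1 := by
      rw [Complex.normSq_apply]
      simp only [hz]
      rw [← pow_two, ← pow_two, div_pow, div_pow, sA, sB]
      field_simp at hp ⊢
      linarith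
    have hz1 : ‖z‖ = 1 := by
      have := Complex.normSq_eq_norm_sq z
      rw [hn] at this
      nlinarith [norm_nonneg z]
    have hz0 : z ≠ 0 := by
      intro hz'
      rw [hz', norm_zero] at hz1
      exact zero_ne_one hz1
    refine ⟨z.arg, ?_⟩
    have hc : Real.cos z.arg = x / A := by
      rw [Complex.cos_arg hz0, hz1, div_one]
    have hs : Real.sin z.arg = (y + lam * x + lam * x ^ 2) / B := by
      rw [Complex.sin_arg, hz1, div_one]
    rw [hc, hs, mul_div_cancel₀ _ pA.ne', mul_div_cancel₀ _ pB.ne']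
    ext
    · rfl
    · simp only
      ring

end IsochronousCubic

end

noncomputable section

namespace IsochronousCubic

/-! ### Zeros and their orders -/

/-! The coordinates `X = √(1 - λ) x`, `Y = (y + λ x + λ x²) / √λ` have a constant Jacobian and turn
`H` into `(X² + Y²) / 2`. In `z = Y - i X` the system becomes `z' = i k z + ε F(z)` with `k = √(1 -
λ) / √λ` (`perturbedRotation_toComplex`), so the unperturbed flow is a rigid rotation.

In these coordinates `I(h)` is a constant times the integral of the radial part of the perturbation
over the circle of radius `√(2h)`. Let `X` and `Y` have weights 1 and 2; then so do `x` and `y`, and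
`f`, `g` have weight at most `2n`. Only monomials even in both variables have nonzero circular
moments. By parity, those that survive in the radial part have ordinary degree at most `2n`. Hence
`I(h) = c h Q(h)` with `c ≠ 0` and `deg Q < n` (`hasMoments_radialPart`). Conversely, `λ x + y = √λ
Y - λ X² / (1 - λ)`, and its powers produce a `Q` of each exact degree, so every `Q` of degree less
than `n` occurs (`exists_radialPart_moments_eq`).

The inverse function theorem, applied to the integral equation for curves in the rotating frame,
gives a return map `ρ + ε D(ρ, ε)` with `D` jointly smooth and `D(ρ, 0) = ρ Q(ρ² / 2) / k`
(`exists_isLocalReturn`). A zero of order `m` of `D(·, 0)` has a nonvanishing `m`-th derivative.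
This persists for small `ε`, and Rolle's theorem then allows at most `m` zeros nearby, counted with
multiplicity (`exists_sum_order_le_of_hasZeroOfOrder`). Every closed orbit in the subannulus winds
once around the origin and stays close to a circle (`exists_section_of_periodic`), so it is a zero
of one of finitely many such `D(·, ε)`. The orders add up to at most the number of roots of `Q`.
Simple roots persist, so a `Q` with `n - 1` simple positive roots attains the bound.

For `n = 1` the equation for `x` has constant damping. If the damping is nonzero, an energy is
strictly monotone along nonconstant solutions. If it is zero, the energy is a first integral, so
closed orbits are not isolated (`not_isLimitCycle_of_affine`). -/

theorem sum_order_le_of_iteratedDeriv_ne_zero {J : Set ℝ} (hJ : J.OrdConnected) (hJo : IsOpen J)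
    (m : ℕ) : ∀ {f : ℝ → ℝ}, ContDiffOn ℝ m f J → (∀ x ∈ J, iteratedDeriv m f x ≠ 0) →
    ∀ (Z : Finset ℝ) (k : ℝ → ℕ), (∀ z ∈ Z, z ∈ J) →
      (∀ z ∈ Z, ∀ j < k z, iteratedDeriv j f z = 0) → ∑ z ∈ Z, k z ≤ m := by
  induction m with
  | zero =>
    intro f _ hne Z k hZ hk
    refine (Finset.sum_eq_zero fun z hz => ?_).le
    by_contra h
    exact hne z (hZ z hz) (hk z hz 0 (Nat.pos_of_ne_zero h))
  | succ m ih =>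
    intro f hf hne Z k hZ hk
    have hf' : ContDiffOn ℝ m (deriv f) J := by
      have :=
        (contDiffOn_succ_iff_deriv_of_isOpen (n := ((m : ℕ) : WithTop ℕ∞)) hJo).1
          (by exact_mod_cast hf)
      exact this.2.2
    have hdiff : DifferentiableOn ℝ f J := hf.differentiableOn (by simp)
    set Z₁ := Z.filter (fun z => 0 < k z) with hZ₁
    have hsum : ∑ z ∈ Z, k z = ∑ z ∈ Z₁, k z := by
      rw [hZ₁, Finset.sum_filter_of_ne]
      intro z _ hz
      exact Nat.pos_of_ne_zero hz
    rw [hsum]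
    rcases Z₁.eq_empty_or_nonempty with h0 | hne₁
    · simp [h0]
    have hmem : ∀ z ∈ Z₁, z ∈ Z ∧ 0 < k z := fun z hz => by simpa [hZ₁] using hz
    set M := Z₁.max' hne₁ with hM
    have hMm : M ∈ Z₁ := Z₁.max'_mem hne₁
    -- A Rolle point between `z` and its successor in `Z₁`. Lying below every later zero makes these
    -- points distinct and disjoint from `Z₁`.
    have hξ : ∀ z, ∃ ξ, z ∈ Z₁.erase M → z < ξ ∧ (∀ w ∈ Z₁, z < w → ξ < w) ∧ deriv f ξ = 0 := by
      intro z
      by_cases hz : z ∈ Z₁.erase M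
      swap
      · exact ⟨0, fun h => absurd h hz⟩
      have hz₁ := Finset.mem_of_mem_erase hz
      have hzM : z < M := lt_of_le_of_ne (Z₁.le_max' z hz₁) (Finset.ne_of_mem_erase hz)
      have hne₂ : (Z₁.filter (fun w => z < w)).Nonempty := ⟨M, by simp [hMm, hzM]⟩
      set w := (Z₁.filter (fun w => z < w)).min' hne₂
      have hw : w ∈ Z₁ ∧ z < w := by
        exact Finset.mem_filter.1 ((Z₁.filter (fun w => z < w)).min'_mem hne₂)
      have hsub : Icc z w ⊆ J := hJ.out (hZ z (hmem z hz₁).1) (hZ w (hmem w hw.1).1)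
      have e : ∀ y ∈ Z₁, f y = 0 := fun y hy => by
        simpa using hk y (hmem y hy).1 0 (hmem y hy).2
      obtain ⟨ξ, hξ, hd⟩ := exists_deriv_eq_zero hw.2 (hdiff.continuousOn.mono hsub)
        ((e z hz₁).trans (e w hw.1).symm)
      refine ⟨ξ, fun _ => ⟨hξ.1, fun y hy hzy => hξ.2.trans_le ?_, hd⟩⟩
      exact Finset.min'_le _ _ (by simp [hy, hzy])
    choose ξ hξ using hξ
    have hinj : Set.InjOn ξ (Z₁.erase M) := by
      intro a ha b hb hab
      by_contra hne
      rcases lt_or_gt_of_ne hne with h | h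
      · have := (hξ a ha).2.1 b (Finset.mem_of_mem_erase hb) h
        have := (hξ b hb).1
        linarith
      · have := (hξ b hb).2.1 a (Finset.mem_of_mem_erase ha) h
        have := (hξ a ha).1
        linarith
    have hnot : ∀ z ∈ Z₁.erase M, ξ z ∉ Z₁ := fun z hz h =>
      lt_irrefl _ ((hξ z hz).2.1 _ h (hξ z hz).1)
    have hdisj : Disjoint Z₁ ((Z₁.erase M).image ξ) := by
      rw [Finset.disjoint_right]
      intro x hx
      obtain ⟨z, hz, rfl⟩ := Finset.mem_image.1 hx
      exact hnot z hz
    -- The derivative keeps order `k - 1` at each zero and gains one zero in each of the `card - 1`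
    -- gaps, so its total is one less than that of `f`.
    have key := ih hf' (fun x hx => by rw [← iteratedDeriv_succ']; exact hne x hx)
      (Z₁ ∪ (Z₁.erase M).image ξ) (fun x => if x ∈ Z₁ then k x - 1 else 1) ?_ ?_
    · rw [Finset.sum_union hdisj] at key
      have e1 : ∑ x ∈ Z₁, (if x ∈ Z₁ then k x - 1 else 1) = ∑ x ∈ Z₁, (k x - 1) :=
        Finset.sum_congr rfl fun x hx => by simp [hx]
      have e2 : ∑ x ∈ (Z₁.erase M).image ξ, (if x ∈ Z₁ then k x - 1 else 1) = Z₁.card - 1 := by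
        rw [Finset.sum_image hinj, ← Finset.card_erase_of_mem hMm, Finset.card_eq_sum_ones]
        exact Finset.sum_congr rfl fun x hx => by simp [hnot x hx]
      have e3 : ∑ x ∈ Z₁, k x = ∑ x ∈ Z₁, (k x - 1) + Z₁.card := by
        rw [Finset.card_eq_sum_ones, ← Finset.sum_add_distrib]
        exact Finset.sum_congr rfl fun x hx => by have := (hmem x hx).2; omega
      have : 0 < Z₁.card := hne₁.card_pos
      omega
    · intro x hx
      rcases Finset.mem_union.1 hx with h | h
      · exact hZ x (hmem x h).1
      · obtain ⟨z, hz, rfl⟩ := Finset.mem_image.1 h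
        have hz₁ := Finset.mem_of_mem_erase hz
        have hzM : z < M := lt_of_le_of_ne (Z₁.le_max' z hz₁) (Finset.ne_of_mem_erase hz)
        exact hJ.out (hZ z (hmem z hz₁).1) (hZ M (hmem M hMm).1)
          ⟨(hξ z hz).1.le, ((hξ z hz).2.1 M hMm hzM).le⟩
    · intro x hx j hj
      rw [← iteratedDeriv_succ']
      by_cases h : x ∈ Z₁
      · simp only [h, if_true] at hj
        exact hk x (hmem x h).1 _ (by omega)
      · simp only [h, if_false] at hj
        rcases Finset.mem_union.1 hx with h' | h'
        · exact absurd h' h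
        obtain ⟨z, hz, rfl⟩ := Finset.mem_image.1 h'
        have : j = 0 := by omega
        subst this
        simpa using (hξ z hz).2.2

/-- Each derivative in the first variable costs one order of joint smoothness. The case `i = 0`
supplies the joint continuity by which a nonzero derivative at `ε = 0` stays nonzero for small `ε`.
-/
theorem contDiffOn_iteratedDeriv_fst {D : ℝ × ℝ → ℝ} {O : Set (ℝ × ℝ)} (hO : IsOpen O) {q : ℕ}
    (hD : ContDiffOn ℝ q D O) : ∀ {j i : ℕ}, i + j = q →
    ContDiffOn ℝ i (fun p : ℝ × ℝ => iteratedDeriv j (fun r => D (r, p.2)) p.1) O := by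
  intro j
  induction j with
  | zero =>
    intro i h
    have : i = q := by omega
    subst this
    simpa using hD
  | succ j ih =>
    intro i h
    have h1 := ih (i := i + 1) (by omega)
    set G := fun p : ℝ × ℝ => iteratedDeriv j (fun r => D (r, p.2)) p.1 with hG
    have h2 : ContDiffOn ℝ i (fun p => fderiv ℝ G p (1, 0)) O :=
      (h1.fderiv_of_isOpen hO (m := i) (by exact_mod_cast le_rfl)).clm_apply contDiffOn_const
    refine h2.congr fun p hp => ?_
    rw [iteratedDeriv_succ]
    have hd : DifferentiableAt ℝ G p :=
      (h1.differentiableOn (by simp) p hp).differentiableAt (hO.mem_nhds hp)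
    have h3 : HasDerivAt (fun r : ℝ => (r, p.2)) ((1 : ℝ), (0 : ℝ)) p.1 :=
      (hasDerivAt_id _).prodMk (hasDerivAt_const _ _)
    have := HasFDerivAt.comp_hasDerivAt (x := p.1) (f := fun r : ℝ => (r, p.2)) (l := G)
      (l' := fderiv ℝ G p) (by exact hd.hasFDerivAt) h3
    exact this.deriv

theorem HasZeroOfOrder.congr {f g : ℝ → ℝ} {x : ℝ} {m : ℕ} (h : HasZeroOfOrder f x m)
    (hfg : f =ᶠ[𝓝 x] g) : HasZeroOfOrder g x m := by
  obtain ⟨h1, h2, h3⟩ := h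
  refine ⟨h1.congr_of_eventuallyEq hfg.symm, fun j hj => ?_, ?_⟩
  · rw [← hfg.iteratedDeriv_eq]; exact h2 j hj
  · rw [← hfg.iteratedDeriv_eq]; exact h3

theorem iteratedDeriv_polynomial (p : Polynomial ℝ) (j : ℕ) :
    iteratedDeriv j (fun y => p.eval y) = fun y => (Polynomial.derivative^[j] p).eval y := by
  induction j with
  | zero => simp
  | succ j ih =>
    rw [iteratedDeriv_succ, ih, Function.iterate_succ_apply']
    ext y
    simp

theorem hasZeroOfOrder_polynomial {p : Polynomial ℝ} (hp : p ≠ 0) (x : ℝ) :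
    HasZeroOfOrder (fun y => p.eval y) x (p.rootMultiplicity x) := by
  refine ⟨by simpa using (p.contDiff_aeval (𝕜 := ℝ) _).contDiffAt, fun j hj => ?_, ?_⟩
  · rw [iteratedDeriv_polynomial]
    exact Polynomial.isRoot_iterate_derivative_of_lt_rootMultiplicity hj
  · rw [iteratedDeriv_polynomial]
    simp only
    rw [Polynomial.eval_iterate_derivative_rootMultiplicity]
    have := Polynomial.eval_divByMonic_pow_rootMultiplicity_ne_zero x hp
    have hf := (p.rootMultiplicity x).factorial_ne_zero
    simp [this, hf]

/-- Transfers the order of a zero `ρ` of `D(·, ε)` to the displacement function `s ↦ ε D(ρ + s, ε)`.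
-/
theorem HasZeroOfOrder.const_mul_comp_add {f : ℝ → ℝ} {x c : ℝ} {m : ℕ} (h : HasZeroOfOrder f x m)
    (hc : c ≠ 0) : HasZeroOfOrder (fun s => c * f (x + s)) 0 m := by
  obtain ⟨h1, h2, h3⟩ := h
  have e : ∀ j, iteratedDeriv j (fun s => c * f (x + s)) 0 = c * iteratedDeriv j f x := by
    intro j
    rw [iteratedDeriv_const_mul_field, iteratedDeriv_comp_const_add]
    simp
  refine ⟨?_, fun j hj => ?_, ?_⟩
  · refine contDiffAt_const.mul (ContDiffAt.comp (0 : ℝ) ?_ (by fun_prop))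
    simpa using h1
  · rw [e, h2 j hj, mul_zero]
  · rw [e]; exact mul_ne_zero hc h3

section

/-! ### Solutions of autonomous systems -/

/-- The set where the solutions agree is closed by continuity and open by local uniqueness. A global
Lipschitz bound is not available, since the fields are cubic or worse. -/
theorem solution_unique {E : Type*} [NormedAddCommGroup E] [NormedSpace ℝ E] {X : E → E}
    (hX : ContDiff ℝ 1 X) {f g : ℝ → E} (hf : ∀ t, HasDerivAt f (X (f t)) t)
    (hg : ∀ t, HasDerivAt g (X (g t)) t) {t₀ : ℝ} (h : f t₀ = g t₀) : f = g := by
  have cf : Continuous f := continuous_iff_continuousAt.2 fun t => (hf t).continuousAt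
  have cg : Continuous g := continuous_iff_continuousAt.2 fun t => (hg t).continuousAt
  have hcl : IsClosed {t | f t = g t} := isClosed_eq cf cg
  have hop : IsOpen {t | f t = g t} := by
    rw [isOpen_iff_mem_nhds]
    intro t ht
    obtain ⟨K, s, hs, hK⟩ := (hX.contDiffAt (x := f t)).exists_lipschitzOnWith
    have h1 : ∀ᶠ r in 𝓝 t, f r ∈ s := cf.continuousAt.eventually hs
    have h2 : ∀ᶠ r in 𝓝 t, g r ∈ s :=
      cg.continuousAt.eventually (by rw [← show f t = g t from ht]; exact hs)
    exact ODE_solution_unique_of_eventually (v := fun _ => X) (s := fun _ => s) (K := K)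
      (Eventually.of_forall fun _ => hK) (h1.mono fun r hr => ⟨hf r, hr⟩)
      (h2.mono fun r hr => ⟨hg r, hr⟩) ht
  have := IsClopen.eq_univ ⟨hcl, hop⟩ ⟨t₀, h⟩
  ext1 t
  have ht : t ∈ {t | f t = g t} := by rw [this]; trivial
  exact ht

theorem hasDerivAt_shift {E : Type*} [NormedAddCommGroup E] [NormedSpace ℝ E] {X : E → E}
    {f : ℝ → E} (hf : ∀ t, HasDerivAt f (X (f t)) t) (c : ℝ) (t : ℝ) :
    HasDerivAt (fun t => f (t + c)) (X (f (t + c))) t :=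
  (hf (t + c)).comp_add_const t c

variable {X : ℝ × ℝ → ℝ × ℝ}

theorem IsPeriodicSolution.continuous {γ : ℝ → ℝ × ℝ} {T : ℝ} (h : IsPeriodicSolution X γ T) :
    Continuous γ :=
  continuous_iff_continuousAt.2 fun t => (h.1 t).continuousAt

theorem IsPeriodicSolution.le_of_eq (hX : ContDiff ℝ 1 X) {γ : ℝ → ℝ × ℝ} {T : ℝ}
    (h : IsPeriodicSolution X γ T) {s t : ℝ} (hst : s < t) (he : γ s = γ t) :
    Function.Periodic γ (t - s) ∧ T ≤ t - s := by
  have h1 : (fun r => γ (r + (t - s))) = γ :=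
    solution_unique hX (hasDerivAt_shift h.1 _) h.1 (t₀ := s) (by simp [he])
  refine ⟨fun r => congrFun h1 r, ?_⟩
  by_contra hlt
  refine h.2.2.2 (t - s) ⟨by linarith, by linarith⟩ ?_
  simpa using congrFun h1 0

theorem IsPeriodicSolution.shift (hX : ContDiff ℝ 1 X) {γ : ℝ → ℝ × ℝ} {T : ℝ}
    (h : IsPeriodicSolution X γ T) (c : ℝ) : IsPeriodicSolution X (fun t => γ (t + c)) T := by
  refine ⟨hasDerivAt_shift h.1 c, h.2.1, fun t => ?_, fun t ht he => ?_⟩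
  · simp only
    rw [show t + T + c = t + c + T by ring, h.2.2.1]
  · have := (h.le_of_eq hX (s := 0 + c) (t := t + c) (by linarith [ht.1]) he.symm).2
    linarith [ht.2]

theorem range_shift {α : Type*} (γ : ℝ → α) (c : ℝ) : range (fun t => γ (t + c)) = range γ :=
  (Equiv.addRight c).surjective.range_comp γ

theorem IsClosedOrbit.eq_of_mem (hX : ContDiff ℝ 1 X) {Γ Γ' : Set (ℝ × ℝ)}
    (h : IsClosedOrbit X Γ) (h' : IsClosedOrbit X Γ') {p : ℝ × ℝ} (hp : p ∈ Γ) (hp' : p ∈ Γ') :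
    Γ = Γ' := by
  obtain ⟨γ, T, hγ, rfl⟩ := h
  obtain ⟨γ', T', hγ', rfl⟩ := h'
  obtain ⟨a, rfl⟩ := hp
  obtain ⟨b, hb⟩ := hp'
  have := solution_unique hX (hasDerivAt_shift hγ.1 a) (hasDerivAt_shift hγ'.1 b) (t₀ := 0)
    (by simp [hb])
  rw [← range_shift γ a, this, range_shift γ' b]

/-- The `τ`-periodic extension of the restriction of `γ` to `[0, τ)`. -/
def periodicExtension {α : Type*} (γ : ℝ → α) (τ : ℝ) (t : ℝ) : α := γ (t - ⌊t / τ⌋ * τ)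

/-- The closing condition `γ τ = γ 0` makes the formula valid at both ends of a cell, so that
one-sided derivatives can be glued at multiples of `τ`. -/
theorem periodicExtension_eq {α : Type*} {γ : ℝ → α} {τ : ℝ} (hτ : 0 < τ) (h : γ τ = γ 0) (n : ℤ)
    {t : ℝ} (ht : t ∈ Icc (n * τ) ((n + 1) * τ)) :
    periodicExtension γ τ t = γ (t - n * τ) := by
  unfold periodicExtension
  rcases ht.2.lt_or_eq with h1 | h1
  · have : ⌊t / τ⌋ = n := by
      rw [Int.floor_eq_iff]
      exact ⟨(le_div_iff₀ hτ).2 ht.1, (div_lt_iff₀ hτ).2 h1⟩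
    rw [this]
  · have : ⌊t / τ⌋ = n + 1 := by
      rw [h1, mul_div_cancel_right₀ _ hτ.ne']
      exact_mod_cast Int.floor_intCast (n + 1)
    rw [this, h1]
    push_cast
    rw [sub_self, ← h]
    congr 1
    ring

theorem periodicExtension_periodic {α : Type*} (γ : ℝ → α) {τ : ℝ} (hτ : 0 < τ) :
    Function.Periodic (periodicExtension γ τ) τ := by
  intro t
  unfold periodicExtension
  rw [add_div, div_self hτ.ne', Int.floor_add_one]
  congr 1
  push_cast
  ring

theorem hasDerivAt_periodicExtension {γ : ℝ → ℝ × ℝ} {τ : ℝ} (hτ : 0 < τ) (h : γ τ = γ 0)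
    (hγ : ∀ t ∈ Icc 0 τ, HasDerivWithinAt γ (X (γ t)) (Icc 0 τ) t) (t : ℝ) :
    HasDerivAt (periodicExtension γ τ) (X (periodicExtension γ τ t)) t := by
  have cell : ∀ n : ℤ, ∀ t ∈ Icc (n * τ) ((n + 1) * τ),
      HasDerivWithinAt (periodicExtension γ τ) (X (periodicExtension γ τ t))
        (Icc (n * τ) ((n + 1) * τ)) t := by
    intro n t ht
    have hmaps : ∀ s ∈ Icc (n * τ) ((n + 1) * τ), s - n * τ ∈ Icc 0 τ := fun s hs =>
      ⟨by linarith [hs.1], by linarith [hs.2]⟩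
    rw [periodicExtension_eq hτ h n ht]
    have h1 := HasDerivWithinAt.scomp t (hγ _ (hmaps t ht))
      (((hasDerivAt_id t).sub_const (n * τ)).hasDerivWithinAt) hmaps
    rw [one_smul] at h1
    exact h1.congr (fun s hs => periodicExtension_eq hτ h n hs) (periodicExtension_eq hτ h n ht)
  set n := ⌊t / τ⌋ with hn
  have h1 : n * τ ≤ t := (le_div_iff₀ hτ).1 (Int.floor_le _)
  have h2 : t < (n + 1) * τ := (div_lt_iff₀ hτ).1 (Int.lt_floor_add_one _)
  rcases h1.lt_or_eq with h1' | h1'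
  · exact (cell n t ⟨h1, h2.le⟩).hasDerivAt (Icc_mem_nhds h1' h2)
  -- At a multiple of `τ` the derivatives within the two adjacent cells coincide and combine.
  · have c1 := cell n t ⟨h1, h2.le⟩
    have c2 := cell (n - 1) t ⟨by push_cast; linarith, by push_cast; linarith⟩
    refine (c2.union c1).hasDerivAt ?_
    push_cast
    rw [sub_add_cancel, Icc_union_Icc_eq_Icc (by linarith) (by linarith)]
    exact Icc_mem_nhds (by linarith) h2

/-- The nonzero velocity at the start excludes returns before some time `η`. The return times in
`[η, τ]` then form a nonempty compact set, whose minimum is the least period. -/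
theorem exists_isPeriodicSolution (hX : ContDiff ℝ 1 X) {γ : ℝ → ℝ × ℝ} {τ : ℝ} (hτ : 0 < τ)
    (h : γ τ = γ 0) (hγ : ∀ t ∈ Icc 0 τ, HasDerivWithinAt γ (X (γ t)) (Icc 0 τ) t)
    (h0 : X (γ 0) ≠ 0) :
    ∃ γ' T, IsPeriodicSolution X γ' T ∧ range γ' = γ '' Icc 0 τ := by
  set δ := periodicExtension γ τ with hδ
  have hd : ∀ t, HasDerivAt δ (X (δ t)) t := hasDerivAt_periodicExtension hτ h hγ
  have hp : Function.Periodic δ τ := periodicExtension_periodic γ hτ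
  have e : ∀ t ∈ Icc 0 τ, δ t = γ t := by
    intro t ht
    have := periodicExtension_eq (t := t) hτ h 0 (by simpa using ht)
    simpa using this
  have e0 : δ 0 = γ 0 := e 0 ⟨le_rfl, hτ.le⟩
  have hr : range δ = γ '' Icc 0 τ := by
    rw [← hp.image_Icc hτ 0, zero_add]
    exact image_congr e
  have cδ : Continuous δ := continuous_iff_continuousAt.2 fun t => (hd t).continuousAt
  have hne : ∀ᶠ t in 𝓝[≠] (0 : ℝ), δ t ≠ δ 0 := (hd 0).eventually_ne (by rwa [e0])
  obtain ⟨η, hη, hη'⟩ := Metric.eventually_nhds_iff.1 (eventually_nhdsWithin_iff.1 hne)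
  have hS : IsCompact (Icc η τ ∩ {t | δ t = δ 0}) :=
    isCompact_Icc.inter_right (isClosed_eq cδ continuous_const)
  have hδτ : δ τ = δ 0 := by simpa using hp 0
  have hητ : η ≤ τ := by
    by_contra hlt
    exact hη' (y := τ) (by rw [Real.dist_eq, sub_zero, abs_of_pos hτ]; linarith) hτ.ne' hδτ
  obtain ⟨T, ⟨⟨hT1, hT2⟩, hT3⟩, hT4⟩ := hS.exists_isLeast ⟨τ, ⟨hητ, le_rfl⟩, hδτ⟩
  have hT0 : 0 < T := by linarith
  refine ⟨δ, T, ⟨hd, hT0, fun t => ?_, fun t ht he => ?_⟩, hr⟩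
  · exact congrFun (solution_unique hX (hasDerivAt_shift hd T) hd (t₀ := 0)
      (by simpa using hT3)) t
  · rcases lt_or_ge t η with hlt | hge
    · exact hη' (y := t) (by rw [Real.dist_eq, sub_zero, abs_of_pos ht.1]; exact hlt) ht.1.ne' he
    · exact absurd (hT4 ⟨⟨hge, by linarith [ht.2]⟩, he⟩) (not_le.2 ht.2)

end

/-! ### Continuous dependence on the initial point -/

/-- In the sup norm the ball is a square. Clamping each coordinate is nonexpansive and retracts the
plane onto it, so composing the field with the clamp gives the extension. -/
theorem exists_lipschitzWith_eqOn_closedBall {X : ℝ × ℝ → ℝ × ℝ} (hX : ContDiff ℝ 1 X) {R : ℝ}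
    (hR : 0 ≤ R) : ∃ (Y : ℝ × ℝ → ℝ × ℝ) (K B : NNReal), LipschitzWith K Y ∧ (∀ p, ‖Y p‖ ≤ B) ∧
      EqOn Y X (Metric.closedBall 0 R) := by
  set c : ℝ × ℝ → ℝ × ℝ := fun p => (max (-R) (min R p.1), max (-R) (min R p.2)) with hc
  have cl : LipschitzWith 1 c := by
    have h1 : LipschitzWith 1 (fun x : ℝ => max (-R) (min R x)) :=
      (LipschitzWith.id.const_min R).const_max (-R)
    have := (h1.comp LipschitzWith.prod_fst).prodMk (h1.comp LipschitzWith.prod_snd)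
    simpa using this
  have cm : ∀ p, c p ∈ Metric.closedBall (0 : ℝ × ℝ) R := by
    intro p
    have h : ∀ x : ℝ, |max (-R) (min R x)| ≤ R := fun x =>
      abs_le.2 ⟨le_max_left _ _, max_le (by linarith) (min_le_left _ _)⟩
    rw [mem_closedBall_zero_iff, Prod.norm_def]
    exact max_le (h _) (h _)
  have ce : ∀ p ∈ Metric.closedBall (0 : ℝ × ℝ) R, c p = p := by
    intro p hp
    rw [mem_closedBall_zero_iff, Prod.norm_def] at hp
    have h1 := abs_le.1 ((le_max_left _ _).trans hp)
    have h2 := abs_le.1 ((le_max_right _ _).trans hp)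
    simp [hc, min_eq_right h1.2, min_eq_right h2.2, max_eq_right h1.1, max_eq_right h2.1]
  have hK : IsCompact (Metric.closedBall (0 : ℝ × ℝ) R) := isCompact_closedBall _ _
  obtain ⟨K, hLip⟩ := LocallyLipschitzOn.exists_lipschitzOnWith_of_compact hK
    (hX.locallyLipschitz.locallyLipschitzOn)
  obtain ⟨B, hB⟩ := hK.exists_bound_of_continuousOn hX.continuous.continuousOn
  refine ⟨X ∘ c, K, B.toNNReal, ?_, fun p => ?_, fun p hp => by simp [ce p hp]⟩
  · have := (hLip.comp (cl.lipschitzOnWith (s := univ)) (fun p _ => cm p))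
    rw [mul_one, lipschitzOnWith_univ] at this
    exact this
  · exact (hB _ (cm p)).trans (Real.le_coe_toNNReal B)

/-- Picard–Lindelöf solves the truncated field on all of `[0, T]`. Grönwall's inequality keeps the
solution within `η` of `γ`, hence in the ball where the truncated field is the original one. -/
theorem exists_solution_near {X : ℝ × ℝ → ℝ × ℝ} (hX : ContDiff ℝ 1 X) {γ : ℝ → ℝ × ℝ}
    (hγ : ∀ t, HasDerivAt γ (X (γ t)) t) {T η : ℝ} (hT : 0 ≤ T) (hη : 0 < η) :
    ∃ δ > 0, ∀ q, dist q (γ 0) < δ → ∃ z : ℝ → ℝ × ℝ, z 0 = q ∧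
      (∀ t ∈ Icc 0 T, HasDerivWithinAt z (X (z t)) (Icc 0 T) t) ∧
      ∀ t ∈ Icc 0 T, dist (z t) (γ t) < η := by
  have cγ : Continuous γ := continuous_iff_continuousAt.2 fun t => (hγ t).continuousAt
  obtain ⟨R₀, hR₀⟩ := (isCompact_Icc (a := 0) (b := T)).exists_bound_of_continuousOn
    cγ.continuousOn
  have hR₀' : 0 ≤ R₀ := (norm_nonneg _).trans (hR₀ 0 ⟨le_rfl, hT⟩)
  obtain ⟨Y, K, B, hLip, hB, hYX⟩ := exists_lipschitzWith_eqOn_closedBall hX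
    (R := R₀ + η) (by linarith)
  have hpos := Real.exp_pos (K * T)
  -- Grönwall's factor `exp (K T)` turns this initial distance into at most `η / 2`.
  refine ⟨η / 2 / Real.exp (K * T), by positivity, fun q hq => ?_⟩
  have hPL : IsPicardLindelof (fun _ => Y) (⟨0, le_rfl, hT⟩ : Icc 0 T) q (B * T.toNNReal) 0 B K :=
    IsPicardLindelof.of_time_independent (fun x _ => hB x) hLip.lipschitzOnWith (by
      simp [Real.coe_toNNReal _ hT, max_eq_left hT])
  obtain ⟨z, hz0, hz⟩ := hPL.exists_eq_forall_mem_Icc_hasDerivWithinAt₀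
  have toIci : ∀ {f : ℝ → ℝ × ℝ} {f' : ℝ × ℝ} {t : ℝ}, t ∈ Ico 0 T →
      HasDerivWithinAt f f' (Icc 0 T) t → HasDerivWithinAt f f' (Ici t) t := fun ht h =>
    h.mono_of_mem_nhdsWithin (Icc_mem_nhdsGE_of_mem ht)
  have hclose : ∀ t ∈ Icc 0 T, dist (z t) (γ t) < η := by
    intro t ht
    have := dist_le_of_trajectories_ODE (v := fun _ => Y) (K := K) (f := z) (g := γ) (a := 0)
      (b := T) (δ := η / 2 / Real.exp (K * T)) (fun _ => hLip)
      (fun t ht => (hz t ht).continuousWithinAt)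
      (fun t ht => toIci ht (hz t (Ico_subset_Icc_self ht))) cγ.continuousOn
      (fun t ht => by
        have : γ t ∈ Metric.closedBall (0 : ℝ × ℝ) (R₀ + η) := by
          rw [mem_closedBall_zero_iff]
          linarith [hR₀ t (Ico_subset_Icc_self ht)]
        rw [hYX this]
        exact (hγ t).hasDerivWithinAt)
      (by
        have : z 0 = q := hz0
        rw [this]; exact hq.le) t ht
    have h2 : Real.exp (K * (t - 0)) ≤ Real.exp (K * T) := by
      rw [sub_zero]; gcongr; exact ht.2
    calc dist (z t) (γ t) ≤ η / 2 / Real.exp (K * T) * Real.exp (K * (t - 0)) := this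
      _ ≤ η / 2 / Real.exp (K * T) * Real.exp (K * T) := by gcongr
      _ = η / 2 := by field_simp
      _ < η := by linarith
  refine ⟨z, hz0, fun t ht => ?_, hclose⟩
  have h1 := hz t ht
  have : z t ∈ Metric.closedBall (0 : ℝ × ℝ) (R₀ + η) := by
    rw [mem_closedBall_zero_iff]
    have h2 := hR₀ t ht
    have h3 := hclose t ht
    rw [dist_eq_norm] at h3
    have h4 := norm_le_norm_add_norm_sub' (z t) (γ t)
    linarith
  rwa [hYX this] at h1

/-! ### Closed orbits of systems with a first integral -/

theorem IsPeriodicSolution.field_ne_zero {X : ℝ × ℝ → ℝ × ℝ} (hX : ContDiff ℝ 1 X)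
    {γ : ℝ → ℝ × ℝ} {T : ℝ} (h : IsPeriodicSolution X γ T) (t : ℝ) : X (γ t) ≠ 0 := by
  intro h0
  have : γ = fun _ => γ t := solution_unique hX h.1 (g := fun _ => γ t) (t₀ := t)
    (fun s => by rw [h0]; exact hasDerivAt_const _ _) rfl
  have hT := h.2.1
  refine h.2.2.2 (T / 2) ⟨by linarith, by linarith⟩ ?_
  rw [this]

theorem firstIntegral_eq {X : ℝ × ℝ → ℝ × ℝ} {E : ℝ × ℝ → ℝ} (hE : ContDiff ℝ 1 E)
    (hEX : ∀ p, fderiv ℝ E p (X p) = 0) {z : ℝ → ℝ × ℝ} {T : ℝ}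
    (hz : ∀ t ∈ Icc 0 T, HasDerivWithinAt z (X (z t)) (Icc 0 T) t) :
    ∀ t ∈ Icc 0 T, E (z t) = E (z 0) := by
  have hd : ∀ t ∈ Icc 0 T, HasDerivWithinAt (E ∘ z) 0 (Icc 0 T) t := fun t ht => by
    have := ((hE.differentiable one_ne_zero (z t)).hasFDerivAt).comp_hasDerivWithinAt t (hz t ht)
    rwa [hEX] at this
  exact constant_of_has_deriv_right_zero (fun t ht => (hd t ht).continuousWithinAt) fun t ht =>
    (hd t (Ico_subset_Icc_self ht)).mono_of_mem_nhdsWithin (Icc_mem_nhdsGE_of_mem ht)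

theorem exists_injOn_ball_of_deriv_ne_zero {f : ℝ → ℝ} (hf : ContDiff ℝ 1 f) {x : ℝ}
    (h : deriv f x ≠ 0) : ∃ r > 0, InjOn f (Metric.ball x r) := by
  have : ∀ᶠ y in 𝓝 x, deriv f y ≠ 0 :=
    (hf.continuous_deriv le_rfl).continuousAt.eventually_ne h
  obtain ⟨r, hr, hr'⟩ := Metric.eventually_nhds_iff_ball.1 this
  have key : ∀ a ∈ Metric.ball x r, ∀ b ∈ Metric.ball x r, a < b → f a ≠ f b := by
    intro a ha b hb hab he
    obtain ⟨c, hc, hc'⟩ := exists_deriv_eq_zero hab hf.continuous.continuousOn he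
    refine hr' c ?_ hc'
    exact (convex_ball x r).ordConnected.out ha hb (Ioo_subset_Icc_self hc)
  refine ⟨r, hr, fun a ha b hb he => ?_⟩
  rcases lt_trichotomy a b with hlt | heq | hgt
  · exact absurd he (key a ha b hb hlt)
  · exact heq
  · exact absurd he.symm (key b hb a ha hgt)

/-- On a segment transversal to the orbit, `E` is injective, because its differential vanishes along
the orbit but is not zero. A nearby solution comes back to the segment with the same value of `E`,
hence to the same point. Closed orbits thus fill a neighbourhood of a given one. -/
theorem not_isLimitCycle_of_firstIntegral {X : ℝ × ℝ → ℝ × ℝ} (hX : ContDiff ℝ 1 X)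
    {E : ℝ × ℝ → ℝ} (hE : ContDiff ℝ 1 E) (hEX : ∀ p, fderiv ℝ E p (X p) = 0)
    (hreg : ∀ p, X p ≠ 0 → fderiv ℝ E p ≠ 0) (Γ : Set (ℝ × ℝ)) : ¬ IsLimitCycle X Γ := by
  rintro ⟨⟨γ, T, hγ, rfl⟩, U, hU, hΓU, hiso⟩
  have hT := hγ.2.1
  set p := γ 0 with hp
  have hXp : X p ≠ 0 := hγ.field_ne_zero hX 0
  set a := (X p).1 with ha
  set b := (X p).2 with hb
  have hN : 0 < a ^ 2 + b ^ 2 := by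
    by_contra hle
    have ha0 : a = 0 := by nlinarith [sq_nonneg a, sq_nonneg b]
    have hb0 : b = 0 := by nlinarith [sq_nonneg a, sq_nonneg b]
    exact hXp (Prod.ext ha0 hb0)
  set v : ℝ × ℝ := (-b, a) with hv
  -- Orthogonal decomposition along the flow and along the section direction `v`.
  have hdec : ∀ w : ℝ × ℝ, w = ((w.1 * a + w.2 * b) / (a ^ 2 + b ^ 2)) • X p
      + ((w.2 * a - w.1 * b) / (a ^ 2 + b ^ 2)) • v := by
    intro w
    ext
    · simp only [hv, Prod.fst_add, Prod.smul_fst, smul_eq_mul, ← ha]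
      field_simp
      ring
    · simp only [hv, Prod.snd_add, Prod.smul_snd, smul_eq_mul, ← hb]
      field_simp
      ring
  have hEv : fderiv ℝ E p v ≠ 0 := by
    intro h0
    refine hreg p hXp (ContinuousLinearMap.ext fun w => ?_)
    rw [hdec w, map_add, map_smul, map_smul, hEX, h0]
    simp
  set φ : ℝ → ℝ := fun s => E (p + s • v) with hφ
  have hφC : ContDiff ℝ 1 φ := hE.comp (by fun_prop)
  have hφd : deriv φ 0 ≠ 0 := by
    have h1 : HasDerivAt (fun s : ℝ => p + s • v) v 0 := by
      simpa using ((hasDerivAt_id (0 : ℝ)).smul_const v).const_add p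
    have h2 : HasFDerivAt E (fderiv ℝ E p) (p + (0 : ℝ) • v) := by
      rw [zero_smul, add_zero]
      exact (hE.differentiable one_ne_zero p).hasFDerivAt
    rw [show deriv φ 0 = fderiv ℝ E p v from (h2.comp_hasDerivAt (0 : ℝ) h1).deriv]
    exact hEv
  obtain ⟨r, hr, hinj⟩ := exists_injOn_ball_of_deriv_ne_zero hφC hφd
  -- a bound on the displacement that keeps the section coordinate in the ball of radius `r`
  have hcoord : ∃ η > 0, ∀ q : ℝ × ℝ, dist q p < η →
      |((q - p).2 * a - (q - p).1 * b) / (a ^ 2 + b ^ 2)| < r := by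
    have hc : ContinuousAt (fun q : ℝ × ℝ =>
        |((q - p).2 * a - (q - p).1 * b) / (a ^ 2 + b ^ 2)|) p := by fun_prop
    have : ∀ᶠ q in 𝓝 p, |((q - p).2 * a - (q - p).1 * b) / (a ^ 2 + b ^ 2)| < r :=
      hc.eventually_lt_const (by simpa using hr)
    exact Metric.eventually_nhds_iff.1 this
  obtain ⟨η₁, hη₁, hcoord⟩ := hcoord
  have hcomp : IsCompact (range γ) := by
    have := hγ.2.2.1.image_Icc hT 0
    rw [← this]
    exact isCompact_Icc.image hγ.continuous
  obtain ⟨η₂, hη₂, hthick⟩ := hcomp.exists_thickening_subset_open hU hΓU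
  -- times just before and just after the period
  set g : ℝ × ℝ → ℝ := fun q => (q - p).1 * a + (q - p).2 * b with hg
  have hgc : Continuous g := by fun_prop
  have hγT : γ T = p := by simpa using hγ.2.2.1 0
  have hgd : HasDerivAt (fun t => g (γ t)) (a ^ 2 + b ^ 2) T := by
    have h1 := hγ.1 T
    rw [hγT] at h1
    have h2 : HasDerivAt (fun t => (γ t).1) a T := h1.fst
    have h3 : HasDerivAt (fun t => (γ t).2) b T := h1.snd
    have := ((h2.sub_const p.1).mul_const a).add ((h3.sub_const p.2).mul_const b)
    convert! this using 1
    ring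
  have hgT : g (γ T) = 0 := by simp [hg, hγT]
  have hclose : ∀ᶠ t in 𝓝 T, dist (γ t) p < η₁ / 2 :=
    (hγ.continuous.continuousAt.dist continuousAt_const).eventually_lt_const
      (by rw [hγT, dist_self]; positivity)
  have hsl : ∀ᶠ t in 𝓝[≠] T, 0 < slope (fun t => g (γ t)) T t :=
    hgd.tendsto_slope.eventually_const_lt hN
  obtain ⟨σ₀, hσ₀, hσ⟩ := Metric.eventually_nhds_iff.1
    (hclose.and (eventually_nhdsWithin_iff.1 hsl))
  set σ := min (σ₀ / 2) (T / 2) with hσd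
  have hσ1 : 0 < σ := lt_min (by linarith) (by linarith)
  have hσ2 : σ < σ₀ := (min_le_left _ _).trans_lt (by linarith)
  have hσ3 : σ < T := (min_le_right _ _).trans_lt (by linarith)
  have hplus : 0 < g (γ (T + σ)) := by
    have := (hσ (y := T + σ) (by simp [abs_of_pos hσ1, hσ2])).2
      (by simp [hσ1.ne'])
    rw [slope_def_field, hgT, sub_zero, add_sub_cancel_left] at this
    exact (div_pos_iff_of_pos_right hσ1).1 this
  have hminus : g (γ (T - σ)) < 0 := by
    have := (hσ (y := T - σ) (by simp [abs_of_pos hσ1, hσ2])).2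
      (by simp [hσ1.ne'])
    rw [slope_def_field, hgT, sub_zero, sub_sub_cancel_left, div_neg, neg_pos] at this
    exact (div_neg_iff.1 this).elim (fun h => absurd h.2 (by linarith)) (fun h => h.1)
  have hgp : ∀ᶠ q in 𝓝 (γ (T + σ)), 0 < g q := hgc.continuousAt.eventually_const_lt hplus
  have hgm : ∀ᶠ q in 𝓝 (γ (T - σ)), g q < 0 := hgc.continuousAt.eventually_lt_const hminus
  obtain ⟨η₃, hη₃, hgp⟩ := Metric.eventually_nhds_iff.1 hgp
  obtain ⟨η₄, hη₄, hgm⟩ := Metric.eventually_nhds_iff.1 hgm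
  set η := min (min (η₁ / 2) η₂) (min η₃ η₄) with hη
  have hη0 : 0 < η := by positivity
  obtain ⟨δ, hδ, hnear⟩ := exists_solution_near hX hγ.1 (T := T + σ) (by linarith) hη0
  -- a nearby initial point on the section
  have hs : ∃ s : ℝ, s ≠ 0 ∧ |s| < r ∧ dist (p + s • v) p < δ ∧ X (p + s • v) ≠ 0 := by
    have hc : ContinuousAt (fun s : ℝ => p + s • v) 0 := by fun_prop
    have e1 : ∀ᶠ s : ℝ in 𝓝 0, dist (p + s • v) p < δ :=
      (hc.dist continuousAt_const).eventually_lt_const (by simpa using hδ)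
    have e2 : ∀ᶠ s : ℝ in 𝓝 0, X (p + s • v) ≠ 0 := by
      have : ContinuousAt (fun s : ℝ => X (p + s • v)) 0 :=
        (hX.continuous.comp (by fun_prop)).continuousAt
      exact this.eventually_ne (by simpa using hXp)
    have e3 : ∀ᶠ s : ℝ in 𝓝 0, |s| < r := by
      simpa [Real.norm_eq_abs] using! eventually_norm_sub_lt (0 : ℝ) hr
    obtain ⟨s, ⟨⟨h1, h2⟩, h3⟩, h4⟩ := ((((e1.and e2).and e3).filter_mono
      nhdsWithin_le_nhds).and (self_mem_nhdsWithin (s := {(0 : ℝ)}ᶜ))).exists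
    exact ⟨s, h4, h3, h1, h2⟩
  obtain ⟨s, hs0, hsr, hsδ, hsX⟩ := hs
  obtain ⟨z, hz0, hz, hzγ⟩ := hnear _ hsδ
  have hzc : ContinuousOn z (Icc 0 (T + σ)) := fun t ht => (hz t ht).continuousWithinAt
  obtain ⟨t₁, ht₁, hgt₁⟩ : (0 : ℝ) ∈ (fun t => g (z t)) '' Icc (T - σ) (T + σ) := by
    refine intermediate_value_Icc (by linarith) ?_ ⟨?_, ?_⟩
    · exact hgc.comp_continuousOn (hzc.mono (Icc_subset_Icc (by linarith) le_rfl))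
    · refine (hgm ((hzγ _ ⟨by linarith, by linarith⟩).trans_le ?_)).le
      exact (min_le_right _ _).trans (min_le_right _ _)
    · refine (hgp ((hzγ _ ⟨by linarith, by linarith⟩).trans_le ?_)).le
      exact (min_le_right _ _).trans (min_le_left _ _)
  have ht₁' : t₁ ∈ Icc 0 (T + σ) := ⟨by linarith [ht₁.1], ht₁.2⟩
  have ht₁0 : 0 < t₁ := by linarith [ht₁.1]
  simp only at hgt₁
  set s' := ((z t₁ - p).2 * a - (z t₁ - p).1 * b) / (a ^ 2 + b ^ 2) with hs'
  have hzt₁ : z t₁ = p + s' • v := by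
    have h1 := hdec (z t₁ - p)
    rw [show (z t₁ - p).1 * a + (z t₁ - p).2 * b = 0 from hgt₁, zero_div, zero_smul, zero_add,
      ← hs'] at h1
    rw [← h1]
    abel
  have hs'r : |s'| < r := by
    refine hcoord _ ?_
    have h1 : dist (z t₁) (γ t₁) < η₁ / 2 :=
      (hzγ t₁ ht₁').trans_le ((min_le_left _ _).trans (min_le_left _ _))
    have h2 : dist (γ t₁) p < η₁ / 2 := by
      refine (hσ (y := t₁) ?_).1
      rw [Real.dist_eq, abs_lt]
      exact ⟨by linarith [ht₁.1], by linarith [ht₁.2]⟩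
    linarith [dist_triangle (z t₁) (γ t₁) p]
  have hss : s' = s := by
    refine hinj (by simpa using hs'r) (by simpa using hsr) ?_
    simp only [hφ]
    rw [← hzt₁, ← hz0]
    exact firstIntegral_eq hE hEX hz t₁ ht₁'
  have hret : z t₁ = z 0 := by rw [hzt₁, hss, hz0]
  obtain ⟨γ', T', hγ', hrange⟩ := exists_isPeriodicSolution hX ht₁0 hret
    (fun t ht => (hz t ⟨ht.1, ht.2.trans ht₁'.2⟩).mono (Icc_subset_Icc le_rfl ht₁'.2))
    (by rw [hz0]; exact hsX)
  have hsub : range γ' ⊆ U := by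
    rw [hrange]
    rintro _ ⟨t, ht, rfl⟩
    refine hthick (Metric.mem_thickening_iff.2 ⟨γ t, mem_range_self t, ?_⟩)
    exact (hzγ t ⟨ht.1, ht.2.trans ht₁'.2⟩).trans_le ((min_le_left _ _).trans (min_le_right _ _))
  have heq := hiso _ ⟨γ', T', hγ', rfl⟩ hsub
  -- If isolation identified the new orbit with `γ`, then `E` would agree at the parameters `s` and
  -- `0`, against injectivity on the section.
  have hmem : p + s • v ∈ range γ := by
    rw [← heq, hrange, ← hz0]
    exact mem_image_of_mem z ⟨le_rfl, ht₁0.le⟩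
  rw [← hγ.2.2.1.image_Icc hT 0] at hmem
  obtain ⟨t, ht, hte⟩ := hmem
  rw [zero_add] at ht
  have h1 := firstIntegral_eq hE hEX (T := T) (fun t _ => (hγ.1 t).hasDerivWithinAt) t ht
  rw [hte] at h1
  refine hs0 (hinj (by simpa using hsr) (by simpa using hr) ?_)
  simp only [hφ]
  rw [h1, zero_smul, add_zero]

/-! ### Linear perturbations -/

theorem contDiff_poly (n : ℕ) (a : ℕ → ℕ → ℝ) {m : WithTop ℕ∞} : ContDiff ℝ m (poly n a) := by
  unfold poly
  fun_prop

theorem contDiff_field (lam : ℝ) (n : ℕ) (a b : ℕ → ℕ → ℝ) (ε : ℝ) {m : WithTop ℕ∞} :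
    ContDiff ℝ m (field lam n a b ε) := by
  have := contDiff_poly n a (m := m)
  have := contDiff_poly n b (m := m)
  unfold field
  fun_prop

theorem poly_one (a : ℕ → ℕ → ℝ) (p : ℝ × ℝ) :
    poly 1 a p = a 0 0 + a 0 1 * p.2 + a 1 0 * p.1 := by
  simp [poly, Finset.sum_range_succ]

/-- `g / c` is monotone and periodic, hence constant. -/
theorem eq_zero_of_periodic_of_deriv_sq {g u : ℝ → ℝ} {c T : ℝ} (hc : c ≠ 0) (hT : 0 < T)
    (hg : Function.Periodic g T) (hd : ∀ t, HasDerivAt g (c * u t ^ 2) t) (t : ℝ) : u t = 0 := by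
  have hd' : ∀ t, HasDerivAt (fun t => g t / c) (u t ^ 2) t := fun t => by
    have := (hd t).div_const c
    rwa [mul_div_cancel_left₀ _ hc] at this
  have hmono : Monotone (fun t => g t / c) := by
    refine monotone_of_deriv_nonneg (fun t => (hd' t).differentiableAt) fun t => ?_
    rw [(hd' t).deriv]
    positivity
  have hle : ∀ r s, g r / c ≤ g s / c := by
    intro r s
    obtain ⟨n, hn⟩ := exists_nat_ge ((r - s) / T)
    rw [div_le_iff₀ hT] at hn
    have h1 := hmono (show r ≤ s + n * T by linarith)
    have h2 : g (s + n * T) = g s := (hg.nat_mul n) s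
    simpa only [h2] using h1
  have hconst : (fun t => g t / c) = fun _ => g 0 / c :=
    funext fun r => le_antisymm (hle r 0) (hle 0 r)
  have h0 : HasDerivAt (fun t => g t / c) 0 t := by
    rw [hconst]; exact hasDerivAt_const _ _
  exact pow_eq_zero_iff two_ne_zero |>.1 ((hd' t).unique h0)

theorem eq_of_hasDerivAt_zero {f : ℝ → ℝ} (h : ∀ t, HasDerivAt f 0 t) (s t : ℝ) : f s = f t :=
  is_const_of_deriv_eq_zero (fun t => (h t).differentiableAt) (fun t => (h t).deriv) s t

theorem IsPeriodicSolution.not_const {X : ℝ × ℝ → ℝ × ℝ} {γ : ℝ → ℝ × ℝ} {T : ℝ}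
    (h : IsPeriodicSolution X γ T) (h1 : ∀ t, (γ t).1 = (γ 0).1) (h2 : ∀ t, (γ t).2 = (γ 0).2) :
    False := by
  have := h.2.1
  exact h.2.2.2 (T / 2) ⟨by linarith, by linarith⟩ (Prod.ext (h1 _) (h2 _))

/-- A planar system with `x' = A + B x - x² + κ y`, `y' = A' + B' x + 3 λ x² + 2 λ x³ + (β + 2x) y`
has no limit cycle. -/
theorem not_isLimitCycle_of_affine {X : ℝ × ℝ → ℝ × ℝ} (hX : ContDiff ℝ 1 X)
    {lam κ A B A' B' β : ℝ}
    (h1 : ∀ p, (X p).1 = κ * p.2 + (A + B * p.1 - p.1 ^ 2))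
    (h2 : ∀ p, (X p).2 = p.2 * (β + 2 * p.1)
      + (A' + B' * p.1 + 3 * lam * p.1 ^ 2 + 2 * lam * p.1 ^ 3)) (Γ : Set (ℝ × ℝ)) :
    ¬ IsLimitCycle X Γ := by
  intro hΓ
  obtain ⟨γ, T, hγ, -⟩ := hΓ.1
  have hT := hγ.2.1
  have hx : ∀ t, HasDerivAt (fun t => (γ t).1)
      (κ * (γ t).2 + (A + B * (γ t).1 - (γ t).1 ^ 2)) t := fun t => by
    have : HasDerivAt (fun t => (γ t).1) (X (γ t)).1 t := (hγ.1 t).fst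
    rwa [h1] at this
  have hy : ∀ t, HasDerivAt (fun t => (γ t).2) ((γ t).2 * (β + 2 * (γ t).1)
      + (A' + B' * (γ t).1 + 3 * lam * (γ t).1 ^ 2 + 2 * lam * (γ t).1 ^ 3)) t := fun t => by
    have : HasDerivAt (fun t => (γ t).2) (X (γ t)).2 t := (hγ.1 t).snd
    rwa [h2] at this
  by_cases hκ : κ = 0
  · subst hκ
    -- For `κ = 0` the equation for `x` is autonomous. A primitive of its right hand side, taken
    -- along the solution, has the square of that right hand side as derivative.
    have hq : ∀ t, A + B * (γ t).1 - (γ t).1 ^ 2 = 0 := by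
      refine eq_zero_of_periodic_of_deriv_sq (c := 1) one_ne_zero hT
        (g := fun t => A * (γ t).1 + B * (γ t).1 ^ 2 / 2 - (γ t).1 ^ 3 / 3)
        (fun t => by simp only [hγ.2.2.1 t]) fun t => ?_
      have := (((hx t).const_mul A).add ((((hx t).pow 2).const_mul B).div_const 2)).sub
        (((hx t).pow 3).div_const 3)
      convert! this using 1
      push_cast
      ring
    have cx : ∀ t, (γ t).1 = (γ 0).1 := fun t =>
      eq_of_hasDerivAt_zero (fun t => by
        have := hx t
        rwa [hq, zero_mul, zero_add] at this) t 0
    set x₀ := (γ 0).1 with hx₀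
    set m := β + 2 * x₀ with hm
    set c₀ := A' + B' * x₀ + 3 * lam * x₀ ^ 2 + 2 * lam * x₀ ^ 3 with hc₀
    have hy' : ∀ t, HasDerivAt (fun t => (γ t).2) ((γ t).2 * m + c₀) t := fun t => by
      have := hy t
      rwa [cx t, ← hm, ← hc₀] at this
    have hz : ∀ t, (γ t).2 * m + c₀ = 0 := by
      refine eq_zero_of_periodic_of_deriv_sq (c := 1) one_ne_zero hT
        (g := fun t => m * (γ t).2 ^ 2 / 2 + c₀ * (γ t).2)
        (fun t => by simp only [hγ.2.2.1 t]) fun t => ?_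
      have := ((((hy' t).pow 2).const_mul m).div_const 2).add ((hy' t).const_mul c₀)
      convert! this using 1
      push_cast
      ring
    exact hγ.not_const cx fun t =>
      eq_of_hasDerivAt_zero (fun t => by
        have := hy' t
        rwa [hz] at this) t 0
  -- the energy of the second order equation `x'' = δ x' + V(x)`
  set v₀ := κ * A' - A * β with hv₀
  set v₁ := κ * B' - 2 * A - B * β with hv₁
  set v₂ := 3 * κ * lam - 2 * B + β with hv₂
  set v₃ := 2 * κ * lam + 2 with hv₃
  set w : ℝ × ℝ → ℝ := fun p => κ * p.2 + (A + B * p.1 - p.1 ^ 2) with hw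
  set E : ℝ × ℝ → ℝ := fun p => w p ^ 2 / 2
    - (v₀ * p.1 + v₁ * p.1 ^ 2 / 2 + v₂ * p.1 ^ 3 / 3 + v₃ * p.1 ^ 4 / 4) with hE
  have hcurve : ∀ (z : ℝ → ℝ × ℝ) (t : ℝ) (d : ℝ × ℝ), HasDerivAt z d t →
      HasDerivAt (fun s => E (z s))
        (w (z t) * (κ * d.2 + (B - 2 * (z t).1) * d.1)
          - (v₀ + v₁ * (z t).1 + v₂ * (z t).1 ^ 2 + v₃ * (z t).1 ^ 3) * d.1) t := by
    intro z t d hz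
    have hf : HasDerivAt (fun s => (z s).1) d.1 t := hz.fst
    have hs : HasDerivAt (fun s => (z s).2) d.2 t := hz.snd
    have hw' : HasDerivAt (fun s => w (z s)) (κ * d.2 + (B * d.1 - 2 * (z t).1 * d.1)) t := by
      have := (hs.const_mul κ).add (((hf.const_mul B).const_add A).sub (hf.pow 2))
      convert! this using 1
      push_cast
      ring
    have := ((hw'.pow 2).div_const 2).sub ((((hf.const_mul v₀).add
      (((hf.pow 2).const_mul v₁).div_const 2)).add (((hf.pow 3).const_mul v₂).div_const 3)).add
        (((hf.pow 4).const_mul v₃).div_const 4))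
    convert! this using 1
    push_cast
    ring
  -- The divergence is `(B - 2x) + (β + 2x) = B + β`. The cancellation of `2x` makes the damping
  -- constant, so `E` changes at the rate `(B + β) w²`.
  have hident : ∀ p, w p * (κ * (X p).2 + (B - 2 * p.1) * (X p).1)
      - (v₀ + v₁ * p.1 + v₂ * p.1 ^ 2 + v₃ * p.1 ^ 3) * (X p).1 = (B + β) * w p ^ 2 := by
    intro p
    rw [h1, h2]
    simp only [hw, hv₀, hv₁, hv₂, hv₃]
    ring
  -- Without damping `E` is a first integral, and for `κ ≠ 0` its critical points are equilibria.
  -- With damping, periodicity forces `w = x' = 0`, so the solution is constant.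
  by_cases hδ : B + β = 0
  · have hEC : ContDiff ℝ 1 E := by
      simp only [hE, hw]
      fun_prop
    have hfd : ∀ p d, fderiv ℝ E p d = w p * (κ * d.2 + (B - 2 * p.1) * d.1)
        - (v₀ + v₁ * p.1 + v₂ * p.1 ^ 2 + v₃ * p.1 ^ 3) * d.1 := by
      intro p d
      have hline : HasDerivAt (fun s : ℝ => p + s • d) d 0 := by
        simpa using ((hasDerivAt_id (0 : ℝ)).smul_const d).const_add p
      have e1 := hcurve _ 0 d hline
      have h2 : HasFDerivAt E (fderiv ℝ E p) (p + (0 : ℝ) • d) := by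
        rw [zero_smul, add_zero]
        exact (hEC.differentiable one_ne_zero p).hasFDerivAt
      have e2 := h2.comp_hasDerivAt (0 : ℝ) hline
      have := e2.unique e1
      simpa using this
    refine not_isLimitCycle_of_firstIntegral hX hEC (fun p => ?_) (fun p hp h0 => hp ?_) Γ hΓ
    · rw [hfd, hident, hδ, zero_mul]
    · have d1 := hfd p (0, 1)
      have d2 := hfd p (1, 0)
      rw [h0] at d1 d2
      simp only [zero_apply, mul_one, mul_zero, add_zero, sub_zero,
        zero_add] at d1 d2
      have hw0 : w p = 0 := by
        rcases mul_eq_zero.1 d1.symm with h | h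
        · exact h
        · exact absurd h hκ
      have hX1 : (X p).1 = 0 := by rw [h1]; exact hw0
      rw [hw0, zero_mul, zero_sub, eq_comm, neg_eq_zero] at d2
      have hX2 : κ * (X p).2 = 0 := by
        have hw0' : κ * p.2 + (A + B * p.1 - p.1 ^ 2) = 0 := hw0
        rw [h2]
        linear_combination d2 + (β + 2 * p.1) * hw0'
      exact Prod.ext hX1 ((mul_eq_zero.1 hX2).resolve_left hκ)
  · have hw0 : ∀ t, w (γ t) = 0 := by
      refine eq_zero_of_periodic_of_deriv_sq hδ hT (g := fun t => E (γ t))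
        (fun t => by simp only [hγ.2.2.1 t]) fun t => ?_
      have := hcurve γ t _ (hγ.1 t)
      rwa [hident] at this
    have cx : ∀ t, (γ t).1 = (γ 0).1 := fun t =>
      eq_of_hasDerivAt_zero (fun t => by
        have := hx t
        rwa [show κ * (γ t).2 + (A + B * (γ t).1 - (γ t).1 ^ 2) = 0 from hw0 t] at this) t 0
    refine hγ.not_const cx fun t => mul_left_cancel₀ hκ ?_
    have e1 : κ * (γ t).2 + (A + B * (γ t).1 - (γ t).1 ^ 2) = 0 := hw0 t
    have e2 : κ * (γ 0).2 + (A + B * (γ 0).1 - (γ 0).1 ^ 2) = 0 := hw0 0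
    rw [cx t] at e1
    linarith

theorem not_isLimitCycle_linear (lam : ℝ) (a b : ℕ → ℕ → ℝ) (ε : ℝ) (Γ : Set (ℝ × ℝ)) :
    ¬ IsLimitCycle (field lam 1 a b ε) Γ := by
  refine not_isLimitCycle_of_affine (lam := lam) (κ := -lam⁻¹ + ε * a 0 1) (A := ε * a 0 0)
    (B := ε * a 1 0 - 1) (A' := ε * b 0 0) (B' := 1 + ε * b 1 0) (β := 1 + ε * b 0 1)
    (contDiff_field lam 1 a b ε) (fun p => ?_) (fun p => ?_) Γ
  · simp only [field, poly_one]
    ring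
  · simp only [field, poly_one]
    ring

/-! ### Circular moments -/

/-- The reflection `θ ↦ π - θ` changes the sign when `a` is odd, and `θ ↦ 2π - θ` when `b` is odd.
-/
theorem integral_cos_pow_mul_sin_pow_eq_zero {a b : ℕ} (h : Odd a ∨ Odd b) :
    ∫ θ in (0 : ℝ)..(2 * Real.pi), Real.cos θ ^ a * Real.sin θ ^ b = 0 := by
  have hper : Function.Periodic (fun θ => Real.cos θ ^ a * Real.sin θ ^ b) (2 * Real.pi) :=
    fun θ => by simp
  rcases h with h | h
  · have h1 := intervalIntegral.integral_comp_sub_left (a := 0) (b := 2 * Real.pi)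
      (fun θ => Real.cos θ ^ a * Real.sin θ ^ b) Real.pi
    have h2 := hper.intervalIntegral_add_eq (Real.pi - 2 * Real.pi) 0
    simp only [Real.cos_pi_sub, Real.sin_pi_sub, h.neg_pow, neg_mul,
      intervalIntegral.integral_neg, sub_zero] at h1
    rw [show Real.pi - 2 * Real.pi + 2 * Real.pi = Real.pi by ring, zero_add] at h2
    linarith
  · have h1 := intervalIntegral.integral_comp_sub_left (a := 0) (b := 2 * Real.pi)
      (fun θ => Real.cos θ ^ a * Real.sin θ ^ b) (2 * Real.pi)
    simp only [Real.cos_two_pi_sub, Real.sin_two_pi_sub, h.neg_pow, mul_neg,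
      intervalIntegral.integral_neg, sub_zero, sub_self] at h1
    linarith

/-- The integrals of `φ` over the circles of radius `r` about the origin are `r² Q(r² / 2)` for a
polynomial `Q` of degree less than `n`. -/
def HasMoments (n : ℕ) (φ : ℝ × ℝ → ℝ) : Prop :=
  Continuous φ ∧ ∃ Q ∈ Polynomial.degreeLT ℝ n, ∀ r : ℝ,
    ∫ θ in (0 : ℝ)..(2 * Real.pi), φ (r * Real.cos θ, r * Real.sin θ) = r ^ 2 * Q.eval (r ^ 2 / 2)

theorem intervalIntegrable_circle {φ : ℝ × ℝ → ℝ} (h : Continuous φ) (r a b : ℝ) :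
    IntervalIntegrable (fun θ => φ (r * Real.cos θ, r * Real.sin θ)) MeasureTheory.volume a b :=
  (h.comp (by fun_prop)).intervalIntegrable _ _

theorem HasMoments.zero (n : ℕ) : HasMoments n 0 :=
  ⟨continuous_const, 0, zero_mem _, fun r => by simp⟩

theorem HasMoments.add {n : ℕ} {φ ψ : ℝ × ℝ → ℝ} (h : HasMoments n φ) (h' : HasMoments n ψ) :
    HasMoments n (φ + ψ) := by
  obtain ⟨c, Q, hQ, e⟩ := h
  obtain ⟨c', Q', hQ', e'⟩ := h'
  refine ⟨c.add c', Q + Q', add_mem hQ hQ', fun r => ?_⟩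
  simp only [Pi.add_apply]
  rw [intervalIntegral.integral_add (intervalIntegrable_circle c _ _ _)
    (intervalIntegrable_circle c' _ _ _), e, e', Polynomial.eval_add]
  ring

theorem HasMoments.smul {n : ℕ} {φ : ℝ × ℝ → ℝ} (h : HasMoments n φ) (k : ℝ) :
    HasMoments n (k • φ) := by
  obtain ⟨c, Q, hQ, e⟩ := h
  refine ⟨c.const_smul k, k • Q, Submodule.smul_mem _ _ hQ, fun r => ?_⟩
  simp only [Pi.smul_apply, smul_eq_mul]
  rw [intervalIntegral.integral_const_mul, e, Polynomial.eval_smul, smul_eq_mul]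
  ring

theorem HasMoments.sum {ι : Type*} {n : ℕ} {s : Finset ι} {φ : ι → ℝ × ℝ → ℝ}
    (h : ∀ i ∈ s, HasMoments n (φ i)) : HasMoments n (∑ i ∈ s, φ i) :=
  Finset.sum_induction _ _ (fun _ _ => HasMoments.add) (HasMoments.zero n) h

/-- The monomial `X ^ a * Y ^ b` as a function on the plane. -/
def monomialFun (a b : ℕ) (p : ℝ × ℝ) : ℝ := p.1 ^ a * p.2 ^ b

theorem integral_monomialFun (a b : ℕ) (r : ℝ) :
    ∫ θ in (0 : ℝ)..(2 * Real.pi), monomialFun a b (r * Real.cos θ, r * Real.sin θ)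
      = r ^ (a + b) * ∫ θ in (0 : ℝ)..(2 * Real.pi), Real.cos θ ^ a * Real.sin θ ^ b := by
  rw [← intervalIntegral.integral_const_mul]
  congr 1
  ext θ
  simp only [monomialFun]
  ring

/-- If `a + b = 2 (j + 1)`, the moment is a multiple of `r² (r² / 2)^j`, and `j < n`. The constant
monomial is excluded because its moment is not divisible by `r²`. -/
theorem HasMoments.monomial {n a b : ℕ} (h : Odd a ∨ Odd b ∨ (1 ≤ a + b ∧ a + b ≤ 2 * n)) :
    HasMoments n (monomialFun a b) := by
  have hc : Continuous (monomialFun a b) := by unfold monomialFun; fun_prop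
  by_cases ho : Odd a ∨ Odd b
  · refine ⟨hc, 0, zero_mem _, fun r => ?_⟩
    rw [integral_monomialFun, integral_cos_pow_mul_sin_pow_eq_zero ho]
    simp
  · have hab : 1 ≤ a + b ∧ a + b ≤ 2 * n := by tauto
    have hev : Even (a + b) := by
      rw [not_or, Nat.not_odd_iff_even, Nat.not_odd_iff_even] at ho
      exact ho.1.add ho.2
    obtain ⟨k, hk⟩ := hev
    obtain ⟨j, rfl⟩ : ∃ j, k = j + 1 := ⟨k - 1, by omega⟩
    refine ⟨hc, Polynomial.C ((∫ θ in (0 : ℝ)..(2 * Real.pi), Real.cos θ ^ a * Real.sin θ ^ b)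
      * 2 ^ j) * Polynomial.X ^ j, ?_, fun r => ?_⟩
    · rw [Polynomial.mem_degreeLT]
      refine (Polynomial.degree_C_mul_X_pow_le _ _).trans_lt ?_
      exact_mod_cast (by omega : j < n)
    · rw [integral_monomialFun, hk, Polynomial.eval_C_mul, Polynomial.eval_pow, Polynomial.eval_X,
        div_pow]
      field_simp
      ring

/-- Polynomial functions of weighted degree at most `N`, where `X` and `Y` have weights `1`, `2`. -/
def weightLE (N : ℕ) : Submodule ℝ (ℝ × ℝ → ℝ) :=
  Submodule.span ℝ {φ | ∃ a b, a + 2 * b ≤ N ∧ φ = monomialFun a b}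

theorem monomialFun_mul (a b c d : ℕ) :
    monomialFun a b * monomialFun c d = monomialFun (a + c) (b + d) := by
  ext p
  simp only [monomialFun, Pi.mul_apply]
  ring

theorem monomialFun_mem {a b N : ℕ} (h : a + 2 * b ≤ N) : monomialFun a b ∈ weightLE N :=
  Submodule.subset_span ⟨a, b, h, rfl⟩

theorem weightLE_mono {M N : ℕ} (h : M ≤ N) : weightLE M ≤ weightLE N :=
  Submodule.span_mono fun _ ⟨a, b, hab, e⟩ => ⟨a, b, hab.trans h, e⟩

theorem mul_mem_weightLE {M N : ℕ} {φ ψ : ℝ × ℝ → ℝ} (h : φ ∈ weightLE M) (h' : ψ ∈ weightLE N) :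
    φ * ψ ∈ weightLE (M + N) := by
  have := Submodule.mul_mem_mul h h'
  rw [weightLE, weightLE, Submodule.span_mul_span] at this
  refine Submodule.span_mono ?_ this
  rintro _ ⟨_, ⟨a, b, hab, rfl⟩, _, ⟨c, d, hcd, rfl⟩, rfl⟩
  exact ⟨a + c, b + d, by omega, monomialFun_mul a b c d⟩

theorem pow_mem_weightLE {M : ℕ} {φ : ℝ × ℝ → ℝ} (h : φ ∈ weightLE M) (k : ℕ) :
    φ ^ k ∈ weightLE (M * k) := by
  induction k with
  | zero =>
    have : φ ^ 0 = monomialFun 0 0 := by ext p; simp [monomialFun]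
    rw [this]
    exact monomialFun_mem (by omega)
  | succ k ih =>
    rw [pow_succ, mul_add, mul_one]
    exact mul_mem_weightLE ih h

/-- The degree bound `n - 1` comes from here. Only products even in `X` and in `Y` matter. After
multiplication by `Y` or `X Y`, evenness requires `b ≥ 1`, and then `a + b ≤ 2n - b` leaves room for
the extra factors; an even number that is at most `2n + 1` is at most `2n`. -/
theorem hasMoments_of_mem_weightLE {n : ℕ} {φ : ℝ × ℝ → ℝ} (h : φ ∈ weightLE (2 * n)) :
    HasMoments n (monomialFun 1 0 * φ) ∧ HasMoments n (monomialFun 0 1 * φ) ∧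
      HasMoments n (monomialFun 1 1 * φ) := by
  induction h using Submodule.span_induction with
  | mem φ h =>
    obtain ⟨a, b, hab, rfl⟩ := h
    simp only [monomialFun_mul]
    refine ⟨HasMoments.monomial ?_, HasMoments.monomial ?_, HasMoments.monomial ?_⟩ <;>
    · simp only [Nat.odd_iff]
      omega
  | zero =>
    simp only [mul_zero]
    exact ⟨HasMoments.zero n, HasMoments.zero n, HasMoments.zero n⟩
  | add φ ψ _ _ h h' =>
    simp only [mul_add]
    exact ⟨h.1.add h'.1, h.2.1.add h'.2.1, h.2.2.add h'.2.2⟩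
  | smul k φ _ h =>
    simp only [mul_smul_comm]
    exact ⟨h.1.smul k, h.2.1.smul k, h.2.2.smul k⟩

/-! ### The Abelian integral -/

/-- The inverse of the linearizing change of coordinates
`X = √(1 - λ) x`, `Y = (y + λ x + λ x²) / √λ`. -/
def toPlane (lam : ℝ) (p : ℝ × ℝ) : ℝ × ℝ :=
  (p.1 / √(1 - lam),
    √lam * p.2 - lam * (p.1 / √(1 - lam)) - lam * (p.1 / √(1 - lam)) ^ 2)

/-- The inner product of the position with the perturbation, in linearizing coordinates. -/
def radialPart (lam : ℝ) (n : ℕ) (a b : ℕ → ℕ → ℝ) (p : ℝ × ℝ) : ℝ :=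
  p.1 * (√(1 - lam) * poly n a (toPlane lam p))
    + p.2 * ((poly n b (toPlane lam p)
      + (lam + 2 * lam * (toPlane lam p).1) * poly n a (toPlane lam p)) / √lam)

theorem poly_toPlane_mem_weightLE (lam : ℝ) (n : ℕ) (a : ℕ → ℕ → ℝ) :
    (fun p => poly n a (toPlane lam p)) ∈ weightLE (2 * n) := by
  set x : ℝ × ℝ → ℝ := fun p => (toPlane lam p).1 with hx
  set y : ℝ × ℝ → ℝ := fun p => (toPlane lam p).2 with hy
  have hx1 : x ∈ weightLE 1 := by
    have : x = (1 / √(1 - lam)) • monomialFun 1 0 := by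
      ext p; simp [hx, toPlane, monomialFun]; ring
    rw [this]
    exact Submodule.smul_mem _ _ (monomialFun_mem (by omega))
  have hy1 : y ∈ weightLE 2 := by
    have : y = √lam • monomialFun 0 1 - lam • x - lam • x ^ 2 := by
      ext p; simp [hx, hy, toPlane, monomialFun]
    rw [this]
    refine sub_mem (sub_mem (Submodule.smul_mem _ _ (monomialFun_mem (by omega)))
      (Submodule.smul_mem _ _ (weightLE_mono (by omega) hx1))) (Submodule.smul_mem _ _ ?_)
    simpa using pow_mem_weightLE hx1 2
  have : (fun p => poly n a (toPlane lam p))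
      = ∑ i ∈ Finset.range (n + 1), ∑ j ∈ Finset.range (n + 1 - i), a i j • (x ^ i * y ^ j) := by
    ext p
    simp only [poly, Finset.sum_apply, Pi.smul_apply, Pi.mul_apply, Pi.pow_apply, smul_eq_mul,
      hx, hy, mul_assoc]
  rw [this]
  refine Submodule.sum_mem _ fun i hi => Submodule.sum_mem _ fun j hj => Submodule.smul_mem _ _ ?_
  rw [Finset.mem_range] at hi hj
  exact weightLE_mono (by omega) (mul_mem_weightLE (pow_mem_weightLE hx1 i)
    (pow_mem_weightLE hy1 j))

theorem hasMoments_radialPart {lam : ℝ} (n : ℕ) (a b : ℕ → ℕ → ℝ) :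
    HasMoments n (radialPart lam n a b) := by
  have ha := hasMoments_of_mem_weightLE (poly_toPlane_mem_weightLE lam n a)
  have hb := hasMoments_of_mem_weightLE (poly_toPlane_mem_weightLE lam n b)
  have := (((ha.1.smul √(1 - lam)).add (hb.2.1.smul (1 / √lam))).add
    (ha.2.1.smul (lam / √lam))).add (ha.2.2.smul (2 * lam / √(1 - lam) / √lam))
  convert this using 1
  ext p
  simp only [radialPart, toPlane, monomialFun, Pi.add_apply, Pi.smul_apply, Pi.mul_apply,
    smul_eq_mul]
  ring

/-- The form `g dx - f dy` measures flux through the oval. The linearizing coordinates multiply it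
by the constant Jacobian and turn the oval into a circle, whose normal is the position vector. -/
theorem abelianIntegral_eq {lam : ℝ} (h0 : 0 < lam) (h1 : lam < 1) (n : ℕ) (a b : ℕ → ℕ → ℝ)
    (h : ℝ) :
    abelianIntegral lam n a b h = -(√lam / √(1 - lam)) * ∫ θ in (0 : ℝ)..(2 * Real.pi),
      radialPart lam n a b (√(2 * h) * Real.cos θ, √(2 * h) * Real.sin θ) := by
  have h1' : 0 < 1 - lam := by linarith
  have sm := Real.sqrt_pos.2 h1'
  have sl := Real.sqrt_pos.2 h0
  have e1 : √(2 * h / (1 - lam)) = √(2 * h) / √(1 - lam) := Real.sqrt_div' _ h1'.le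
  have e2 : √(2 * lam * h) = √lam * √(2 * h) := by
    rw [← Real.sqrt_mul h0.le]; congr 1; ring
  have ho : ∀ θ, oval lam h θ = toPlane lam (√(2 * h) * Real.cos θ, √(2 * h) * Real.sin θ) := by
    intro θ
    simp only [oval, toPlane, e1, e2]
    ext
    · simp only; ring
    · simp only; ring
  have d1 : ∀ θ, deriv (fun s => (oval lam h s).1) θ
      = √(2 * h) / √(1 - lam) * (-Real.sin θ) := by
    intro θ
    simp only [oval, e1]
    exact ((Real.hasDerivAt_cos θ).const_mul _).deriv
  have d2 : ∀ θ, deriv (fun s => (oval lam h s).2) θ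
      = -(lam + 2 * lam * (oval lam h θ).1) * (√(2 * h) / √(1 - lam) * (-Real.sin θ))
        + √lam * √(2 * h) * Real.cos θ := by
    intro θ
    simp only [oval, e1, e2]
    have hx := (Real.hasDerivAt_cos θ).const_mul (√(2 * h) / √(1 - lam))
    have := (((hx.pow 2).const_mul (-lam)).sub (hx.const_mul lam)).add
      ((Real.hasDerivAt_sin θ).const_mul (√lam * √(2 * h)))
    refine HasDerivAt.deriv ?_
    convert! this using 1
    push_cast
    ring
  rw [abelianIntegral, ← intervalIntegral.integral_const_mul]
  congr 1
  ext θ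
  rw [d1, d2, ho]
  simp only [radialPart]
  field_simp
  ring

theorem exists_abelianIntegral_polynomial {lam : ℝ} (h0 : 0 < lam) (h1 : lam < 1) (n : ℕ)
    (a b : ℕ → ℕ → ℝ) {Q : Polynomial ℝ} (hQ : ∀ r : ℝ,
      ∫ θ in (0 : ℝ)..(2 * Real.pi), radialPart lam n a b (r * Real.cos θ, r * Real.sin θ)
        = r ^ 2 * Q.eval (r ^ 2 / 2)) {h : ℝ} (hh : 0 ≤ h) :
    abelianIntegral lam n a b h = -(2 * (√lam / √(1 - lam))) * (h * Q.eval h) := by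
  rw [abelianIntegral_eq h0 h1 n a b h, hQ, Real.sq_sqrt (by linarith),
    mul_div_cancel_left₀ _ two_ne_zero]
  ring

/-! ### Perturbations with prescribed Abelian integral -/

theorem integral_cos_pow_mul_sin_sq_pos (j : ℕ) :
    0 < ∫ θ in (0 : ℝ)..(2 * Real.pi), Real.cos θ ^ (2 * j) * Real.sin θ ^ 2 := by
  refine intervalIntegral.integral_pos (by positivity) (by fun_prop) (fun θ _ => ?_)
    ⟨Real.pi / 4, ⟨by positivity, by linarith [Real.pi_pos]⟩, ?_⟩
  · rw [pow_mul]; positivity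
  · rw [Real.cos_pi_div_four, Real.sin_pi_div_four]
    positivity

/-- Expand `Y (ν Y + κ X²)^(i+1)`. The term linear in `Y` integrates to zero, the term in `X^(2i)
Y²` has a nonzero moment of degree `2i + 2`, and every further term that is even in both variables
has smaller degree. -/
theorem exists_polynomial_integral_mul_pow {ν κ : ℝ} (hν : ν ≠ 0) (hκ : κ ≠ 0) (i : ℕ) :
    ∃ Q : Polynomial ℝ, Q.degree = i ∧ ∀ r : ℝ, ∫ θ in (0 : ℝ)..(2 * Real.pi),
      (fun p : ℝ × ℝ => p.2 * (ν * p.2 + κ * p.1 ^ 2) ^ (i + 1)) (r * Real.cos θ, r * Real.sin θ)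
        = r ^ 2 * Q.eval (r ^ 2 / 2) := by
  set c : ℝ := κ ^ i * ν * (i + 1) with hc
  have hc0 : c ≠ 0 := by positivity
  -- The terms with exponent of `Y` at least 3.
  set rest : ℝ × ℝ → ℝ := ∑ l ∈ Finset.range i,
    (ν ^ (l + 2) * κ ^ (i + 1 - (l + 2)) * ((i + 1).choose (l + 2) : ℝ)) •
      monomialFun (2 * (i + 1 - (l + 2))) (l + 3) with hrest
  have hr : HasMoments i rest := by
    refine HasMoments.sum fun l hl => (HasMoments.monomial ?_).smul _
    rw [Finset.mem_range] at hl
    simp only [Nat.odd_iff]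
    omega
  have hodd : HasMoments i (κ ^ (i + 1) • monomialFun (2 * (i + 1)) 1) :=
    (HasMoments.monomial (by simp)).smul _
  have hexp : (fun p : ℝ × ℝ => p.2 * (ν * p.2 + κ * p.1 ^ 2) ^ (i + 1))
      = (rest + κ ^ (i + 1) • monomialFun (2 * (i + 1)) 1) + c • monomialFun (2 * i) 2 := by
    ext p
    rw [add_pow, Finset.sum_range_succ', Finset.sum_range_succ']
    simp only [hrest, hc, Pi.add_apply, Pi.smul_apply, Finset.sum_apply, smul_eq_mul, monomialFun,
      mul_add, Finset.mul_sum]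
    have e : ∀ l ∈ Finset.range i, p.2 * ((ν * p.2) ^ (l + 1 + 1) * (κ * p.1 ^ 2) ^
        (i + 1 - (l + 1 + 1)) * ((i + 1).choose (l + 1 + 1) : ℝ))
        = ν ^ (l + 2) * κ ^ (i + 1 - (l + 2)) * ((i + 1).choose (l + 2) : ℝ) *
          (p.1 ^ (2 * (i + 1 - (l + 2))) * p.2 ^ (l + 3)) := fun l _ => by
      rw [mul_pow, mul_pow, pow_mul]
      ring
    rw [Finset.sum_congr rfl e]
    simp only [zero_add, Nat.choose_one_right, Nat.choose_zero_right, add_tsub_cancel_right,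
      pow_one, pow_zero, Nat.sub_zero, mul_pow, pow_mul]
    push_cast
    ring
  obtain ⟨hcont, Q, hQ, e⟩ := hr.add hodd
  have hpos := integral_cos_pow_mul_sin_sq_pos i
  set J := ∫ θ in (0 : ℝ)..(2 * Real.pi), Real.cos θ ^ (2 * i) * Real.sin θ ^ 2 with hJ
  refine ⟨Q + Polynomial.C (c * J * 2 ^ i) * Polynomial.X ^ i, ?_, fun r => ?_⟩
  · have hdeg : (Polynomial.C (c * J * 2 ^ i) * Polynomial.X ^ i).degree = (i : WithBot ℕ) :=
      Polynomial.degree_C_mul_X_pow _ (by positivity)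
    rw [Polynomial.degree_add_eq_right_of_degree_lt, hdeg]
    rw [hdeg]
    exact Polynomial.mem_degreeLT.1 hQ
  · rw [hexp]
    simp only [Pi.add_apply (f := rest + _), Pi.smul_apply c, smul_eq_mul]
    rw [intervalIntegral.integral_add (intervalIntegrable_circle hcont _ _ _)
      ((intervalIntegrable_circle (by unfold monomialFun; fun_prop) _ _ _).const_mul c), e,
      intervalIntegral.integral_const_mul, integral_monomialFun, ← hJ, Polynomial.eval_add,
      Polynomial.eval_C_mul, Polynomial.eval_pow, Polynomial.eval_X, div_pow]
    field_simp
    ring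

/-! ### Orders of the zeros of the Abelian integral and of the first-order displacement -/

theorem sum_rootMultiplicity_le {n : ℕ} {Q : Polynomial ℝ} (hQ : Q ∈ Polynomial.degreeLT ℝ n)
    (hQ0 : Q ≠ 0) (Z : Finset ℝ) : ∑ h ∈ Z, Q.rootMultiplicity h ≤ n - 1 := by
  have h1 : Q.natDegree < n := by
    rwa [Polynomial.mem_degreeLT, Polynomial.degree_eq_natDegree hQ0, Nat.cast_lt] at hQ
  have h2 := Q.card_roots'
  have h3 : ∑ h ∈ Z, Q.rootMultiplicity h ≤ ∑ h ∈ Z ∪ Q.roots.toFinset, Q.roots.count h := by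
    simp only [Polynomial.count_roots]
    exact Finset.sum_le_sum_of_subset Finset.subset_union_left
  rw [Multiset.sum_count_eq_card fun a ha => by simp [Multiset.mem_toFinset.1, ha]] at h3
  omega

theorem abelianIntegral_zeros {lam : ℝ} (h0 : 0 < lam) (h1 : lam < 1) {n : ℕ}
    {a b : ℕ → ℕ → ℝ} {Q : Polynomial ℝ} (hQ0 : Q ≠ 0) (hQ : ∀ r : ℝ,
      ∫ θ in (0 : ℝ)..(2 * Real.pi), radialPart lam n a b (r * Real.cos θ, r * Real.sin θ)
        = r ^ 2 * Q.eval (r ^ 2 / 2)) :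
    (∀ h, h ∈ Q.roots.toFinset.filter (0 < ·) ↔ 0 < h ∧ abelianIntegral lam n a b h = 0) ∧
      ∀ h > 0, HasZeroOfOrder (abelianIntegral lam n a b) h (Q.rootMultiplicity h) := by
  set c : ℝ := -(2 * (√lam / √(1 - lam))) with hc
  have hc0 : c ≠ 0 := by
    have := Real.sqrt_pos.2 h0
    have := Real.sqrt_pos.2 (show 0 < 1 - lam by linarith)
    rw [hc, neg_ne_zero]
    positivity
  have hI : ∀ h : ℝ, 0 ≤ h → abelianIntegral lam n a b h = c * (h * Q.eval h) := fun h hh =>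
    exists_abelianIntegral_polynomial h0 h1 n a b hQ hh
  refine ⟨fun h => ?_, fun h hh => ?_⟩
  · rw [Finset.mem_filter, Multiset.mem_toFinset, Polynomial.mem_roots hQ0, Polynomial.IsRoot,
      and_comm]
    refine and_congr_right fun hh => ?_
    rw [hI h hh.le]
    simp [hc0, hh.ne']
  -- For positive argument the integral is the polynomial `Q · cX`, and the factor `cX` does not
  -- vanish at `h`.
  · have hP0 : Q * (Polynomial.C c * Polynomial.X) ≠ 0 := by simp [hQ0, hc0]
    have key := hasZeroOfOrder_polynomial hP0 h
    have e : (Q * (Polynomial.C c * Polynomial.X)).rootMultiplicity h = Q.rootMultiplicity h := by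
      rw [Polynomial.rootMultiplicity_mul hP0, Polynomial.rootMultiplicity_eq_zero
        (p := Polynomial.C c * Polynomial.X) (by simp [hc0, hh.ne']), add_zero]
    rw [e] at key
    refine key.congr ?_
    filter_upwards [lt_mem_nhds hh] with y hy
    rw [hI y (le_of_lt hy)]
    simp only [Polynomial.eval_mul, Polynomial.eval_C, Polynomial.eval_X]
    ring

/-- The substitution `r ↦ r² / 2` preserves orders at `ρ > 0`, since `r² / 2 - ρ² / 2 = (r + ρ) / 2
· (r - ρ)` and the first factor does not vanish there. -/
theorem hasZeroOfOrder_mul_comp_sq {Q : Polynomial ℝ} (hQ : Q ≠ 0) {K ρ : ℝ} (hK : K ≠ 0)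
    (hρ : 0 < ρ) : HasZeroOfOrder (fun r => K * r * Q.eval (r ^ 2 / 2)) ρ
      (Q.rootMultiplicity (ρ ^ 2 / 2)) := by
  obtain ⟨q, hq, hdvd⟩ := Polynomial.exists_eq_pow_rootMultiplicity_mul_and_not_dvd Q hQ (ρ ^ 2 / 2)
  rw [Polynomial.dvd_iff_isRoot, Polynomial.IsRoot] at hdvd
  set m := Q.rootMultiplicity (ρ ^ 2 / 2) with hm
  set S : Polynomial ℝ := Polynomial.C K * Polynomial.X *
    ((Polynomial.C (1 / 2) * (Polynomial.X + Polynomial.C ρ)) ^ m *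
      q.comp (Polynomial.C (1 / 2) * Polynomial.X ^ 2)) with hS
  have hSρ : S.eval ρ ≠ 0 := by
    simp only [hS, Polynomial.eval_mul, Polynomial.eval_C, Polynomial.eval_X, Polynomial.eval_pow,
      Polynomial.eval_add, Polynomial.eval_comp]
    have e : 1 / 2 * ρ ^ 2 = ρ ^ 2 / 2 := by ring
    rw [e]
    have : (1 / 2 * (ρ + ρ)) ^ m ≠ 0 := by positivity
    exact mul_ne_zero (mul_ne_zero hK hρ.ne') (mul_ne_zero this hdvd)
  have hS0 : S ≠ 0 := fun h => hSρ (by rw [h]; simp)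
  have hR0 : S * (Polynomial.X - Polynomial.C ρ) ^ m ≠ 0 :=
    mul_ne_zero hS0 (pow_ne_zero _ (Polynomial.X_sub_C_ne_zero ρ))
  have key := hasZeroOfOrder_polynomial hR0 ρ
  rw [Polynomial.rootMultiplicity_mul_X_sub_C_pow hS0, Polynomial.rootMultiplicity_eq_zero hSρ,
    zero_add] at key
  refine key.congr (Eventually.of_forall fun r => ?_)
  have e : Q.eval (r ^ 2 / 2) = (r ^ 2 / 2 - ρ ^ 2 / 2) ^ m * q.eval (r ^ 2 / 2) := by
    rw [hq]
    simp
  simp only [hS, Polynomial.eval_mul, Polynomial.eval_C, Polynomial.eval_X, Polynomial.eval_pow,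
    Polynomial.eval_add, Polynomial.eval_sub, Polynomial.eval_comp]
  rw [e, show 1 / 2 * r ^ 2 = r ^ 2 / 2 by ring,
    show r ^ 2 / 2 - ρ ^ 2 / 2 = 1 / 2 * (r + ρ) * (r - ρ) by ring,
    mul_pow (1 / 2 * (r + ρ)) (r - ρ)]
  ring

/-- These coefficients make the perturbation a polynomial in the single linear form `λ x + y`. The
sums are matched by `(i, j) ↦ (i + j, i)`. -/
theorem poly_binomial (n : ℕ) (c : ℕ → ℝ) (lam : ℝ) (p : ℝ × ℝ) :
    poly n (fun i j => c (i + j) * ((i + j).choose i : ℝ) * lam ^ i) p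
      = ∑ m ∈ Finset.range (n + 1), c m * (lam * p.1 + p.2) ^ m := by
  unfold poly
  have : ∀ m ∈ Finset.range (n + 1), c m * (lam * p.1 + p.2) ^ m
      = ∑ i ∈ Finset.range (m + 1), c m * (m.choose i : ℝ) * lam ^ i * p.1 ^ i * p.2 ^ (m - i) := by
    intro m _
    rw [add_pow, Finset.mul_sum]
    refine Finset.sum_congr rfl fun i _ => ?_
    rw [mul_pow]
    ring
  rw [Finset.sum_congr rfl this, Finset.sum_sigma', Finset.sum_sigma']
  refine Finset.sum_bij' (fun x _ => ⟨x.1 + x.2, x.1⟩) (fun x _ => ⟨x.2, x.1 - x.2⟩) ?_ ?_ ?_ ?_ ?_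
  · rintro ⟨i, j⟩ h
    simp only [Finset.mem_sigma, Finset.mem_range] at h ⊢
    omega
  · rintro ⟨i, j⟩ h
    simp only [Finset.mem_sigma, Finset.mem_range] at h ⊢
    omega
  · rintro ⟨i, j⟩ h
    simp
  · rintro ⟨i, j⟩ h
    simp only [Finset.mem_sigma, Finset.mem_range] at h
    simp only [Sigma.mk.injEq, heq_eq_eq, and_true]
    omega
  · rintro ⟨i, j⟩ h
    simp

/-- With `f = 0` and `g` a polynomial in `λ x + y = √λ Y - λ X² / (1 - λ)`, the power `i + 1`
contributes a polynomial of exact degree `i`. One polynomial of each degree below `n` spans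
`degreeLT ℝ n`. -/
theorem exists_radialPart_moments_eq {lam : ℝ} (h0 : 0 < lam) (h1 : lam < 1) {n : ℕ}
    {Q : Polynomial ℝ} (hQ : Q ∈ Polynomial.degreeLT ℝ n) : ∃ b : ℕ → ℕ → ℝ, ∀ r : ℝ,
      ∫ θ in (0 : ℝ)..(2 * Real.pi), radialPart lam n 0 b (r * Real.cos θ, r * Real.sin θ)
        = r ^ 2 * Q.eval (r ^ 2 / 2) := by
  have sl := Real.sqrt_pos.2 h0
  have sm := Real.sqrt_pos.2 (show 0 < 1 - lam by linarith)
  choose q hqdeg hq using exists_polynomial_integral_mul_pow (ν := √lam)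
    (κ := -(lam * (1 / √(1 - lam)) ^ 2)) sl.ne' (by rw [neg_ne_zero]; positivity)
  let S : Polynomial.Sequence ℝ := ⟨q, hqdeg⟩
  have hspan := S.span_degreeLT (m := n) fun i _ =>
    isUnit_iff_ne_zero.2 (Polynomial.leadingCoeff_ne_zero.2 (S.ne_zero i))
  rw [← hspan, ← Finset.coe_range, Submodule.mem_span_image_finset_iff_exists_fun'] at hQ
  obtain ⟨c, rfl⟩ := hQ
  -- The exponent is shifted by one and the constant term is dropped; the factor `√λ` cancels the
  -- division by `√λ` in `radialPart`.
  refine ⟨fun i j => (if i + j = 0 then 0 else √lam * c (i + j - 1)) *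
    ((i + j).choose i : ℝ) * lam ^ i, fun r => ?_⟩
  have e : ∀ p, radialPart lam n 0 (fun i j => (if i + j = 0 then 0 else √lam * c (i + j - 1)) *
      ((i + j).choose i : ℝ) * lam ^ i) p = ∑ i ∈ Finset.range n,
        c i * (p.2 * (√lam * p.2 + -(lam * (1 / √(1 - lam)) ^ 2) * p.1 ^ 2) ^ (i + 1)) := by
    intro p
    have hz : poly n 0 (toPlane lam p) = 0 := by simp [poly]
    rw [radialPart, poly_binomial n (fun m => if m = 0 then 0 else √lam * c (m - 1)), hz,
      Finset.sum_range_succ']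
    simp only [if_true, Nat.succ_ne_zero, if_false, zero_mul, mul_zero, add_zero, zero_add,
      add_tsub_cancel_right, Finset.sum_div, Finset.mul_sum]
    refine Finset.sum_congr rfl fun i _ => ?_
    have : lam * (toPlane lam p).1 + (toPlane lam p).2
        = √lam * p.2 + -(lam * (1 / √(1 - lam)) ^ 2) * p.1 ^ 2 := by
      simp only [toPlane]
      ring
    rw [this]
    field_simp
  simp only [e]
  rw [intervalIntegral.integral_finsetSum]
  · rw [Polynomial.eval_finsetSum, Finset.mul_sum]
    refine Finset.sum_congr rfl fun i _ => ?_
    have := hq i r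
    simp only at this
    rw [intervalIntegral.integral_const_mul, this, Polynomial.eval_smul, smul_eq_mul]
    ring
  · intro i _
    exact Continuous.intervalIntegrable (by fun_prop) _ _

/-! ### The integral equation for a perturbed rotation -/

theorem zero_smul_curve (u : C(unitInterval, ℂ)) : (0 : ℝ) • u = 0 := zero_smul ℝ u

theorem continuous_extend (u : C(unitInterval, ℂ)) :
    Continuous fun r : ℝ => u (projIcc 0 1 zero_le_one r) :=
  u.continuous.comp continuous_projIcc

theorem hasDerivAt_integral_extend (u : C(unitInterval, ℂ)) (t : ℝ) :
    HasDerivAt (fun t => ∫ r in (0 : ℝ)..t, u (projIcc 0 1 zero_le_one r))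
      (u (projIcc 0 1 zero_le_one t)) t :=
  intervalIntegral.integral_hasDerivAt_right ((continuous_extend u).intervalIntegrable _ _)
    ((continuous_extend u).stronglyMeasurableAtFilter _ _) (continuous_extend u).continuousAt

/-- The operator of integration from `0`. -/
def volterra : C(unitInterval, ℂ) →L[ℝ] C(unitInterval, ℂ) :=
  LinearMap.mkContinuous
    { toFun := fun u => ⟨fun s => ∫ r in (0 : ℝ)..s, u (projIcc 0 1 zero_le_one r),
        (continuous_iff_continuousAt.2 fun t =>
          (hasDerivAt_integral_extend u t).continuousAt).comp continuous_subtype_val⟩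
      map_add' := fun u v => by
        ext s
        exact intervalIntegral.integral_add ((continuous_extend u).intervalIntegrable _ _)
          ((continuous_extend v).intervalIntegrable _ _)
      map_smul' := fun c u => by
        ext s
        exact intervalIntegral.integral_smul c _ }
    1 fun u => by
      rw [one_mul, ContinuousMap.norm_le _ (norm_nonneg u)]
      intro s
      refine (intervalIntegral.norm_integral_le_of_norm_le_const (C := ‖u‖)
        fun r _ => u.norm_coe_le_norm _).trans ?_
      rw [sub_zero, abs_of_nonneg s.2.1]
      exact mul_le_of_le_one_right (norm_nonneg u) s.2.2

theorem volterra_apply (u : C(unitInterval, ℂ)) (s : unitInterval) :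
    volterra u s = ∫ r in (0 : ℝ)..s, u (projIcc 0 1 zero_le_one r) := rfl

/-- The unit circle, traversed once. -/
def rotation : C(unitInterval, ℂ) := ⟨fun s => Complex.exp (2 * Real.pi * s * Complex.I),
  by fun_prop⟩

/-- The unit circle, traversed once in the opposite direction. -/
def rotationInv : C(unitInterval, ℂ) := ⟨fun s => Complex.exp (-(2 * Real.pi * s * Complex.I)),
  by fun_prop⟩

/-- The right hand side of the equation `z' = i k z + ε F(z)`, in the rotating frame and with time
rescaled by the return time `(μ + 2π) / k`; the argument is `(u, μ, ε)`. -/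
def rotatingField (k : ℝ) (F : C(ℂ, ℂ)) (w : C(unitInterval, ℂ) × ℝ × ℝ) : C(unitInterval, ℂ) :=
  w.2.1 • (ContinuousMap.const _ Complex.I * w.1)
    + (w.2.2 * ((w.2.1 + 2 * Real.pi) / k)) • (rotationInv * F.comp (rotation * w.1))

/-- The map whose fibre over `(ρ, 0, ε)` consists of the orbits from `ρ` back to the real axis. -/
def returnEq (k : ℝ) (F : C(ℂ, ℂ)) (w : C(unitInterval, ℂ) × ℝ × ℝ) :
    C(unitInterval, ℂ) × ℝ × ℝ :=
  (w.1 - volterra (rotatingField k F w), (w.1 1).im, w.2.2)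

/-- The constant curve `ρ`, with vanishing second component. -/
def constCurve (p : ℝ × ℝ) : C(unitInterval, ℂ) × ℝ × ℝ := (p.1 • 1, 0, p.2)

theorem contDiff_constCurve {m : WithTop ℕ∞} : ContDiff ℝ m constCurve := by
  unfold constCurve
  fun_prop

theorem contDiff_rotatingField {k : ℝ} {F : C(ℂ, ℂ)} {q : ℕ}
    (hF : ContDiff ℝ q fun u : C(unitInterval, ℂ) => F.comp u) :
    ContDiff ℝ q (rotatingField k F) := by
  have h1 : ContDiff ℝ q fun w : C(unitInterval, ℂ) × ℝ × ℝ => F.comp (rotation * w.1) :=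
    hF.comp (contDiff_const.mul contDiff_fst)
  unfold rotatingField
  fun_prop

theorem contDiff_returnEq {k : ℝ} {F : C(ℂ, ℂ)} {q : ℕ}
    (hF : ContDiff ℝ q fun u : C(unitInterval, ℂ) => F.comp u) :
    ContDiff ℝ q (returnEq k F) := by
  have h1 := contDiff_rotatingField (k := k) hF
  have h2 : ContDiff ℝ q fun w : C(unitInterval, ℂ) × ℝ × ℝ => (w.1 1).im :=
    (Complex.imCLM.comp (ContinuousMap.evalCLM ℝ (1 : unitInterval))).contDiff.comp contDiff_fst
  unfold returnEq
  exact (contDiff_fst.sub (volterra.contDiff.comp h1)).prodMk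
    (h2.prodMk (contDiff_snd.comp contDiff_snd))

/-- The factors `μ` and `ε` in `rotatingField` vanish at the unperturbed orbit, so the derivatives
of the other factors do not enter the linearization. -/
theorem hasFDerivAt_smul_of_eq_zero {E G : Type*} [NormedAddCommGroup E] [NormedSpace ℝ E]
    [NormedAddCommGroup G] [NormedSpace ℝ G] {c : E → ℝ} {c' : E →L[ℝ] ℝ} {f : E → G} {x : E}
    (hc : HasFDerivAt c c' x) (h0 : c x = 0) (hf : DifferentiableAt ℝ f x) :
    HasFDerivAt (fun y => c y • f y) (c'.smulRight (f x)) x := by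
  have := hc.smul hf.hasFDerivAt
  rw [h0, zero_smul, zero_add] at this
  exact this

theorem returnEq_constCurve (k : ℝ) (F : C(ℂ, ℂ)) (ρ : ℝ) :
    returnEq k F (constCurve (ρ, 0)) = constCurve (ρ, 0) := by
  simp [returnEq, constCurve, rotatingField, zero_smul_curve]

/-- The linearization sends `(u, μ, ε)` to `(u - μ V a₀ - (2π ε / k) V b₀, Im u(1), ε)`, where `V`
integrates from `0` and `a₀ = i ρ`. Since `Im (V a₀)(1) = ρ ≠ 0`, the second component determines
`μ`: this is transversality of the flow to the real axis. -/
theorem exists_hasFDerivAt_returnEq {k : ℝ} {F : C(ℂ, ℂ)} {q : ℕ} (hq : q ≠ 0)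
    (hF : ContDiff ℝ q fun u : C(unitInterval, ℂ) => F.comp u) {ρ : ℝ} (hρ : ρ ≠ 0) :
    ∃ L : (C(unitInterval, ℂ) × ℝ × ℝ) ≃L[ℝ] (C(unitInterval, ℂ) × ℝ × ℝ),
      HasFDerivAt (returnEq k F)
        (L : (C(unitInterval, ℂ) × ℝ × ℝ) →L[ℝ] (C(unitInterval, ℂ) × ℝ × ℝ))
        (constCurve (ρ, 0)) := by
  set w₀ := constCurve (ρ, 0) with hw₀
  set p₁ : (C(unitInterval, ℂ) × ℝ × ℝ) →L[ℝ] C(unitInterval, ℂ) := ContinuousLinearMap.fst ℝ _ _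
  set p₂ : (C(unitInterval, ℂ) × ℝ × ℝ) →L[ℝ] ℝ :=
    (ContinuousLinearMap.fst ℝ _ _).comp (ContinuousLinearMap.snd ℝ _ _)
  set p₃ : (C(unitInterval, ℂ) × ℝ × ℝ) →L[ℝ] ℝ :=
    (ContinuousLinearMap.snd ℝ _ _).comp (ContinuousLinearMap.snd ℝ _ _)
  set a₀ : C(unitInterval, ℂ) := ContinuousMap.const _ Complex.I * w₀.1
  set b₀ : C(unitInterval, ℂ) := rotationInv * F.comp (rotation * w₀.1)
  have ha₀ : (volterra a₀ 1).im = ρ := by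
    rw [volterra_apply]
    simp [a₀, w₀, constCurve]
  have hd : ∀ x, HasFDerivAt (fun w : C(unitInterval, ℂ) × ℝ × ℝ => F.comp (rotation * w.1))
      (fderiv ℝ (fun w : C(unitInterval, ℂ) × ℝ × ℝ => F.comp (rotation * w.1)) x) x := fun x =>
    ((hF.comp (contDiff_const.mul contDiff_fst)).differentiable
      (by exact_mod_cast hq) x).hasFDerivAt
  have hrot : HasFDerivAt (rotatingField k F)
      (p₂.smulRight a₀ + ((2 * Real.pi / k) • p₃).smulRight b₀) w₀ := by
    refine HasFDerivAt.add ?_ ?_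
    · exact hasFDerivAt_smul_of_eq_zero (c := fun w : C(unitInterval, ℂ) × ℝ × ℝ => w.2.1)
        (f := fun w : C(unitInterval, ℂ) × ℝ × ℝ => ContinuousMap.const _ Complex.I * w.1)
        (x := w₀) p₂.hasFDerivAt rfl
        ((differentiableAt_const _).mul differentiableAt_fst)
    · refine hasFDerivAt_smul_of_eq_zero (c := fun w : C(unitInterval, ℂ) × ℝ × ℝ =>
        w.2.2 * ((w.2.1 + 2 * Real.pi) / k)) ?_ (by simp [w₀, constCurve])
        ((differentiableAt_const _).mul (hd w₀).differentiableAt)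
      have h1 : HasFDerivAt (fun w : C(unitInterval, ℂ) × ℝ × ℝ => w.2.2) p₃ w₀ := p₃.hasFDerivAt
      have h2 : DifferentiableAt ℝ (fun w : C(unitInterval, ℂ) × ℝ × ℝ =>
        (w.2.1 + 2 * Real.pi) / k) w₀ := by fun_prop
      have := h1.mul h2.hasFDerivAt
      convert! this using 1
      simp [w₀, constCurve]
  have hL : HasFDerivAt (returnEq k F)
      ((p₁ - volterra.comp (p₂.smulRight a₀ + ((2 * Real.pi / k) • p₃).smulRight b₀)).prod
        (((Complex.imCLM.comp (ContinuousMap.evalCLM ℝ (1 : unitInterval))).comp p₁).prod p₃))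
      w₀ := by
    refine HasFDerivAt.prodMk (HasFDerivAt.sub p₁.hasFDerivAt ?_) (HasFDerivAt.prodMk ?_ ?_)
    · exact volterra.hasFDerivAt.comp w₀ hrot
    · exact ((Complex.imCLM.comp (ContinuousMap.evalCLM ℝ (1 : unitInterval))).comp p₁).hasFDerivAt
    · exact p₃.hasFDerivAt
  set L := (p₁ - volterra.comp (p₂.smulRight a₀ + ((2 * Real.pi / k) • p₃).smulRight b₀)).prod
        (((Complex.imCLM.comp (ContinuousMap.evalCLM ℝ (1 : unitInterval))).comp p₁).prod p₃)
  have hLa : ∀ w, L w = (w.1 - (w.2.1 • volterra a₀ + (2 * Real.pi / k * w.2.2) • volterra b₀),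
      (w.1 1).im, w.2.2) := by
    intro w
    simp [L, p₁, p₂, p₃]
  have hker : L.ker = ⊥ := by
    rw [LinearMap.ker_eq_bot']
    rintro ⟨u, μ, ε⟩ h
    have h' : L (u, μ, ε) = 0 := h
    rw [hLa] at h'
    simp only [Prod.mk_eq_zero] at h'
    obtain ⟨h1, h2, rfl⟩ := h'
    rw [mul_zero, zero_smul_curve, add_zero, sub_eq_zero] at h1
    rw [h1] at h2
    have h3 : μ * ρ = 0 := by rw [← ha₀]; simpa using h2
    have h4 : μ = 0 := (mul_eq_zero.1 h3).resolve_right hρ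
    rw [h4, zero_smul_curve] at h1
    rw [h1, h4]
    rfl
  have hrange : L.range = ⊤ := by
    rw [LinearMap.range_eq_top]
    rintro ⟨A, β, η⟩
    set μ := (β - (A 1).im - (2 * Real.pi / k * η) * (volterra b₀ 1).im) / ρ with hμ
    refine ⟨(A + (μ • volterra a₀ + (2 * Real.pi / k * η) • volterra b₀), μ, η), ?_⟩
    have := hLa (A + (μ • volterra a₀ + (2 * Real.pi / k * η) • volterra b₀), μ, η)
    refine (show _ = _ from this).trans ?_
    simp only [add_sub_cancel_right, Prod.mk.injEq, and_true, true_and]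
    have e : (A + (μ • volterra a₀ + (2 * Real.pi / k * η) • volterra b₀)) 1
        = A 1 + (μ • volterra a₀ 1 + (2 * Real.pi / k * η) • volterra b₀ 1) := rfl
    rw [e, Complex.add_im, Complex.add_im, Complex.smul_im, Complex.smul_im, ha₀, smul_eq_mul,
      smul_eq_mul, hμ, div_mul_cancel₀ _ hρ]
    ring
  exact ⟨ContinuousLinearEquiv.ofBijective L hker hrange, by
    rw [ContinuousLinearEquiv.coe_ofBijective]; exact hL⟩

/-! ### Correspondence between fibres of `returnEq` and orbits; energy balance -/

section

/-- The perturbed rotation `i k z + ε F(z)`. -/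
def perturbedRotation (k : ℝ) (F : C(ℂ, ℂ)) (ε : ℝ) (z : ℂ) : ℂ :=
  Complex.I * k * z + ε * F z

/-- Pointwise complex conjugation of curves. -/
def conjCurve : C(unitInterval, ℂ) →L[ℝ] C(unitInterval, ℂ) :=
  ContinuousLinearMap.compLeftContinuous ℝ unitInterval (Complex.conjCLE : ℂ →L[ℝ] ℂ)

theorem conjCurve_apply (u : C(unitInterval, ℂ)) (s : unitInterval) :
    conjCurve u s = (starRingEnd ℂ) (u s) := rfl

/-- The work of the perturbation along a curve in the rotating frame. -/
def work (F : C(ℂ, ℂ)) (u : C(unitInterval, ℂ)) : ℝ :=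
  (volterra (conjCurve (rotation * u) * F.comp (rotation * u)) 1).re

theorem rotation_mul_rotationInv (s : unitInterval) : rotation s * rotationInv s = 1 := by
  simp only [rotation, rotationInv, ContinuousMap.coe_mk]
  rw [← Complex.exp_add, add_neg_cancel, Complex.exp_zero]

theorem rotationInv_eq_conj (s : unitInterval) :
    rotationInv s = (starRingEnd ℂ) (rotation s) := by
  simp only [rotation, rotationInv, ContinuousMap.coe_mk]
  rw [← Complex.exp_conj]
  congr 1
  simp [map_ofNat]

theorem rotationInv_one : rotationInv 1 = 1 := by
  have : rotationInv 1 = Complex.exp (-(2 * Real.pi * ((1 : ℝ) : ℂ) * Complex.I)) := rfl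
  rw [this, Complex.ofReal_one, mul_one, Complex.exp_neg, Complex.exp_two_pi_mul_I, inv_one]

theorem norm_rotation (s : unitInterval) : ‖rotation s‖ = 1 := by
  simp only [rotation, ContinuousMap.coe_mk]
  have := Complex.norm_exp_ofReal_mul_I (2 * Real.pi * s)
  push_cast at this
  exact this

section Fibre

variable {k : ℝ} {F : C(ℂ, ℂ)} {u : C(unitInterval, ℂ)} {μ ε ρ : ℝ}

/-- The extension to the real line of a curve in a fibre of `returnEq`. -/
def extendCurve (k : ℝ) (F : C(ℂ, ℂ)) (w : C(unitInterval, ℂ) × ℝ × ℝ) (ρ t : ℝ) : ℂ :=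
  ρ + ∫ r in (0 : ℝ)..t, rotatingField k F w (projIcc 0 1 zero_le_one r)

theorem hasDerivAt_extendCurve (w : C(unitInterval, ℂ) × ℝ × ℝ) (t : ℝ) :
    HasDerivAt (extendCurve k F w ρ) (rotatingField k F w (projIcc 0 1 zero_le_one t)) t :=
  (hasDerivAt_integral_extend _ t).const_add _

theorem extendCurve_eq (h : returnEq k F (u, μ, ε) = constCurve (ρ, ε)) (s : unitInterval) :
    extendCurve k F (u, μ, ε) ρ s = u s := by
  have h1 : u - volterra (rotatingField k F (u, μ, ε)) = ρ • 1 := congrArg Prod.fst h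
  have h2 := congrArg (fun f : C(unitInterval, ℂ) => f s) (sub_eq_iff_eq_add.1 h1)
  simp only [extendCurve]
  rw [← volterra_apply]
  rw [show u s = _ from h2]
  simp

theorem rotatingField_apply (s : unitInterval) : rotatingField k F (u, μ, ε) s
    = Complex.I * μ * u s + ε * ((μ + 2 * Real.pi) / k) * (rotationInv s * F (rotation s * u s)) := by
  simp only [rotatingField, ContinuousMap.add_apply, ContinuousMap.smul_apply,
    ContinuousMap.mul_apply, ContinuousMap.const_apply, ContinuousMap.comp_apply,
    Complex.real_smul]
  push_cast
  ring

/-- Undoing the rotating frame and the time scaling: `z(t) = exp (2π i t / τ) u(t / τ)` with `τ = (μ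
+ 2π) / k`. -/
theorem exists_solution_of_returnEq (hk : 0 < k) (hμ : 0 < μ + 2 * Real.pi)
    (h : returnEq k F (u, μ, ε) = constCurve (ρ, ε)) :
    ∃ z : ℝ → ℂ, z 0 = ρ ∧ z ((μ + 2 * Real.pi) / k) = (u 1).re ∧
      ∀ t ∈ Icc 0 ((μ + 2 * Real.pi) / k), HasDerivAt z (perturbedRotation k F ε (z t)) t ∧
        ∃ s, ‖z t‖ = ‖u s‖ := by
  set τ := (μ + 2 * Real.pi) / k with hτ
  have hτ0 : 0 < τ := by positivity
  have hkτ : k * τ = μ + 2 * Real.pi := by rw [hτ]; field_simp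
  set v := extendCurve k F (u, μ, ε) ρ with hv
  set z : ℝ → ℂ := fun t => Complex.exp (2 * Real.pi * (t / τ : ℝ) * Complex.I) * v (t / τ) with hz
  have hs : ∀ t ∈ Icc 0 τ, t / τ ∈ Icc (0 : ℝ) 1 := fun t ht =>
    ⟨div_nonneg ht.1 hτ0.le, (div_le_one hτ0).2 ht.2⟩
  have hzu : ∀ t (ht : t ∈ Icc 0 τ), z t = rotation ⟨t / τ, hs t ht⟩ * u ⟨t / τ, hs t ht⟩ := by
    intro t ht
    rw [← extendCurve_eq h]
    rfl
  have him : (u 1).im = 0 := congrArg (fun x => x.2.1) h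
  refine ⟨z, ?_, ?_, fun t ht => ⟨?_, ⟨t / τ, hs t ht⟩, ?_⟩⟩
  · simp [hz, hv, extendCurve]
  · have h1 := extendCurve_eq h 1
    rw [← hv] at h1
    have h2 : v (τ / τ) = u 1 := by rw [div_self hτ0.ne']; exact h1
    simp only [hz]
    rw [h2, div_self hτ0.ne', Complex.ofReal_one, mul_one, Complex.exp_two_pi_mul_I, one_mul]
    exact Complex.ext rfl (by simpa using him)
  · have hd1 : HasDerivAt (fun t : ℝ => t / τ) (1 / τ) t := (hasDerivAt_id t).div_const τ
    have hd2 := (hasDerivAt_extendCurve (k := k) (F := F) (ρ := ρ) (u, μ, ε) (t / τ)).scomp t hd1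
    have hd3 : HasDerivAt (fun t : ℝ => Complex.exp (2 * Real.pi * (t / τ : ℝ) * Complex.I))
        (Complex.exp (2 * Real.pi * (t / τ : ℝ) * Complex.I) *
          (2 * Real.pi * (1 / τ : ℝ) * Complex.I)) t := by
      refine HasDerivAt.cexp ?_
      exact ((hd1.ofReal_comp.const_mul (2 * Real.pi : ℂ)).mul_const Complex.I)
    have hd := hd3.mul hd2
    convert! hd using 1
    rw [projIcc_of_mem zero_le_one (hs t ht), rotatingField_apply]
    set s : unitInterval := ⟨t / τ, hs t ht⟩ with hsd
    have e1 : Complex.exp (2 * Real.pi * (t / τ : ℝ) * Complex.I) = rotation s := rfl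
    have e2 : ((extendCurve k F (u, μ, ε) ρ) ∘ fun t => t / τ) t = u s := by
      rw [← extendCurve_eq h s]
      rfl
    have e3 := rotation_mul_rotationInv s
    have e4 : ((μ : ℂ) + 2 * Real.pi) / k = τ := by rw [hτ]; push_cast; rfl
    have e5 : (k : ℂ) * τ = μ + 2 * Real.pi := by exact_mod_cast hkτ
    have hτc : (τ : ℂ) ≠ 0 := by exact_mod_cast hτ0.ne'
    rw [e1, e2, e4, perturbedRotation, hzu t ht, Complex.real_smul]
    push_cast
    field_simp
    linear_combination (rotation s * u s * Complex.I) * e5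
      - (ε * F (rotation s * u s) * τ) * e3
  · rw [hzu t ht, norm_mul, norm_rotation, one_mul]

/-- The term `i μ u` is orthogonal to `u`, so only the perturbation changes `|u|²`. The explicit
factor `ε` allows the displacement to be divided by `ε` without loss of smoothness. -/
theorem normSq_sub_of_returnEq (h : returnEq k F (u, μ, ε) = constCurve (ρ, ε)) :
    Complex.normSq (u 1) - ρ ^ 2 = 2 * ε * ((μ + 2 * Real.pi) / k) * work F u := by
  set v := extendCurve k F (u, μ, ε) ρ with hv
  set g := conjCurve (rotation * u) * F.comp (rotation * u) with hg
  have hd : ∀ t ∈ uIcc (0 : ℝ) 1, HasDerivAt (fun t => Complex.normSq (v t))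
      (2 * ε * ((μ + 2 * Real.pi) / k) * (g (projIcc 0 1 zero_le_one t)).re) t := by
    intro t ht
    rw [uIcc_of_le zero_le_one] at ht
    have h1 := hasDerivAt_extendCurve (k := k) (F := F) (ρ := ρ) (u, μ, ε) t
    rw [← hv, projIcc_of_mem zero_le_one ht] at h1
    have hre : HasDerivAt (fun t => (v t).re) (rotatingField k F (u, μ, ε) ⟨t, ht⟩).re t :=
      (Complex.reCLM.hasFDerivAt.comp_hasDerivAt t h1)
    have him : HasDerivAt (fun t => (v t).im) (rotatingField k F (u, μ, ε) ⟨t, ht⟩).im t :=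
      (Complex.imCLM.hasFDerivAt.comp_hasDerivAt t h1)
    have := (hre.mul hre).add (him.mul him)
    refine this.congr_deriv ?_
    rw [projIcc_of_mem zero_le_one ht]
    set s : unitInterval := ⟨t, ht⟩ with hs
    have e : v t = u s := extendCurve_eq h s
    have e1 : g s = (starRingEnd ℂ) (u s) * (rotationInv s * F (rotation s * u s)) := by
      rw [rotationInv_eq_conj]
      simp only [hg, ContinuousMap.mul_apply, conjCurve_apply, ContinuousMap.comp_apply, map_mul]
      ring
    rw [e, e1, rotatingField_apply]
    generalize rotationInv s * F (rotation s * u s) = c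
    rw [show (ε : ℂ) * ((μ + 2 * Real.pi) / k) = ((ε * ((μ + 2 * Real.pi) / k) : ℝ) : ℂ) by
      push_cast; rfl, mul_assoc 2 ε]
    generalize ε * ((μ + 2 * Real.pi) / k) = d at *
    simp only [Complex.add_re, Complex.add_im, Complex.mul_re, Complex.mul_im, Complex.I_re,
      Complex.I_im, Complex.ofReal_re, Complex.ofReal_im, Complex.conj_re, Complex.conj_im]
    ring
  have hcont : Continuous fun t : ℝ => (g (projIcc 0 1 zero_le_one t)).re :=
    Complex.continuous_re.comp (continuous_extend g)
  have := intervalIntegral.integral_eq_sub_of_hasDerivAt hd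
    ((hcont.const_mul _).intervalIntegrable _ _)
  have e0 : v 0 = ρ := by simp [hv, extendCurve]
  have e1 : v 1 = u 1 := extendCurve_eq h 1
  rw [intervalIntegral.integral_const_mul, e0, e1, Complex.normSq_ofReal] at this
  rw [work, volterra_apply]
  have h3 : (∫ r in (0 : ℝ)..1, (g (projIcc 0 1 zero_le_one r)).re)
      = (∫ r in (0 : ℝ)..1, g (projIcc 0 1 zero_le_one r)).re :=
    intervalIntegral.intervalIntegral_re ((continuous_extend g).intervalIntegrable _ _)
  rw [← hg, show (((1 : unitInterval) : ℝ)) = 1 from rfl, ← h3, this]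
  ring

/-- The converse passage: an actual solution ending on the real axis gives a point of the fibre.
Injectivity of the local inverse then identifies it with the constructed one. -/
theorem returnEq_of_solution (hk : 0 < k) {z : ℝ → ℂ} {τ : ℝ}
    (hz : ∀ t, HasDerivAt z (perturbedRotation k F ε (z t)) t) (hz0 : z 0 = ρ)
    (him : (z τ).im = 0)
    (hu : ∀ s : unitInterval, u s = rotationInv s * z (τ * s)) :
    returnEq k F (u, k * τ - 2 * Real.pi, ε) = constCurve (ρ, ε) := by
  have hkc : (k : ℂ) ≠ 0 := by exact_mod_cast hk.ne'
  set w : C(unitInterval, ℂ) × ℝ × ℝ := (u, k * τ - 2 * Real.pi, ε) with hw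
  set v : ℝ → ℂ := fun s => Complex.exp (-(2 * Real.pi * s * Complex.I)) * z (τ * s) with hv
  have hd : ∀ s ∈ Icc (0 : ℝ) 1,
      HasDerivAt v (rotatingField k F w (projIcc 0 1 zero_le_one s)) s := by
    intro s hs
    have d1 : HasDerivAt (fun s : ℝ => τ * s) τ s := by
      simpa using (hasDerivAt_id s).const_mul τ
    have d2 := (hz (τ * s)).scomp s d1
    have d3 : HasDerivAt (fun s : ℝ => Complex.exp (-(2 * Real.pi * s * Complex.I)))
        (Complex.exp (-(2 * Real.pi * s * Complex.I)) * (-(2 * Real.pi * 1 * Complex.I))) s :=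
      HasDerivAt.cexp ((((hasDerivAt_id s).ofReal_comp.const_mul
        (2 * Real.pi : ℂ)).mul_const Complex.I).neg)
    refine (d3.mul d2).congr_deriv ?_
    rw [projIcc_of_mem zero_le_one hs]
    set σ : unitInterval := ⟨s, hs⟩ with hσ
    have e1 : Complex.exp (-(2 * Real.pi * s * Complex.I)) = rotationInv σ := rfl
    have e2 : rotation σ * u σ = z (τ * s) := by
      rw [hu, ← mul_assoc, rotation_mul_rotationInv, one_mul]
    rw [e1, hw, rotatingField_apply, e2, hu, perturbedRotation]
    have e3 : z (τ * (σ : ℝ)) = z (τ * s) := rfl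
    have e4 : ((fun s => z (τ * s)) : ℝ → ℂ) s = z (τ * s) := rfl
    simp only [Function.comp_def, e3, Complex.real_smul]
    push_cast
    field_simp
    ring
  have hvu : ∀ s : unitInterval, v s = u s := fun s => by rw [hu]; rfl
  refine Prod.ext ?_ (Prod.ext ?_ rfl)
  · change u - volterra (rotatingField k F w) = ρ • 1
    ext s
    have := intervalIntegral.integral_eq_sub_of_hasDerivAt (a := 0) (b := s) (f := v)
      (f' := fun s => rotatingField k F w (projIcc 0 1 zero_le_one s)) (fun r hr => hd r (by
        rw [uIcc_of_le s.2.1] at hr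
        exact ⟨hr.1, hr.2.trans s.2.2⟩)) ((continuous_extend _).intervalIntegrable _ _)
    have e0 : v 0 = ρ := by simp [hv, hz0]
    rw [← volterra_apply, hvu, e0] at this
    rw [ContinuousMap.sub_apply, this]
    simp
  · change (u 1).im = 0
    rw [hu, rotationInv_one, one_mul, show (((1 : unitInterval) : ℝ)) = 1 from rfl, mul_one, him]

end Fibre

end

/-- `T` and `P` are the return time and the return map of `z' = i k z + ε F(z)` on the positive real
axis, for `(ρ, ε)` in a neighbourhood `O` of `(ρ₀, 0)`, and `P(ρ, ε) = ρ + ε D(ρ, ε)`. -/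
structure IsLocalReturn (k : ℝ) (F : C(ℂ, ℂ)) (q : ℕ) (ρ₀ r : ℝ) (O : Set (ℝ × ℝ))
    (T D : ℝ × ℝ → ℝ) : Prop where
  isOpen : IsOpen O
  mem : (ρ₀, 0) ∈ O
  continuousOn : ContinuousOn T O
  contDiffOn : ContDiffOn ℝ q D O
  pos : ∀ p ∈ O, 0 < p.1
  time_pos : ∀ p ∈ O, 0 < T p
  transversal : ∀ p ∈ O, 0 < k * p.1 + p.2 * (F p.1).im
  solution : ∀ p ∈ O, ∃ z : ℝ → ℂ, z 0 = p.1 ∧ z (T p) = (p.1 + p.2 * D p : ℝ) ∧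
    ∀ t ∈ Icc 0 (T p), HasDerivAt z (perturbedRotation k F p.2 (z t)) t ∧ |‖z t‖ - ρ₀| < r
  limit : ∀ p ∈ O, p.2 = 0 → D p = 2 * Real.pi / k / p.1 * work F (p.1 • 1)
  unique : ∃ η > 0, ∀ (z : ℝ → ℂ) (τ : ℝ) (p : ℝ × ℝ), |p.2| < η → |k * τ - 2 * Real.pi| < η →
    (∀ t, HasDerivAt z (perturbedRotation k F p.2 (z t)) t) → z 0 = p.1 → (z τ).im = 0 →
    (∀ s : unitInterval, ‖rotationInv s * z (τ * s) - ρ₀‖ < η) →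
    p ∈ O ∧ T p = τ ∧ z τ = (p.1 + p.2 * D p : ℝ)

/-! ### Construction of the local return map -/

theorem exists_isLocalReturn {k : ℝ} (hk : 0 < k) {F : C(ℂ, ℂ)} {q : ℕ} (hq : q ≠ 0)
    (hF : ContDiff ℝ q fun u : C(unitInterval, ℂ) => F.comp u) {ρ₀ r : ℝ} (hρ₀ : 0 < ρ₀)
    (hr : 0 < r) : ∃ O T D, IsLocalReturn k F q ρ₀ r O T D := by
  obtain ⟨L, hL⟩ := exists_hasFDerivAt_returnEq (k := k) hq hF hρ₀.ne'
  have hq' : (q : WithTop ℕ∞) ≠ 0 := by exact_mod_cast hq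
  have hC : ContDiffAt ℝ q (returnEq k F) (constCurve (ρ₀, 0)) :=
    (contDiff_returnEq (k := k) hF).contDiffAt
  set e := hC.toOpenPartialHomeomorph (returnEq k F) hL hq' with he
  have hesrc : constCurve (ρ₀, 0) ∈ e.source := hC.mem_toOpenPartialHomeomorph_source hL hq'
  have hecoe : ∀ w, e w = returnEq k F w := fun w => rfl
  have hetgt : constCurve (ρ₀, 0) ∈ e.target := by
    have := e.map_source hesrc
    rwa [hecoe, returnEq_constCurve] at this
  set W : ℝ × ℝ → C(unitInterval, ℂ) × ℝ × ℝ := fun p => e.symm (constCurve p) with hWdef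
  have hW₀ : W (ρ₀, 0) = constCurve (ρ₀, 0) := by
    have := e.left_inv hesrc
    rwa [hecoe, returnEq_constCurve] at this
  have hsymm : ContDiffAt ℝ q e.symm (constCurve (ρ₀, 0)) := by
    refine e.contDiffAt_symm (f₀' := L) hetgt ?_ ?_
    · change HasFDerivAt _ _ (W (ρ₀, 0))
      rw [hW₀]; exact hL
    · change ContDiffAt _ _ _ (W (ρ₀, 0))
      rw [hW₀]; exact hC
  have hWC : ContDiffAt ℝ q W (ρ₀, 0) := hsymm.comp (ρ₀, 0) contDiff_constCurve.contDiffAt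
  have hWc : ContinuousAt W (ρ₀, 0) := hWC.continuousAt
  have cc : Continuous constCurve := (contDiff_constCurve (m := 0)).continuous
  set T : ℝ × ℝ → ℝ := fun p => ((W p).2.1 + 2 * Real.pi) / k with hT
  -- The energy balance reads `(P - ρ)(P + ρ) = 2 ε T work`, so this is `(P - ρ) / ε`, written
  -- without division by `ε`.
  set D : ℝ × ℝ → ℝ := fun p => 2 * T p * work F (W p).1 / (((W p).1 1).re + p.1) with hD
  have hre : Continuous fun w : C(unitInterval, ℂ) × ℝ × ℝ => (w.1 1).re :=
    Complex.continuous_re.comp ((ContinuousMap.evalCLM ℝ (1 : unitInterval)).continuous.comp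
      continuous_fst)
  have ev : ∀ᶠ p in 𝓝 (ρ₀, (0 : ℝ)), ContDiffAt ℝ q W p ∧ constCurve p ∈ e.target ∧
      constCurve (p.1, 0) ∈ e.source ∧ 0 < p.1 ∧ 0 < k * p.1 + p.2 * (F p.1).im ∧
      0 < (W p).2.1 + 2 * Real.pi ∧ 0 < ((W p).1 1).re ∧ ‖(W p).1 - ρ₀ • 1‖ < r := by
    refine (hWC.eventually (by simp)).and ((cc.continuousAt.eventually
      (e.open_target.mem_nhds hetgt)).and ?_)
    have h1 : Continuous fun p : ℝ × ℝ => constCurve (p.1, 0) := cc.comp (by fun_prop)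
    refine (h1.continuousAt.eventually (e.open_source.mem_nhds hesrc)).and ?_
    have h0 : Continuous fun p : ℝ × ℝ => p.1 := continuous_fst
    refine ((h0.tendsto (ρ₀, 0)).eventually_const_lt hρ₀).and ?_
    have h2 : Continuous fun p : ℝ × ℝ => k * p.1 + p.2 * (F p.1).im := by fun_prop
    refine (h2.continuousAt.eventually_const_lt (by simp only [zero_mul, add_zero]; positivity)).and
      ?_
    have h3 : ContinuousAt (fun p => (W p).2.1 + 2 * Real.pi) (ρ₀, 0) := by fun_prop
    refine (h3.eventually_const_lt (by beta_reduce; rw [hW₀]; simp [constCurve, Real.pi_pos])).and ?_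
    have h4 : ContinuousAt (fun p => ((W p).1 1).re) (ρ₀, 0) := hre.continuousAt.comp hWc
    refine (h4.eventually_const_lt (by beta_reduce; rw [hW₀]; simpa [constCurve] using hρ₀)).and ?_
    have h5 : ContinuousAt (fun p => ‖(W p).1 - ρ₀ • 1‖) (ρ₀, 0) := by fun_prop
    exact h5.eventually_lt_const (by beta_reduce; rw [hW₀]; simpa [constCurve] using hr)
  obtain ⟨O, hO, hOopen, hOmem⟩ := mem_nhds_iff.1 ev
  have hWeq : ∀ p ∈ O, returnEq k F ((W p).1, (W p).2.1, p.2) = constCurve p ∧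
      (W p).2.2 = p.2 := by
    intro p hp
    have h1 : returnEq k F (W p) = constCurve p := e.right_inv (hO hp).2.1
    have h2 : (W p).2.2 = p.2 := congrArg (fun x => x.2.2) h1
    refine ⟨?_, h2⟩
    rw [← h2]
    exact h1
  have hP : ∀ p ∈ O, ((W p).1 1).re = p.1 + p.2 * D p := by
    intro p hp
    have h1 := normSq_sub_of_returnEq (hWeq p hp).1
    have him : ((W p).1 1).im = 0 := congrArg (fun x => x.2.1) (hWeq p hp).1
    obtain ⟨-, -, -, hp1, -, -, hpre, -⟩ := hO hp
    rw [Complex.normSq_apply, him] at h1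
    simp only [hD, hT]
    have : ((W p).1 1).re + p.1 ≠ 0 := by positivity
    field_simp
    field_simp at h1
    linear_combination h1
  refine ⟨O, T, D, ⟨hOopen, hOmem, fun p hp => ?_, fun p hp => ?_, fun p hp => (hO hp).2.2.2.1,
    fun p hp => div_pos (hO hp).2.2.2.2.2.1 hk, fun p hp => (hO hp).2.2.2.2.1, fun p hp => ?_,
    fun p hp h0 => ?_, ?_⟩⟩
  · have : ContinuousAt W p := (hO hp).1.continuousAt
    exact ContinuousAt.continuousWithinAt (by fun_prop)
  · have hw : ContDiffAt ℝ q W p := (hO hp).1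
    have h1 : ContDiffAt ℝ q (fun p => (W p).1) p := hw.fst
    have h2 : ContDiffAt ℝ q T p := by
      have : ContDiffAt ℝ q (fun p => (W p).2.1) p := hw.snd.fst
      exact (this.add contDiffAt_const).div_const k
    have h3 : ContDiff ℝ q (work F) := by
      have h4 : ContDiff ℝ q fun u : C(unitInterval, ℂ) => F.comp (rotation * u) :=
        hF.comp (contDiff_const.mul contDiff_id)
      have h5 : ContDiff ℝ q fun u : C(unitInterval, ℂ) =>
          conjCurve (rotation * u) * F.comp (rotation * u) :=
        (conjCurve.contDiff.comp (contDiff_const.mul contDiff_id)).mul h4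
      exact (Complex.reCLM.comp (ContinuousMap.evalCLM ℝ (1 : unitInterval))).contDiff.comp
        (volterra.contDiff.comp h5)
    have h6 : ContDiffAt ℝ q (fun p => ((W p).1 1).re + p.1) p :=
      ((Complex.reCLM.comp (ContinuousMap.evalCLM ℝ (1 : unitInterval))).contDiff.contDiffAt.comp
        p h1).add contDiffAt_fst
    have h7 : ((W p).1 1).re + p.1 ≠ 0 := by
      obtain ⟨-, -, -, hp1, -, -, hpre, -⟩ := hO hp
      positivity
    exact (((contDiffAt_const.mul h2).mul (h3.contDiffAt.comp p h1)).div h6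
      h7).contDiffWithinAt
  · obtain ⟨z, hz0, hz1, hz⟩ := exists_solution_of_returnEq hk (hO hp).2.2.2.2.2.1 (hWeq p hp).1
    refine ⟨z, hz0, hz1.trans (by rw [hP p hp]), fun t ht => ⟨(hz t ht).1, ?_⟩⟩
    obtain ⟨s, hs⟩ := (hz t ht).2
    rw [hs]
    have h1 := ((W p).1 - ρ₀ • 1).norm_coe_le_norm s
    have h2 := abs_norm_sub_norm_le ((W p).1 s) (ρ₀ : ℂ)
    rw [Complex.norm_real, Real.norm_of_nonneg hρ₀.le] at h2
    have h3 : ((W p).1 - ρ₀ • 1) s = (W p).1 s - ρ₀ := by simp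
    rw [h3] at h1
    exact (h2.trans h1).trans_lt (hO hp).2.2.2.2.2.2.2
  -- For `ε = 0` the constant curve already solves the equation; membership in the source of `e`
  -- makes it the selected solution.
  · have h1 : W p = constCurve (p.1, 0) := by
      have h2 := e.left_inv (hO hp).2.2.1
      rw [hecoe, returnEq_constCurve] at h2
      simp only [hWdef]
      rw [show p = (p.1, 0) from Prod.ext rfl h0]
      exact h2
    have hp1 := (hO hp).2.2.2.1
    simp only [hD, hT, h1, constCurve]
    simp
    field_simp
    ring
  -- A solution close to the constant `ρ₀` in the rotating frame lies in the source of `e`, on which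
  -- `returnEq` is injective.
  · obtain ⟨η, hη, hball⟩ := Metric.isOpen_iff.1 e.open_source _ hesrc
    obtain ⟨η', hη', hball'⟩ := Metric.isOpen_iff.1 hOopen _ hOmem
    refine ⟨min η η', lt_min hη hη', fun z τ p hp2 hτ hz hz0 him hclose => ?_⟩
    have hzc : Continuous z := continuous_iff_continuousAt.2 fun t => (hz t).continuousAt
    set u : C(unitInterval, ℂ) := ⟨fun s => rotationInv s * z (τ * s), by fun_prop⟩ with hu
    have hret := returnEq_of_solution hk hz hz0 him (u := u) fun s => rfl
    have hp1 : |p.1 - ρ₀| < min η η' := by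
      have h1 := hclose 0
      have h2 : rotationInv 0 = 1 := by simp [rotationInv]
      rw [h2, one_mul, show (((0 : unitInterval) : ℝ)) = 0 from rfl, mul_zero, hz0,
        ← Complex.ofReal_sub, Complex.norm_real] at h1
      exact h1
    have hpO : p ∈ O := by
      refine hball' ?_
      rw [Metric.mem_ball, Prod.dist_eq]
      refine max_lt (hp1.trans_le (min_le_right _ _)) ?_
      rw [Real.dist_eq, sub_zero]
      exact hp2.trans_le (min_le_right _ _)
    have hsrc : (u, k * τ - 2 * Real.pi, p.2) ∈ e.source := by
      refine hball ?_
      rw [Metric.mem_ball, Prod.dist_eq, Prod.dist_eq]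
      refine max_lt ?_ (max_lt ?_ ?_)
      · rw [dist_eq_norm, ContinuousMap.norm_lt_iff _ hη]
        intro s
        have h1 : (u - (constCurve (ρ₀, 0)).1) s = rotationInv s * z (τ * s) - ρ₀ := by
          simp [constCurve, hu]
        rw [h1]
        exact (hclose s).trans_le (min_le_left _ _)
      · simpa [constCurve, Real.dist_eq] using hτ.trans_le (min_le_left _ _)
      · simpa [constCurve, Real.dist_eq] using hp2.trans_le (min_le_left _ _)
    have hWp : W p = (u, k * τ - 2 * Real.pi, p.2) := by
      have h1 := e.left_inv hsrc
      rwa [hecoe, hret] at h1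
    refine ⟨hpO, ?_, ?_⟩
    · simp only [hT, hWp, sub_add_cancel]
      rw [mul_div_cancel_left₀ _ hk.ne']
    · have h1 : u 1 = z τ := by
        simp only [hu, ContinuousMap.coe_mk]
        rw [rotationInv_one, one_mul, show (((1 : unitInterval) : ℝ)) = 1 from rfl, mul_one]
      rw [← hP p hpO, hWp, h1]
      exact Complex.ext rfl (by simpa using him)

theorem work_const (F : C(ℂ, ℂ)) (ρ : ℝ) : work F (ρ • 1) = (2 * Real.pi)⁻¹ *
    ∫ θ in (0 : ℝ)..(2 * Real.pi), ((starRingEnd ℂ) (Complex.exp (θ * Complex.I) * ρ) *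
      F (Complex.exp (θ * Complex.I) * ρ)).re := by
  set f : ℝ → ℝ := fun θ => ((starRingEnd ℂ) (Complex.exp (θ * Complex.I) * ρ) *
      F (Complex.exp (θ * Complex.I) * ρ)).re with hf
  have h1 := intervalIntegral.integral_comp_mul_left (a := 0) (b := 1) f
    (show 2 * Real.pi ≠ 0 by positivity)
  rw [mul_zero, mul_one, smul_eq_mul] at h1
  rw [← h1, work, volterra_apply]
  set g := conjCurve (rotation * (ρ • 1)) * F.comp (rotation * (ρ • 1)) with hg
  have h3 : (∫ r in (0 : ℝ)..1, (g (projIcc 0 1 zero_le_one r)).re)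
      = (∫ r in (0 : ℝ)..1, g (projIcc 0 1 zero_le_one r)).re :=
    intervalIntegral.intervalIntegral_re ((continuous_extend g).intervalIntegrable _ _)
  rw [show (((1 : unitInterval) : ℝ)) = 1 from rfl, ← h3]
  refine intervalIntegral.integral_congr fun s hs => ?_
  rw [uIcc_of_le zero_le_one] at hs
  simp only [hf]
  rw [projIcc_of_mem zero_le_one hs]
  have e : (rotation * ((ρ • 1 : C(unitInterval, ℂ)))) ⟨s, hs⟩
      = Complex.exp ((2 * Real.pi * s : ℝ) * Complex.I) * ρ := by
    simp [rotation, mul_comm _ (ρ : ℂ)]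
  rw [hg, ContinuousMap.mul_apply, conjCurve_apply, ContinuousMap.comp_apply, e]

/-! ### Periodic solutions of a perturbed rotation -/

/-- A primitive of `z' / z` is a logarithm of `z` up to a constant; its imaginary part is the
continuous angle. -/
theorem exists_angle {z z' : ℝ → ℂ} (hz : ∀ t, HasDerivAt z (z' t) t) (hc : Continuous z')
    (hne : ∀ t, z t ≠ 0) : ∃ Θ : ℝ → ℝ, (∀ t, HasDerivAt Θ (z' t / z t).im t) ∧
      ∀ t, z t = ‖z t‖ * Complex.exp (Θ t * Complex.I) := by
  have hzc : Continuous z := continuous_iff_continuousAt.2 fun t => (hz t).continuousAt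
  have hψ : Continuous fun t => z' t / z t := hc.div hzc hne
  set w : ℝ → ℂ := fun t => ∫ r in (0 : ℝ)..t, z' r / z r with hw
  have hwd : ∀ t, HasDerivAt w (z' t / z t) t := fun t =>
    intervalIntegral.integral_hasDerivAt_right (hψ.intervalIntegrable _ _)
      (hψ.stronglyMeasurableAtFilter _ _) hψ.continuousAt
  have hzw : ∀ t, z t = z 0 * Complex.exp (w t) := by
    intro t
    have hd : ∀ t, HasDerivAt (fun t => z t * Complex.exp (-w t)) 0 t := fun t => by
      refine ((hz t).mul (hwd t).neg.cexp).congr_deriv ?_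
      have := hne t
      field_simp
      ring
    have h1 := is_const_of_deriv_eq_zero (fun t => (hd t).differentiableAt)
      (fun t => (hd t).deriv) t 0
    have hw0 : w 0 = 0 := by simp [hw]
    simp only [hw0, neg_zero, Complex.exp_zero, mul_one] at h1
    rw [← h1, mul_assoc, ← Complex.exp_add, neg_add_cancel, Complex.exp_zero, mul_one]
  refine ⟨fun t => (z 0).arg + (w t).im, fun t => ?_, fun t => ?_⟩
  · exact HasDerivAt.const_add _ (Complex.imCLM.hasFDerivAt.comp_hasDerivAt t (hwd t))
  · have hn : ‖z t‖ = ‖z 0‖ * Real.exp (w t).re := by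
      rw [hzw t, norm_mul, Complex.norm_exp]
    have h0 : (‖z 0‖ : ℂ) * Complex.exp ((z 0).arg * Complex.I) = z 0 :=
      Complex.norm_mul_exp_arg_mul_I (z 0)
    have h1 : Complex.exp (w t) = Real.exp (w t).re * Complex.exp ((w t).im * Complex.I) := by
      rw [Complex.ofReal_exp, ← Complex.exp_add, Complex.re_add_im]
    rw [hn]
    push_cast
    rw [add_mul, Complex.exp_add, ← Complex.ofReal_exp]
    calc z t = z 0 * Complex.exp (w t) := hzw t
      _ = (‖z 0‖ * Complex.exp ((z 0).arg * Complex.I)) *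
          (Real.exp (w t).re * Complex.exp ((w t).im * Complex.I)) := by rw [h0, h1]
      _ = _ := by ring

theorem mul_le_sub_of_deriv_ge {f f' : ℝ → ℝ} {c : ℝ} (hf : ∀ t, HasDerivAt f (f' t) t)
    (hc : ∀ t, c ≤ f' t) {s t : ℝ} (hst : s ≤ t) : c * (t - s) ≤ f t - f s := by
  have hm : Monotone fun t => f t - c * t := by
    refine monotone_of_deriv_nonneg
      (fun t => ((hf t).sub ((hasDerivAt_id t).const_mul c)).differentiableAt) fun t => ?_
    have := ((hf t).sub ((hasDerivAt_id t).const_mul c)).deriv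
    rw [show deriv (fun t => f t - c * t) t = f' t - c * 1 from this]
    linarith [hc t]
  have := hm hst
  simp only at this
  linarith

/-- A periodic curve that rotates about the origin and does not intersect itself turns once. -/
theorem exists_angle_eq_add_two_pi {z : ℝ → ℂ} {Θ : ℝ → ℝ} {T : ℝ} (hzc : Continuous z)
    (hT : 0 < T) (hper : Function.Periodic z T) (hmin : ∀ s t, s < t → z s = z t → T ≤ t - s)
    (hΘc : Continuous Θ) (hΘm : StrictMono Θ) (hΘs : Function.Surjective Θ)
    (hz : ∀ t, z t = ‖z t‖ * Complex.exp (Θ t * Complex.I)) (hne : ∀ t, z t ≠ 0) :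
    ∃ t, Θ (t + T) = Θ t + 2 * Real.pi := by
  set Λ := (hΘm.orderIsoOfSurjective Θ hΘs).symm with hΛ
  have hΛΘ : ∀ x, Θ (Λ x) = x := fun x => (hΘm.orderIsoOfSurjective Θ hΘs).apply_symm_apply x
  have hΛc : Continuous Λ := Λ.continuous
  -- `φ t` is the time at which the angle has advanced by `2π`.
  set φ : ℝ → ℝ := fun t => Λ (Θ t + 2 * Real.pi) with hφ
  have hφΘ : ∀ t, Θ (φ t) = Θ t + 2 * Real.pi := fun t => hΛΘ _
  have hφc : Continuous φ := hΛc.comp (hΘc.add continuous_const)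
  have hφt : ∀ t, t < φ t := fun t => hΘm.lt_iff_lt.1 (by
    rw [hφΘ]; linarith [Real.pi_pos])
  have hnc : Continuous fun t => ‖z t‖ := hzc.norm
  have hIcc : (Icc 0 T).Nonempty := ⟨0, le_rfl, hT.le⟩
  obtain ⟨tM, -, hM⟩ := isCompact_Icc.exists_isMaxOn hIcc hnc.continuousOn
  obtain ⟨tm, -, hm⟩ := isCompact_Icc.exists_isMinOn hIcc hnc.continuousOn
  have hM' : ∀ t, ‖z t‖ ≤ ‖z tM‖ := fun t => by
    obtain ⟨y, hy, he⟩ := hper.exists_mem_Ico₀ hT t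
    rw [he]
    exact hM (Ico_subset_Icc_self hy)
  have hm' : ∀ t, ‖z tm‖ ≤ ‖z t‖ := fun t => by
    obtain ⟨y, hy, he⟩ := hper.exists_mem_Ico₀ hT t
    rw [he]
    exact hm (Ico_subset_Icc_self hy)
  -- The change of radius over one turn is nonpositive at a maximum of `‖z‖` and nonnegative at a
  -- minimum, so for some `t` the curve closes up after one turn.
  obtain ⟨t, ht⟩ : (0 : ℝ) ∈ range fun t => ‖z (φ t)‖ - ‖z t‖ :=
    mem_range_of_exists_le_of_exists_ge ((hnc.comp hφc).sub hnc)
      ⟨tM, sub_nonpos.2 (hM' _)⟩ ⟨tm, sub_nonneg.2 (hm' _)⟩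
  have hret : z t = z (φ t) := by
    rw [hz t, hz (φ t), hφΘ, sub_eq_zero.1 ht]
    push_cast
    rw [add_mul, Complex.exp_add, Complex.exp_two_pi_mul_I, mul_one]
  have hle := hmin t (φ t) (hφt t) hret
  have hexp : Complex.exp (Θ (t + T) * Complex.I) = Complex.exp (Θ t * Complex.I) := by
    have h1 := hz (t + T)
    rw [hper t] at h1
    have h2 : (‖z t‖ : ℂ) ≠ 0 := by exact_mod_cast norm_ne_zero_iff.2 (hne t)
    exact mul_left_cancel₀ h2 (h1.symm.trans (hz t))
  obtain ⟨n, hn⟩ := Complex.exp_eq_exp_iff_exists_int.1 hexp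
  have hn' : Θ (t + T) = Θ t + n * (2 * Real.pi) := by
    have h1 : ((Θ (t + T) : ℂ)) * Complex.I
        = ((Θ t + n * (2 * Real.pi) : ℝ) : ℂ) * Complex.I := by
      rw [hn]; push_cast; ring
    exact_mod_cast mul_right_cancel₀ Complex.I_ne_zero h1
  have hlt : Θ t < Θ (t + T) := hΘm (by linarith)
  have hn1 : (1 : ℤ) ≤ n := by
    by_contra hcon
    have : (n : ℝ) ≤ 0 := by exact_mod_cast (by omega : n ≤ 0)
    nlinarith [Real.pi_pos]
  have hn1' : (1 : ℝ) ≤ n := by exact_mod_cast hn1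
  -- A period contains at least one full turn; minimality gave the reverse inequality `T ≤ φ t - t`.
  have hge : φ t ≤ t + T := hΘm.le_iff_le.1 (by
    rw [hφΘ, hn']; nlinarith [Real.pi_pos])
  refine ⟨t, ?_⟩
  rw [show t + T = φ t by linarith, hφΘ]

/-- In the annulus the angular speed is `k + O(ε)`. The angle is therefore an increasing bijection,
it grows by exactly `2π` over the least period, and `k T - 2π = O(ε)`. In the rotating frame the
velocity is `O(ε)`, so the orbit stays near its point on the positive real axis. -/
theorem exists_section_of_periodic {k : ℝ} (hk : 0 < k) (F : C(ℂ, ℂ)) {a b η : ℝ} (ha : 0 < a)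
    (hη : 0 < η) : ∃ ε₁ > 0, ∀ ε : ℝ, |ε| < ε₁ → ∀ (z : ℝ → ℂ) (T : ℝ), 0 < T →
      (∀ t, HasDerivAt z (perturbedRotation k F ε (z t)) t) → Function.Periodic z T →
      (∀ s t, s < t → z s = z t → T ≤ t - s) → (∀ t, a ≤ ‖z t‖ ∧ ‖z t‖ ≤ b) →
      ∃ t₀, z t₀ = ‖z t₀‖ ∧ |k * T - 2 * Real.pi| < η ∧
        ∀ s : unitInterval, ‖rotationInv s * z (T * s + t₀) - z t₀‖ < η := by
  obtain ⟨M, hM⟩ := (isCompact_closedBall (0 : ℂ) b).exists_bound_of_continuousOn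
    F.continuous.continuousOn
  set K := 4 * Real.pi / k * (|M| / a) with hK
  -- The three conditions give angular speed at least `k / 2` (hence `T ≤ 4π / k`), the bound on the
  -- period, and the bound on the drift in the rotating frame.
  have ev : ∀ᶠ ε : ℝ in 𝓝 0, |ε| * (|M| / a) < k / 2 ∧ |ε| * K < η ∧
      |ε| * (K * |b| + 4 * Real.pi / k * |M|) < η := by
    have h1 : ∀ c d : ℝ, 0 < d → ∀ᶠ ε : ℝ in 𝓝 0, |ε| * c < d := fun c d hd => by
      have : Continuous fun ε : ℝ => |ε| * c := by fun_prop
      exact (this.tendsto 0).eventually_lt_const (by simpa using hd)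
    exact (h1 _ _ (by positivity)).and ((h1 _ _ hη).and (h1 _ _ hη))
  obtain ⟨ε₁, hε₁, hev⟩ := Metric.eventually_nhds_iff.1 ev
  refine ⟨ε₁, hε₁, fun ε hε z T hT hz hper hmin hann => ?_⟩
  obtain ⟨h1, h2, h3⟩ := hev (y := ε) (by simpa [Real.dist_eq] using hε)
  have hzc : Continuous z := continuous_iff_continuousAt.2 fun t => (hz t).continuousAt
  have hpos : ∀ t, 0 < ‖z t‖ := fun t => ha.trans_le (hann t).1
  have hne : ∀ t, z t ≠ 0 := fun t => norm_pos_iff.1 (hpos t)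
  have hF : ∀ t, ‖F (z t)‖ ≤ |M| := fun t =>
    (hM _ (mem_closedBall_zero_iff.2 (hann t).2)).trans (le_abs_self M)
  have hcont : Continuous fun t => perturbedRotation k F ε (z t) := by
    unfold perturbedRotation
    fun_prop
  obtain ⟨Θ, hΘd, hΘ⟩ := exists_angle hz hcont hne
  set δ := |ε| * (|M| / a) with hδ
  have hδ0 : 0 ≤ δ := by positivity
  have hbound : ∀ t, |(perturbedRotation k F ε (z t) / z t).im - k| ≤ δ := by
    intro t
    have e : perturbedRotation k F ε (z t) / z t = Complex.I * k + ε * F (z t) / z t := by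
      have := hne t
      rw [perturbedRotation]
      field_simp
    rw [e]
    simp only [Complex.add_im, Complex.mul_im, Complex.I_re, Complex.I_im, Complex.ofReal_re,
      Complex.ofReal_im, zero_mul, one_mul, zero_add, add_sub_cancel_left]
    refine (Complex.abs_im_le_norm _).trans ?_
    rw [norm_div, norm_mul, Complex.norm_real, Real.norm_eq_abs, mul_div_assoc, hδ]
    gcongr
    · exact hF t
    · exact (hann t).1
  have hlow : ∀ s t, s ≤ t → (k - δ) * (t - s) ≤ Θ t - Θ s := fun s t hst =>
    mul_le_sub_of_deriv_ge hΘd (fun t => by linarith [(abs_le.1 (hbound t)).1]) hst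
  have hupp : ∀ s t, s ≤ t → Θ t - Θ s ≤ (k + δ) * (t - s) := fun s t hst => by
    have := mul_le_sub_of_deriv_ge (f := fun t => -Θ t) (c := -(k + δ)) (fun t => (hΘd t).neg)
      (fun t => by linarith [(abs_le.1 (hbound t)).2]) hst
    linarith
  have hkδ : k / 2 < k - δ := by linarith
  have hkδ0 : 0 < k - δ := by linarith
  have hΘc : Continuous Θ := continuous_iff_continuousAt.2 fun t => (hΘd t).continuousAt
  have hΘm : StrictMono Θ := fun s t hst => by
    have := hlow s t hst.le
    have : 0 < (k - δ) * (t - s) := mul_pos hkδ0 (sub_pos.2 hst)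
    linarith
  have hΘs : Function.Surjective Θ := by
    refine hΘc.surjective ?_ ?_
    · refine tendsto_atTop_mono' atTop (f₁ := fun t => Θ 0 + (k - δ) * t) ?_
        (tendsto_atTop_add_const_left _ _ (tendsto_id.const_mul_atTop hkδ0))
      filter_upwards [eventually_ge_atTop 0] with t ht
      have := hlow 0 t ht
      rw [sub_zero] at this
      linarith
    · refine tendsto_atBot_mono' atBot (f₁ := fun t => Θ 0 + (k - δ) * t) ?_
        (tendsto_atBot_add_const_left _ _ (tendsto_id.const_mul_atBot hkδ0))
      filter_upwards [eventually_le_atBot 0] with t ht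
      have := hlow t 0 ht
      linarith
  obtain ⟨t₁, ht₁⟩ := exists_angle_eq_add_two_pi hzc hT hper hmin hΘc hΘm hΘs hΘ hne
  have hlo := hlow t₁ (t₁ + T) (by linarith)
  have hup := hupp t₁ (t₁ + T) (by linarith)
  rw [ht₁, add_sub_cancel_left, add_sub_cancel_left] at hlo hup
  have hT' : T ≤ 4 * Real.pi / k := by
    rw [le_div_iff₀ hk]
    nlinarith
  have hkT : |k * T - 2 * Real.pi| ≤ |ε| * K := by
    have h4 : |k * T - 2 * Real.pi| ≤ δ * T := abs_le.2 ⟨by linarith, by linarith⟩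
    refine h4.trans ?_
    have : δ * T ≤ δ * (4 * Real.pi / k) := by gcongr
    refine this.trans_eq ?_
    rw [hδ, hK]
    ring
  obtain ⟨t₀, ht₀⟩ := hΘs 0
  refine ⟨t₀, ?_, hkT.trans_lt h2, fun s => ?_⟩
  · have := hΘ t₀
    rwa [ht₀, Complex.ofReal_zero, zero_mul, Complex.exp_zero, mul_one] at this
  · set v : ℝ → ℂ := fun s => Complex.exp (-(2 * Real.pi * s * Complex.I)) * z (T * s + t₀) with hv
    have hnorm : ∀ s : ℝ, ‖Complex.exp (-(2 * Real.pi * s * Complex.I))‖ = 1 := fun s => by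
      have := Complex.norm_exp_ofReal_mul_I (-(2 * Real.pi * s))
      push_cast at this
      rwa [neg_mul] at this
    have hd : ∀ s : ℝ, HasDerivAt v (Complex.exp (-(2 * Real.pi * s * Complex.I)) *
        (((k * T - 2 * Real.pi : ℝ) : ℂ) * (Complex.I * z (T * s + t₀))
          + (ε * T : ℝ) * F (z (T * s + t₀)))) s := by
      intro s
      have d1 : HasDerivAt (fun s : ℝ => T * s + t₀) T s := by
        simpa using ((hasDerivAt_id s).const_mul T).add_const t₀
      have d2 := (hz (T * s + t₀)).scomp s d1
      have d3 : HasDerivAt (fun s : ℝ => Complex.exp (-(2 * Real.pi * s * Complex.I)))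
          (Complex.exp (-(2 * Real.pi * s * Complex.I)) * (-(2 * Real.pi * 1 * Complex.I))) s :=
        HasDerivAt.cexp ((((hasDerivAt_id s).ofReal_comp.const_mul
          (2 * Real.pi : ℂ)).mul_const Complex.I).neg)
      refine (d3.mul d2).congr_deriv ?_
      simp only [Function.comp_def, Complex.real_smul, perturbedRotation]
      push_cast
      ring
    have hb : ∀ s : ℝ, ‖Complex.exp (-(2 * Real.pi * s * Complex.I)) *
        (((k * T - 2 * Real.pi : ℝ) : ℂ) * (Complex.I * z (T * s + t₀))
          + (ε * T : ℝ) * F (z (T * s + t₀)))‖ ≤ |ε| * (K * |b| + 4 * Real.pi / k * |M|) := by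
      intro s
      rw [norm_mul, hnorm, one_mul]
      refine (norm_add_le _ _).trans ?_
      rw [norm_mul, norm_mul, norm_mul, Complex.norm_I, one_mul, Complex.norm_real,
        Complex.norm_real, Real.norm_eq_abs, Real.norm_eq_abs, abs_mul, abs_of_pos hT]
      have e1 : |k * T - 2 * Real.pi| * ‖z (T * s + t₀)‖ ≤ (|ε| * K) * |b| := by
        gcongr
        exact (hann _).2.trans (le_abs_self b)
      have e2 : |ε| * T * ‖F (z (T * s + t₀))‖ ≤ |ε| * (4 * Real.pi / k) * |M| := by
        gcongr
        exact hF _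
      calc _ ≤ (|ε| * K) * |b| + |ε| * (4 * Real.pi / k) * |M| := add_le_add e1 e2
        _ = _ := by ring
    have hv0 : v 0 = z t₀ := by simp [hv]
    have hvs : v s = rotationInv s * z (T * s + t₀) := rfl
    rw [← hvs, ← hv0]
    refine lt_of_le_of_lt ?_ h3
    have hseg := norm_image_sub_le_of_norm_deriv_le_segment' (f := v) (a := 0) (b := 1)
      (fun s _ => (hd s).hasDerivWithinAt) (fun s _ => hb s) s s.2
    refine hseg.trans (mul_le_of_le_one_right ?_ (by linarith [s.2.2]))
    positivity

section

/-! ### The linearizing complex coordinate -/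

/-- The complex coordinate `Y - i X`, in which the unperturbed system is a rotation. -/
def toComplex (lam : ℝ) (p : ℝ × ℝ) : ℂ :=
  ⟨(p.2 + lam * p.1 + lam * p.1 ^ 2) / √lam, -(√(1 - lam) * p.1)⟩

/-- The inverse of `toComplex`. -/
def ofComplex (lam : ℝ) (z : ℂ) : ℝ × ℝ := toPlane lam (-z.im, z.re)

/-- The angular velocity of the unperturbed system. -/
def angularVelocity (lam : ℝ) : ℝ := √(1 - lam) / √lam

theorem continuous_toPlane (lam : ℝ) : Continuous (toPlane lam) := by
  unfold toPlane
  fun_prop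

theorem continuous_ofComplex (lam : ℝ) : Continuous (ofComplex lam) :=
  (continuous_toPlane lam).comp (by fun_prop)

/-- The perturbation in the complex coordinate. -/
def complexPerturbation (lam : ℝ) (n : ℕ) (a b : ℕ → ℕ → ℝ) : C(ℂ, ℂ) where
  toFun z := ⟨(poly n b (ofComplex lam z)
      + (lam + 2 * lam * (ofComplex lam z).1) * poly n a (ofComplex lam z)) / √lam,
    -(√(1 - lam) * poly n a (ofComplex lam z))⟩
  continuous_toFun := by
    have h1 := continuous_ofComplex lam
    have h2 : Continuous fun z => poly n a (ofComplex lam z) :=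
      (contDiff_poly n a (m := 0)).continuous.comp h1
    have h3 : Continuous fun z => poly n b (ofComplex lam z) :=
      (contDiff_poly n b (m := 0)).continuous.comp h1
    refine Complex.equivRealProdCLM.symm.continuous.comp (Continuous.prodMk ?_ ?_)
    · fun_prop
    · fun_prop

theorem complexPerturbation_apply (lam : ℝ) (n : ℕ) (a b : ℕ → ℕ → ℝ) (z : ℂ) :
    complexPerturbation lam n a b z = ⟨(poly n b (ofComplex lam z)
      + (lam + 2 * lam * (ofComplex lam z).1) * poly n a (ofComplex lam z)) / √lam,
    -(√(1 - lam) * poly n a (ofComplex lam z))⟩ := rfl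

theorem angularVelocity_pos {lam : ℝ} (h0 : 0 < lam) (h1 : lam < 1) : 0 < angularVelocity lam :=
  div_pos (Real.sqrt_pos.2 (by linarith)) (Real.sqrt_pos.2 h0)

theorem toComplex_ofComplex {lam : ℝ} (h0 : 0 < lam) (h1 : lam < 1) (z : ℂ) :
    toComplex lam (ofComplex lam z) = z := by
  have sl := Real.sqrt_pos.2 h0
  have sm := Real.sqrt_pos.2 (show 0 < 1 - lam by linarith)
  apply Complex.ext
  · simp only [toComplex, ofComplex, toPlane]
    field_simp
    ring
  · simp only [toComplex, ofComplex, toPlane]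
    field_simp

theorem ofComplex_toComplex {lam : ℝ} (h0 : 0 < lam) (h1 : lam < 1) (p : ℝ × ℝ) :
    ofComplex lam (toComplex lam p) = p := by
  have sl := Real.sqrt_pos.2 h0
  have sm := Real.sqrt_pos.2 (show 0 < 1 - lam by linarith)
  have e : √(1 - lam) * p.1 / √(1 - lam) = p.1 := by field_simp
  apply Prod.ext
  · simp only [toComplex, ofComplex, toPlane, neg_neg, e]
  · simp only [toComplex, ofComplex, toPlane, neg_neg, e]
    field_simp
    ring

theorem norm_toComplex_sq {lam : ℝ} (h0 : 0 < lam) (h1 : lam < 1) (p : ℝ × ℝ) :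
    ‖toComplex lam p‖ ^ 2 = 2 * ham lam p := by
  have e1 := Real.sq_sqrt h0.le
  have e2 := Real.sq_sqrt (show 0 ≤ 1 - lam by linarith)
  have sl := Real.sqrt_pos.2 h0
  rw [← Complex.normSq_eq_norm_sq, Complex.normSq_apply, ham_eq h0]
  simp only [toComplex]
  rw [← pow_two, div_pow, e1, ← pow_two, neg_pow, mul_pow, e2]
  field_simp

theorem ofComplex_ofReal (lam ρ : ℝ) : ofComplex lam (ρ : ℂ) = (0, √lam * ρ) := by
  simp [ofComplex, toPlane]

theorem perturbedRotation_toComplex {lam : ℝ} (h0 : 0 < lam) (h1 : lam < 1) (n : ℕ)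
    (a b : ℕ → ℕ → ℝ) (ε : ℝ) (p : ℝ × ℝ) :
    perturbedRotation (angularVelocity lam) (complexPerturbation lam n a b) ε (toComplex lam p) =
      ⟨((field lam n a b ε p).2 + (lam + 2 * lam * p.1) * (field lam n a b ε p).1) / √lam,
        -(√(1 - lam) * (field lam n a b ε p).1)⟩ := by
  have sl := Real.sqrt_pos.2 h0
  have e1 : √lam * √lam = lam := Real.mul_self_sqrt h0.le
  have e2 : √(1 - lam) * √(1 - lam) = 1 - lam := Real.mul_self_sqrt (by linarith)
  rw [perturbedRotation, complexPerturbation_apply, ofComplex_toComplex h0 h1]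
  apply Complex.ext
  · simp only [angularVelocity, toComplex, field, Complex.add_re, Complex.mul_re, Complex.mul_im,
      Complex.I_re, Complex.I_im, Complex.ofReal_re, Complex.ofReal_im]
    field_simp
    linear_combination (√lam * p.1) * e2
  · simp only [angularVelocity, toComplex, field, Complex.add_im, Complex.mul_re, Complex.mul_im,
      Complex.I_re, Complex.I_im, Complex.ofReal_re, Complex.ofReal_im]
    have e3 : √(1 - lam) / √lam * ((p.2 + lam * p.1 + lam * p.1 ^ 2) / √lam)
        = √(1 - lam) * (lam⁻¹ * p.2 + p.1 + p.1 ^ 2) := by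
      rw [div_mul_div_comm, e1]
      field_simp
    linear_combination e3

variable {lam : ℝ} {n : ℕ} {a b : ℕ → ℕ → ℝ} {ε : ℝ}

theorem hasDerivAt_toComplex (h0 : 0 < lam) (h1 : lam < 1) {γ : ℝ → ℝ × ℝ} {t : ℝ}
    (h : HasDerivAt γ (field lam n a b ε (γ t)) t) :
    HasDerivAt (fun t => toComplex lam (γ t)) (perturbedRotation (angularVelocity lam)
      (complexPerturbation lam n a b) ε (toComplex lam (γ t))) t := by
  rw [perturbedRotation_toComplex h0 h1]
  have hx : HasDerivAt (fun t => (γ t).1) (field lam n a b ε (γ t)).1 t := h.fst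
  have hy : HasDerivAt (fun t => (γ t).2) (field lam n a b ε (γ t)).2 t := h.snd
  have h2 := ((hy.add (hx.const_mul lam)).add ((hx.pow 2).const_mul lam)).div_const √lam
  have h3 := (hx.const_mul √(1 - lam)).neg
  have := Complex.equivRealProdCLM.symm.hasFDerivAt.comp_hasDerivAt t (h2.prodMk h3)
  refine this.congr_deriv ?_
  apply Complex.ext
  · simp
    ring
  · simp

theorem hasDerivAt_ofComplex (h0 : 0 < lam) (h1 : lam < 1) {z : ℝ → ℂ} {t : ℝ}
    (h : HasDerivAt z (perturbedRotation (angularVelocity lam)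
      (complexPerturbation lam n a b) ε (z t)) t) :
    HasDerivAt (fun t => ofComplex lam (z t)) (field lam n a b ε (ofComplex lam (z t))) t := by
  have sl := Real.sqrt_pos.2 h0
  have sm := Real.sqrt_pos.2 (show 0 < 1 - lam by linarith)
  have hre : HasDerivAt (fun t => (z t).re) (perturbedRotation (angularVelocity lam)
      (complexPerturbation lam n a b) ε (z t)).re t := Complex.reCLM.hasFDerivAt.comp_hasDerivAt t h
  have him : HasDerivAt (fun t => (z t).im) (perturbedRotation (angularVelocity lam)
      (complexPerturbation lam n a b) ε (z t)).im t := Complex.imCLM.hasFDerivAt.comp_hasDerivAt t h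
  have key := perturbedRotation_toComplex h0 h1 n a b ε (ofComplex lam (z t))
  rw [toComplex_ofComplex h0 h1] at key
  rw [key] at hre him
  simp only at hre him
  set p := ofComplex lam (z t) with hp
  have hx : HasDerivAt (fun t => (ofComplex lam (z t)).1) (field lam n a b ε p).1 t := by
    have := him.neg.div_const √(1 - lam)
    rw [neg_neg, mul_div_cancel_left₀ _ sm.ne'] at this
    exact this
  have hy : HasDerivAt (fun t => (ofComplex lam (z t)).2) (field lam n a b ε p).2 t := by
    have := ((hre.const_mul √lam).sub (hx.const_mul lam)).sub ((hx.pow 2).const_mul lam)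
    refine this.congr_deriv ?_
    rw [mul_div_cancel₀ _ sl.ne', ← hp]
    push_cast
    ring
  exact hx.prodMk hy

/-- Composition with a real polynomial map is itself polynomial on the Banach algebra
`C(unitInterval, ℂ)`, built from the real-linear operators of taking real and imaginary parts. -/
theorem contDiff_complexPerturbation_comp (m : ℕ) :
    ContDiff ℝ m fun u : C(unitInterval, ℂ) => (complexPerturbation lam n a b).comp u := by
  set re : C(unitInterval, ℂ) →L[ℝ] C(unitInterval, ℂ) :=
    ContinuousLinearMap.compLeftContinuous ℝ unitInterval (Complex.ofRealCLM.comp Complex.reCLM)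
  set im : C(unitInterval, ℂ) →L[ℝ] C(unitInterval, ℂ) :=
    ContinuousLinearMap.compLeftContinuous ℝ unitInterval (Complex.ofRealCLM.comp Complex.imCLM)
  have hre : ∀ u s, re u s = (u s).re := fun u s => rfl
  have him : ∀ u s, im u s = (u s).im := fun u s => rfl
  set x : C(unitInterval, ℂ) → C(unitInterval, ℂ) := fun u => (-(1 / √(1 - lam))) • im u with hx
  set y : C(unitInterval, ℂ) → C(unitInterval, ℂ) := fun u =>
    √lam • re u - lam • x u - lam • x u ^ 2 with hy
  have hxs : ∀ u s, x u s = ((ofComplex lam (u s)).1 : ℂ) := by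
    intro u s
    simp only [hx, ContinuousMap.smul_apply, him, Complex.real_smul, ofComplex, toPlane]
    push_cast
    ring
  have hys : ∀ u s, y u s = ((ofComplex lam (u s)).2 : ℂ) := by
    intro u s
    have : (ofComplex lam (u s)).2 = √lam * (u s).re - lam * (ofComplex lam (u s)).1
        - lam * (ofComplex lam (u s)).1 ^ 2 := rfl
    rw [this]
    simp only [hy, ContinuousMap.sub_apply, ContinuousMap.smul_apply, ContinuousMap.pow_apply, hre,
      hxs, Complex.real_smul]
    push_cast
    ring
  have hxc : ContDiff ℝ m x := im.contDiff.const_smul _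
  have hyc : ContDiff ℝ m y :=
    ((re.contDiff.const_smul _).sub (hxc.const_smul _)).sub ((hxc.pow 2).const_smul _)
  set P : (ℕ → ℕ → ℝ) → C(unitInterval, ℂ) → C(unitInterval, ℂ) := fun c u =>
    ∑ i ∈ Finset.range (n + 1), ∑ j ∈ Finset.range (n + 1 - i), c i j • (x u ^ i * y u ^ j) with hP
  have hPs : ∀ c u s, P c u s = (poly n c (ofComplex lam (u s)) : ℂ) := by
    intro c u s
    simp only [hP, poly, ContinuousMap.sum_apply, ContinuousMap.smul_apply,
      ContinuousMap.mul_apply, ContinuousMap.pow_apply, hxs, hys, Complex.real_smul]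
    push_cast
    simp only [mul_assoc]
  have hPc : ∀ c, ContDiff ℝ m (P c) := fun c =>
    ContDiff.sum fun i _ => ContDiff.sum fun j _ => ((hxc.pow i).mul (hyc.pow j)).const_smul _
  have hF : (fun u : C(unitInterval, ℂ) => (complexPerturbation lam n a b).comp u) = fun u =>
      (1 / √lam) • (P b u + (lam • (1 : C(unitInterval, ℂ)) + (2 * lam) • x u) * P a u)
        - √(1 - lam) • (ContinuousMap.const _ Complex.I * P a u) := by
    ext u s
    simp only [ContinuousMap.comp_apply, ContinuousMap.sub_apply, ContinuousMap.smul_apply,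
      ContinuousMap.add_apply, ContinuousMap.mul_apply, ContinuousMap.const_apply,
      ContinuousMap.one_apply, hPs, hxs, complexPerturbation_apply, Complex.real_smul]
    apply Complex.ext
    · simp
      ring
    · simp
  rw [hF]
  exact (((hPc b).add ((contDiff_const.add (hxc.const_smul _)).mul (hPc a))).const_smul _).sub
    ((contDiff_const.mul (hPc a)).const_smul _)

/-- Since `z = Y - i X`, the angle of `z` differs from that of `(X, Y)` by a quarter turn, which
does not affect the integral over a period. -/
theorem work_complexPerturbation {Q : Polynomial ℝ} (hQ : ∀ r : ℝ,
      ∫ θ in (0 : ℝ)..(2 * Real.pi), radialPart lam n a b (r * Real.cos θ, r * Real.sin θ)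
        = r ^ 2 * Q.eval (r ^ 2 / 2)) (ρ : ℝ) :
    work (complexPerturbation lam n a b) (ρ • 1)
      = (2 * Real.pi)⁻¹ * (ρ ^ 2 * Q.eval (ρ ^ 2 / 2)) := by
  rw [work_const, ← hQ]
  congr 1
  set g : ℝ → ℝ := fun θ => radialPart lam n a b (ρ * Real.cos θ, ρ * Real.sin θ) with hg
  have hper : Function.Periodic g (2 * Real.pi) := fun θ => by simp [hg]
  have h1 := hper.intervalIntegral_add_eq (Real.pi / 2) 0
  have h2 := intervalIntegral.integral_comp_add_right (a := 0) (b := 2 * Real.pi) g (Real.pi / 2)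
  rw [zero_add, add_comm (2 * Real.pi), h1, zero_add] at h2
  rw [← h2]
  congr 1
  ext θ
  have e1 : (Complex.exp (θ * Complex.I) * ρ).re = ρ * Real.cos θ := by
    rw [Complex.re_mul_ofReal, Complex.exp_ofReal_mul_I_re, mul_comm]
  have e2 : (Complex.exp (θ * Complex.I) * ρ).im = ρ * Real.sin θ := by
    rw [Complex.im_mul_ofReal, Complex.exp_ofReal_mul_I_im, mul_comm]
  simp only [hg, Real.cos_add_pi_div_two, Real.sin_add_pi_div_two]
  rw [complexPerturbation_apply, Complex.mul_re, Complex.conj_re, Complex.conj_im, ofComplex, e1,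
    e2, radialPart, show ρ * -Real.sin θ = -(ρ * Real.sin θ) by ring]
  ring

end

/-! ### Zeros of one-parameter families of functions -/

theorem HasZeroOfOrder.hasDerivAt_ne_zero {f : ℝ → ℝ} {x : ℝ} (h : HasZeroOfOrder f x 1) :
    f x = 0 ∧ deriv f x ≠ 0 := by
  refine ⟨by simpa using h.2.1 0 one_pos, ?_⟩
  rw [← iteratedDeriv_one]
  exact h.2.2

/-- Near a zero of order `m` of `D(·, 0)`, the function `D(·, ε)` has at most `m` zeros, counted
with multiplicity, for small `ε`. -/
theorem exists_sum_order_le_of_hasZeroOfOrder {q : ℕ} {O : Set (ℝ × ℝ)} {D : ℝ × ℝ → ℝ}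
    (hO : IsOpen O) (hD : ContDiffOn ℝ q D O) {x : ℝ} (hx : (x, 0) ∈ O) {m : ℕ} (hm : m ≤ q)
    (h : HasZeroOfOrder (fun s => D (s, 0)) x m) :
    ∃ δ > 0, ∀ ε, |ε| < δ → ∃ (Z : Finset ℝ) (ord : ℝ → ℕ), ∑ s ∈ Z, ord s ≤ m ∧
      ∀ s, |s - x| < δ → (s, ε) ∈ O ∧ (D (s, ε) = 0 →
        s ∈ Z ∧ HasZeroOfOrder (fun s => D (s, ε)) s (ord s)) := by
  obtain ⟨i, hi⟩ := Nat.exists_eq_add_of_le' hm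
  have hc := (contDiffOn_iteratedDeriv_fst hO hD hi.symm).continuousOn
  have hev : ∀ᶠ p in 𝓝 (x, (0 : ℝ)), p ∈ O ∧ iteratedDeriv m (fun r => D (r, p.2)) p.1 ≠ 0 :=
    (hO.eventually_mem hx).and ((hc.continuousAt (hO.mem_nhds hx)).eventually_ne h.2.2)
  obtain ⟨δ, hδ, hball⟩ := Metric.eventually_nhds_iff_ball.1 hev
  refine ⟨δ, hδ, fun ε hε => ?_⟩
  have hmem : ∀ s, |s - x| < δ → (s, ε) ∈ Metric.ball (x, (0 : ℝ)) δ := by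
    intro s hs
    rw [Metric.mem_ball, Prod.dist_eq, max_lt_iff, Real.dist_eq, Real.dist_eq, sub_zero]
    exact ⟨hs, hε⟩
  set f : ℝ → ℝ := fun s => D (s, ε) with hf
  set J : Set ℝ := Metric.ball x δ with hJ
  have hJmem : ∀ s, s ∈ J ↔ |s - x| < δ := fun s => by rw [hJ, Metric.mem_ball, Real.dist_eq]
  have hfJ : ContDiffOn ℝ m f J := by
    refine (hD.of_le (by exact_mod_cast hm)).comp (t := O) ?_ ?_
    · exact (contDiff_id.prodMk contDiff_const).contDiffOn
    · exact fun s hs => (hball _ (hmem s ((hJmem s).1 hs))).1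
  have hne : ∀ s ∈ J, iteratedDeriv m f s ≠ 0 := fun s hs =>
    (hball _ (hmem s ((hJmem s).1 hs))).2
  have hcount := sum_order_le_of_iteratedDeriv_ne_zero (convex_ball x δ).ordConnected
    Metric.isOpen_ball m hfJ hne
  -- More than `m` distinct zeros would already violate the Rolle count with all orders equal to 1.
  have hfin : {s | s ∈ J ∧ f s = 0}.Finite := by
    by_contra hinf
    obtain ⟨Z, hZ, hcard⟩ := Set.Infinite.exists_subset_card_eq hinf (m + 1)
    have := hcount Z (fun _ => 1) (fun z hz => (hZ hz).1) (fun z hz j hj => by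
      rw [Nat.lt_one_iff.1 hj, iteratedDeriv_zero]
      exact (hZ hz).2)
    simp at this
    omega
  set ord : ℝ → ℕ := fun s => sInf {j | iteratedDeriv j f s ≠ 0} with hord
  have hlow : ∀ s, ∀ j < ord s, iteratedDeriv j f s = 0 := fun s j hj => by
    by_contra hne'
    exact Nat.notMem_of_lt_sInf hj hne'
  refine ⟨hfin.toFinset, ord, ?_, fun s hs => ⟨(hball _ (hmem s hs)).1, fun h0 => ?_⟩⟩
  · exact hcount _ ord (fun z hz => ((hfin.mem_toFinset).1 hz).1) fun z _ => hlow z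
  have hsJ := (hJmem s).2 hs
  refine ⟨hfin.mem_toFinset.2 ⟨hsJ, h0⟩, ?_, hlow s,
    Nat.sInf_mem (s := {j | iteratedDeriv j f s ≠ 0}) ⟨m, hne s hsJ⟩⟩
  exact ((hfJ.contDiffAt (Metric.isOpen_ball.mem_nhds hsJ))).of_le
    (by exact_mod_cast Nat.sInf_le (hne s hsJ))

/-- A simple zero persists under perturbation. -/
theorem exists_zero_of_hasZeroOfOrder_one {O : Set (ℝ × ℝ)} {D : ℝ × ℝ → ℝ}
    (hO : IsOpen O) (hD : ContinuousOn D O) {x : ℝ} (hx : (x, 0) ∈ O)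
    (h : HasZeroOfOrder (fun s => D (s, 0)) x 1) :
    ∃ δ > 0, ∀ ε, |ε| < δ → ∃ s, (s, ε) ∈ O ∧ D (s, ε) = 0 := by
  obtain ⟨h0, h1⟩ := h.hasDerivAt_ne_zero
  obtain ⟨δ, hδ, hball⟩ := Metric.isOpen_iff.1 hO _ hx
  have hmem : ∀ s ε, |s - x| < δ → |ε| < δ → (s, ε) ∈ O := by
    intro s ε hs hε
    refine hball ?_
    rw [Metric.mem_ball, Prod.dist_eq, max_lt_iff, Real.dist_eq, Real.dist_eq, sub_zero]
    exact ⟨hs, hε⟩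
  -- A simple zero gives opposite signs on its two sides. They persist for small `ε`, and the
  -- intermediate value theorem applies.
  have hsign : ∃ s t, |s - x| < δ ∧ |t - x| < δ ∧ D (s, 0) < 0 ∧ 0 < D (t, 0) := by
    have key : ∃ η > 0, ∀ u, 0 < u → u < η →
        (D (x - u, 0) < 0 ∧ 0 < D (x + u, 0)) ∨ (D (x + u, 0) < 0 ∧ 0 < D (x - u, 0)) := by
      rcases lt_or_gt_of_ne h1 with hneg | hpos
      · obtain ⟨η, hη, hs⟩ := Metric.eventually_nhds_iff_ball.1
          (eventually_nhdsWithin_sign_eq_of_deriv_neg hneg h0)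
        refine ⟨η, hη, fun u hu huη => Or.inr ⟨?_, ?_⟩⟩
        · have := hs (x + u) (by
            rw [Metric.mem_ball, Real.dist_eq, add_sub_cancel_left,
              abs_of_pos hu]
            exact huη)
          rw [show x - (x + u) = -u by ring, sign_neg (neg_lt_zero.2 hu)] at this
          exact sign_eq_neg_one_iff.1 this
        · have := hs (x - u) (by
            rw [Metric.mem_ball, Real.dist_eq, show x - u - x = -u by ring, abs_neg,
              abs_of_pos hu]
            exact huη)
          rw [show x - (x - u) = u by ring, sign_pos hu] at this
          exact sign_eq_one_iff.1 this
      · obtain ⟨η, hη, hs⟩ := Metric.eventually_nhds_iff_ball.1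
          (eventually_nhdsWithin_sign_eq_of_deriv_pos hpos h0)
        refine ⟨η, hη, fun u hu huη => Or.inl ⟨?_, ?_⟩⟩
        · have := hs (x - u) (by
            rw [Metric.mem_ball, Real.dist_eq, show x - u - x = -u by ring, abs_neg,
              abs_of_pos hu]
            exact huη)
          rw [show x - u - x = -u by ring, sign_neg (neg_lt_zero.2 hu)] at this
          exact sign_eq_neg_one_iff.1 this
        · have := hs (x + u) (by
            rw [Metric.mem_ball, Real.dist_eq, add_sub_cancel_left,
              abs_of_pos hu]
            exact huη)
          rw [show x + u - x = u by ring, sign_pos hu] at this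
          exact sign_eq_one_iff.1 this
    obtain ⟨η, hη, hs⟩ := key
    have hu : 0 < min η δ / 2 := half_pos (lt_min hη hδ)
    have hu1 : min η δ / 2 < min η δ := half_lt_self (lt_min hη hδ)
    have a1 : |x - min η δ / 2 - x| < δ := by
      rw [show x - min η δ / 2 - x = -(min η δ / 2) by ring, abs_neg, abs_of_pos hu]
      exact hu1.trans_le (min_le_right _ _)
    have a2 : |x + min η δ / 2 - x| < δ := by
      rw [add_sub_cancel_left, abs_of_pos hu]
      exact hu1.trans_le (min_le_right _ _)
    rcases hs _ hu (hu1.trans_le (min_le_left _ _)) with h | h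
    · exact ⟨_, _, a1, a2, h⟩
    · exact ⟨_, _, a2, a1, h⟩
  obtain ⟨s, t, hs, ht, hDs, hDt⟩ := hsign
  have hcont : ∀ u, |u - x| < δ → ContinuousAt (fun ε : ℝ => D (u, ε)) 0 := by
    intro u hu
    have h2 := hD.continuousAt (hO.mem_nhds (hmem u 0 hu (by simpa using hδ)))
    exact ContinuousAt.comp (f := fun ε : ℝ => (u, ε)) h2 (by fun_prop)
  have hev := ((hcont s hs).eventually_lt_const hDs).and ((hcont t ht).eventually_const_lt hDt)
  obtain ⟨δ', hδ', hev'⟩ := Metric.eventually_nhds_iff_ball.1 hev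
  refine ⟨min δ δ', lt_min hδ hδ', fun ε hε => ?_⟩
  have hεδ := hε.trans_le (min_le_left _ _)
  obtain ⟨e1, e2⟩ := hev' ε (by
    rw [Metric.mem_ball, Real.dist_eq, sub_zero]
    exact hε.trans_le (min_le_right _ _))
  have hJ : ∀ u ∈ uIcc s t, |u - x| < δ := by
    intro u hu
    have := (convex_ball x δ).ordConnected.uIcc_subset (show s ∈ Metric.ball x δ by
      rwa [Metric.mem_ball, Real.dist_eq]) (show t ∈ Metric.ball x δ by
      rwa [Metric.mem_ball, Real.dist_eq]) hu
    rwa [Metric.mem_ball, Real.dist_eq] at this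
  have hcu : ContinuousOn (fun u => D (u, ε)) (uIcc s t) :=
    hD.comp (by fun_prop) fun u hu => hmem u ε (hJ u hu) hεδ
  obtain ⟨u, hu, hu0⟩ := intermediate_value_uIcc hcu
    (show (0 : ℝ) ∈ uIcc (D (s, ε)) (D (t, ε)) from mem_uIcc.2 (Or.inl ⟨e1.le, e2.le⟩))
  exact ⟨u, hmem u ε (hJ u hu) hεδ, hu0⟩

section

/-! ### Closed orbits and the local return maps -/

variable {lam : ℝ} {n : ℕ} {a b : ℕ → ℕ → ℝ} {ε : ℝ}

/-- A periodic solution `γ` of least period `T` that starts at the point `ρ` of the positive real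
axis and is `η`-close, in the rotating frame, to the constant `ρ`. -/
structure IsSectionSolution (lam : ℝ) (X : ℝ × ℝ → ℝ × ℝ) (η : ℝ) (γ : ℝ → ℝ × ℝ) (T ρ : ℝ) :
    Prop where
  periodic : IsPeriodicSolution X γ T
  start : toComplex lam (γ 0) = ρ
  period : |angularVelocity lam * T - 2 * Real.pi| < η
  near : ∀ s : unitInterval, ‖rotationInv s * toComplex lam (γ (T * s)) - ρ‖ < η

theorem mem_subannulus_iff (h0 : 0 < lam) (h1 : lam < 1) {c d : ℝ} (hd : 0 ≤ d)
    {p : ℝ × ℝ} : p ∈ subannulus lam c d ↔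
      √(2 * c) ≤ ‖toComplex lam p‖ ∧ ‖toComplex lam p‖ ≤ √(2 * d) := by
  have := norm_toComplex_sq h0 h1 p
  rw [Real.sqrt_le_left (norm_nonneg _), Real.le_sqrt (norm_nonneg _) (by linarith), this,
    subannulus, mem_ofPred_eq]
  constructor <;> rintro ⟨h, h'⟩ <;> constructor <;> linarith

theorem exists_isSectionSolution (h0 : 0 < lam) (h1 : lam < 1) (n : ℕ) (a b : ℕ → ℕ → ℝ)
    {c d η : ℝ} (hc : 0 < c) (hd : 0 ≤ d) (hη : 0 < η) :
    ∃ ε₁ > 0, ∀ ε : ℝ, |ε| < ε₁ → ∀ Γ, IsClosedOrbit (field lam n a b ε) Γ →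
      Γ ⊆ subannulus lam c d → ∃ γ T ρ, Γ = range γ ∧ ρ ∈ Icc √(2 * c) √(2 * d) ∧
        IsSectionSolution lam (field lam n a b ε) η γ T ρ := by
  obtain ⟨ε₁, hε₁, key⟩ := exists_section_of_periodic (angularVelocity_pos h0 h1)
    (complexPerturbation lam n a b) (a := √(2 * c)) (b := √(2 * d))
    (Real.sqrt_pos.2 (by linarith)) hη
  refine ⟨ε₁, hε₁, ?_⟩
  rintro ε hε Γ ⟨γ, T, hγ, rfl⟩ hΓ
  have hX := contDiff_field lam n a b ε (m := 1)
  have hb : ∀ t, √(2 * c) ≤ ‖toComplex lam (γ t)‖ ∧ ‖toComplex lam (γ t)‖ ≤ √(2 * d) := fun t =>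
    (mem_subannulus_iff h0 h1 hd).1 (hΓ ⟨t, rfl⟩)
  obtain ⟨t₀, h2, h3, h4⟩ := key ε hε (fun t => toComplex lam (γ t)) T hγ.2.1
    (fun t => hasDerivAt_toComplex h0 h1 (hγ.1 t)) (fun t => by simp only [hγ.2.2.1 t])
    (fun s t hst he => (hγ.le_of_eq hX hst (by
      rw [← ofComplex_toComplex h0 h1 (γ s), he, ofComplex_toComplex h0 h1])).2) hb
  refine ⟨fun t => γ (t + t₀), T, ‖toComplex lam (γ t₀)‖, (range_shift γ t₀).symm, hb t₀,
    hγ.shift hX t₀, ?_, h3, fun s => ?_⟩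
  · rw [zero_add]; exact h2
  · rw [← h2]; exact h4 s

theorem IsSectionSolution.mono {X : ℝ × ℝ → ℝ × ℝ} {η η' : ℝ} {γ : ℝ → ℝ × ℝ} {T ρ : ℝ}
    (h : IsSectionSolution lam X η γ T ρ) (hη : η ≤ η') : IsSectionSolution lam X η' γ T ρ :=
  ⟨h.periodic, h.start, h.period.trans_le hη, fun s => (h.near s).trans_le hη⟩

variable {q : ℕ} {ρ₀ r : ℝ} {O : Set (ℝ × ℝ)} {T D : ℝ × ℝ → ℝ}

/-- The positive real axis is the half-line `x = 0`, `y > 0`, and increasing angle means decreasing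
`x` there. -/
theorem IsLocalReturn.field_fst_neg (h0 : 0 < lam) (h1 : lam < 1)
    (h : IsLocalReturn (angularVelocity lam) (complexPerturbation lam n a b) q ρ₀ r O T D)
    {p : ℝ × ℝ} (hp : p ∈ O) : (field lam n a b p.2 (ofComplex lam (p.1 : ℂ))).1 < 0 := by
  have key := congrArg Complex.im
    (perturbedRotation_toComplex h0 h1 n a b p.2 (ofComplex lam (p.1 : ℂ)))
  rw [toComplex_ofComplex h0 h1] at key
  have e : (perturbedRotation (angularVelocity lam) (complexPerturbation lam n a b) p.2 p.1).im
      = angularVelocity lam * p.1 + p.2 * (complexPerturbation lam n a b p.1).im := by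
    simp [perturbedRotation]
  rw [e] at key
  have := h.transversal p hp
  have sm := Real.sqrt_pos.2 (show 0 < 1 - lam by linarith)
  simp only at key
  nlinarith

theorem IsLocalReturn.exists_solution (h0 : 0 < lam) (h1 : lam < 1)
    (h : IsLocalReturn (angularVelocity lam) (complexPerturbation lam n a b) q ρ₀ r O T D)
    {p : ℝ × ℝ} (hp : p ∈ O) : ∃ γ : ℝ → ℝ × ℝ, γ 0 = ofComplex lam (p.1 : ℂ) ∧
      γ (T p) = ofComplex lam ((p.1 + p.2 * D p : ℝ) : ℂ) ∧ ∀ t ∈ Icc 0 (T p),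
        HasDerivAt γ (field lam n a b p.2 (γ t)) t ∧ |‖toComplex lam (γ t)‖ - ρ₀| < r := by
  obtain ⟨z, hz0, hzT, hz⟩ := h.solution p hp
  refine ⟨fun t => ofComplex lam (z t), by simp only [hz0], by simp only [hzT], fun t ht => ?_⟩
  refine ⟨hasDerivAt_ofComplex h0 h1 (hz t ht).1, ?_⟩
  rw [toComplex_ofComplex h0 h1]
  exact (hz t ht).2

/-- Since `ofComplex` maps `ρ` to `(0, √λ ρ)`, the vector `(0, √λ)` makes the segment parameter `s`
equal to the increment of the radius. -/
theorem IsLocalReturn.isReturnMap (h0 : 0 < lam) (h1 : lam < 1)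
    (h : IsLocalReturn (angularVelocity lam) (complexPerturbation lam n a b) q ρ₀ r O T D)
    {ρ : ℝ} (hp : (ρ, ε) ∈ O) (hD : D (ρ, ε) = 0) :
    IsReturnMap (field lam n a b ε) (ofComplex lam (ρ : ℂ)) (0, √lam) (T (ρ, ε))
      (fun s => s + ε * D (ρ + s, ε)) := by
  have sl := Real.sqrt_pos.2 h0
  have hmap : ContinuousAt (fun s : ℝ => (ρ + s, ε)) 0 := by fun_prop
  have hnhds : O ∈ 𝓝 (ρ + 0, ε) := by rw [add_zero]; exact h.isOpen.mem_nhds hp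
  refine ⟨?_, by simp [hD], ?_, fun s => T (ρ + s, ε), by simp, ?_, ?_⟩
  · have := h.field_fst_neg h0 h1 hp
    simp only [mul_zero, sub_zero]
    exact (mul_neg_of_neg_of_pos this sl).ne
  · have : ContinuousAt (fun s : ℝ => D (ρ + s, ε)) 0 :=
      ContinuousAt.comp (f := fun s : ℝ => (ρ + s, ε))
        (h.contDiffOn.continuousOn.continuousAt hnhds) hmap
    exact continuousAt_id.add (continuousAt_const.mul this)
  · exact ContinuousAt.comp (f := fun s : ℝ => (ρ + s, ε)) (h.continuousOn.continuousAt hnhds) hmap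
  · filter_upwards [hmap.eventually_mem hnhds] with s hs
    obtain ⟨γ, hγ0, hγT, hγ⟩ := h.exists_solution h0 h1 hs
    refine ⟨γ, fun t ht => (hγ t ht).1.hasDerivWithinAt, ?_, ?_⟩
    · rw [hγ0, ofComplex_ofReal, ofComplex_ofReal]
      ext <;> simp
      ring
    · rw [hγT, ofComplex_ofReal, ofComplex_ofReal]
      ext <;> simp
      ring

theorem IsLocalReturn.hasMultiplicity (h0 : 0 < lam) (h1 : lam < 1)
    (h : IsLocalReturn (angularVelocity lam) (complexPerturbation lam n a b) q ρ₀ r O T D)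
    {ρ η : ℝ} (hp : (ρ, ε) ∈ O) (hε : ε ≠ 0) (hD : D (ρ, ε) = 0) {m : ℕ}
    (hm : HasZeroOfOrder (fun s => D (s, ε)) ρ m) {γ : ℝ → ℝ × ℝ}
    (hγ : IsSectionSolution lam (field lam n a b ε) η γ (T (ρ, ε)) ρ) :
    HasMultiplicity (field lam n a b ε) (range γ) m := by
  refine ⟨γ, T (ρ, ε), (0, √lam), fun s => s + ε * D (ρ + s, ε), hγ.periodic, rfl, ?_, ?_⟩
  · rw [← ofComplex_toComplex h0 h1 (γ 0), hγ.start]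
    exact h.isReturnMap h0 h1 hp hD
  · simpa only [add_sub_cancel_left] using hm.const_mul_comp_add hε

/-- The closed orbits near a circle of radius `ρ₀` correspond to zeros of `D(·, ε)`, for which
`D(·, 0)` gives a bound. -/
theorem IsLocalReturn.exists_sum_multiplicity_le (h0 : 0 < lam) (h1 : lam < 1)
    (h : IsLocalReturn (angularVelocity lam) (complexPerturbation lam n a b) q ρ₀ r O T D)
    {m : ℕ} (hm : m ≤ q) (hord : HasZeroOfOrder (fun s => D (s, 0)) ρ₀ m) :
    ∃ δ > 0, ∀ ε, ε ≠ 0 → |ε| < δ → ∃ (Z : Finset ℝ) (ord : ℝ → ℕ), ∑ s ∈ Z, ord s ≤ m ∧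
      ∀ γ τ ρ, |ρ - ρ₀| < δ → IsSectionSolution lam (field lam n a b ε) δ γ τ ρ →
        ρ ∈ Z ∧ HasMultiplicity (field lam n a b ε) (range γ) (ord ρ) := by
  obtain ⟨δ, hδ, key⟩ := exists_sum_order_le_of_hasZeroOfOrder h.isOpen h.contDiffOn h.mem hm hord
  obtain ⟨η, hη, huniq⟩ := h.unique
  -- One half of `η` is for the distance of the curve from `ρ`, the other for that of `ρ` from `ρ₀`.
  have hδη : 0 < min δ (η / 2) := lt_min hδ (half_pos hη)
  refine ⟨min δ (η / 2), hδη, fun ε hε0 hε => ?_⟩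
  obtain ⟨Z, ord, hsum, hZ⟩ := key ε (hε.trans_le (min_le_left _ _))
  refine ⟨Z, ord, hsum, fun γ τ ρ hρ hγ => ?_⟩
  have hle : min δ (η / 2) ≤ η / 2 := min_le_right _ _
  have hT : toComplex lam (γ τ) = ρ := by
    have := hγ.periodic.2.2.1 0
    rw [zero_add] at this
    rw [this, hγ.start]
  obtain ⟨hO, hτ, hend⟩ := huniq (fun t => toComplex lam (γ t)) τ (ρ, ε) (by dsimp only; linarith)
    (by linarith [hγ.period]) (fun t => hasDerivAt_toComplex h0 h1 (hγ.periodic.1 t)) hγ.start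
    (by simp [hT]) fun s => by
      have e1 : ‖(ρ : ℂ) - ρ₀‖ < η / 2 := by
        rw [← Complex.ofReal_sub, Complex.norm_real, Real.norm_eq_abs]
        exact hρ.trans_le hle
      calc ‖rotationInv s * toComplex lam (γ (τ * s)) - ρ₀‖
          = ‖(rotationInv s * toComplex lam (γ (τ * s)) - ρ) + ((ρ : ℂ) - ρ₀)‖ := by
            congr 1; ring
        _ ≤ _ := norm_add_le _ _
        _ < η / 2 + η / 2 := add_lt_add ((hγ.near s).trans_le hle) e1
        _ = η := by ring
  -- The orbit closes up, so `ρ = ρ + ε D(ρ, ε)`.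
  have hD : D (ρ, ε) = 0 := by
    have e : ((ρ : ℝ) : ℂ) = ((ρ + ε * D (ρ, ε) : ℝ) : ℂ) := hT.symm.trans hend
    rw [Complex.ofReal_inj] at e
    have : ε * D (ρ, ε) = 0 := by linarith
    exact (mul_eq_zero.1 this).resolve_left hε0
  obtain ⟨hρZ, hρm⟩ := (hZ ρ (hρ.trans_le (min_le_left _ _))).2 hD
  rw [← hτ] at hγ
  exact ⟨hρZ, h.hasMultiplicity h0 h1 hO hε0 hD hρm hγ⟩

/-- A simple zero of `D(·, 0)` gives rise to a closed orbit. -/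
theorem IsLocalReturn.exists_isClosedOrbit (h0 : 0 < lam) (h1 : lam < 1)
    (h : IsLocalReturn (angularVelocity lam) (complexPerturbation lam n a b) q ρ₀ r O T D)
    (hord : HasZeroOfOrder (fun s => D (s, 0)) ρ₀ 1) :
    ∃ δ > 0, ∀ ε, |ε| < δ → ∃ Γ, IsClosedOrbit (field lam n a b ε) Γ ∧
      ∀ p ∈ Γ, |‖toComplex lam p‖ - ρ₀| < r := by
  obtain ⟨δ, hδ, key⟩ :=
    exists_zero_of_hasZeroOfOrder_one h.isOpen h.contDiffOn.continuousOn h.mem hord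
  refine ⟨δ, hδ, fun ε hε => ?_⟩
  obtain ⟨ρ, hO, hD⟩ := key ε hε
  obtain ⟨γ, hγ0, hγT, hγ⟩ := h.exists_solution h0 h1 hO
  have hneg := h.field_fst_neg h0 h1 hO
  simp only [hD, mul_zero, add_zero] at hγT
  obtain ⟨γ', T', hγ', hr⟩ := exists_isPeriodicSolution (contDiff_field lam n a b ε)
    (h.time_pos _ hO) (hγT.trans hγ0.symm) (fun t ht => (hγ t ht).1.hasDerivWithinAt) (by
      intro e
      rw [hγ0] at e
      simp only [e, Prod.fst_zero, lt_self_iff_false] at hneg)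
  refine ⟨range γ', ⟨γ', T', hγ', rfl⟩, ?_⟩
  rw [hr]
  rintro _ ⟨t, ht, rfl⟩
  exact (hγ t ht).2

end

section

/-! ### Counting the closed orbits in a closed subannulus -/

variable {lam : ℝ} {n : ℕ} {a b : ℕ → ℕ → ℝ} {Q : Polynomial ℝ}

/-- Near `ρ₀` the limit is `D(s, 0) = s Q(s² / 2) / k`, whose zeros have the orders of the roots of
`Q`. -/
theorem IsLocalReturn.hasZeroOfOrder (h0 : 0 < lam) (h1 : lam < 1) (hQ0 : Q ≠ 0) (hQ : ∀ r : ℝ,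
      ∫ θ in (0 : ℝ)..(2 * Real.pi), radialPart lam n a b (r * Real.cos θ, r * Real.sin θ)
        = r ^ 2 * Q.eval (r ^ 2 / 2)) {q : ℕ} {ρ₀ r : ℝ} {O : Set (ℝ × ℝ)} {T D : ℝ × ℝ → ℝ}
    (h : IsLocalReturn (angularVelocity lam) (complexPerturbation lam n a b) q ρ₀ r O T D) :
    HasZeroOfOrder (fun s => D (s, 0)) ρ₀ (Q.rootMultiplicity (ρ₀ ^ 2 / 2)) := by
  have hk := angularVelocity_pos h0 h1
  refine (hasZeroOfOrder_mul_comp_sq hQ0 (K := 1 / angularVelocity lam) (by positivity)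
    (h.pos _ h.mem)).congr ?_
  have hmap : ContinuousAt (fun s : ℝ => (s, (0 : ℝ))) ρ₀ := by fun_prop
  filter_upwards [hmap.eventually_mem (h.isOpen.mem_nhds h.mem)] with s hs
  have hs0 : 0 < s := h.pos _ hs
  rw [h.limit _ hs rfl, work_complexPerturbation hQ]
  have := Real.pi_pos
  field_simp

theorem exists_local_sum_multiplicity_le (h0 : 0 < lam) (h1 : lam < 1) (hQ0 : Q ≠ 0)
    (hQ : ∀ r : ℝ,
      ∫ θ in (0 : ℝ)..(2 * Real.pi), radialPart lam n a b (r * Real.cos θ, r * Real.sin θ)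
        = r ^ 2 * Q.eval (r ^ 2 / 2)) {ρ₀ : ℝ} (hρ₀ : 0 < ρ₀) :
    ∃ δ > 0, ∀ ε, ε ≠ 0 → |ε| < δ → ∃ (Z : Finset ℝ) (ord : ℝ → ℕ),
      ∑ s ∈ Z, ord s ≤ Q.rootMultiplicity (ρ₀ ^ 2 / 2) ∧
      ∀ γ τ ρ, |ρ - ρ₀| < δ → IsSectionSolution lam (field lam n a b ε) δ γ τ ρ →
        ρ ∈ Z ∧ HasMultiplicity (field lam n a b ε) (range γ) (ord ρ) := by
  -- The `+ 1` keeps the smoothness class nonzero when `Q` does not vanish at `ρ₀² / 2`.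
  obtain ⟨O, T, D, h⟩ := exists_isLocalReturn (angularVelocity_pos h0 h1)
    (q := Q.rootMultiplicity (ρ₀ ^ 2 / 2) + 1) (Nat.succ_ne_zero _)
    (contDiff_complexPerturbation_comp (lam := lam) (n := n) (a := a) (b := b) _) hρ₀ one_pos
  exact h.exists_sum_multiplicity_le h0 h1 (Nat.le_succ _) (h.hasZeroOfOrder h0 h1 hQ0 hQ)

/-- Bookkeeping for the count: each closed orbit is labelled by a centre of the finite cover and a
radius on the section. -/
theorem sum_le_sum_sum_of_injOn {α β γ : Type*} {L : Finset α} {t : Finset β} {Z : β → Finset γ}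
    (f : β → γ → ℕ) {p : α → β × γ} (hinj : InjOn p (L : Set α))
    (hp : ∀ i ∈ L, (p i).1 ∈ t ∧ (p i).2 ∈ Z (p i).1) :
    ∑ i ∈ L, f (p i).1 (p i).2 ≤ ∑ x ∈ t, ∑ s ∈ Z x, f x s := by
  classical
  have hinj' : InjOn (fun i => (⟨(p i).1, (p i).2⟩ : (_ : β) × γ)) (L : Set α) := by
    intro i hi j hj he
    simp only [Sigma.mk.injEq, heq_eq_eq] at he
    exact hinj hi hj (Prod.ext he.1 he.2)
  rw [← Finset.sum_sigma t Z fun y => f y.1 y.2,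
    ← Finset.sum_image (f := fun y : (_ : β) × γ => f y.1 y.2) hinj']
  refine Finset.sum_le_sum_of_subset fun y hy => ?_
  obtain ⟨i, hi, rfl⟩ := Finset.mem_image.1 hy
  exact Finset.mem_sigma.2 (hp i hi)

theorem sum_rootMultiplicity_sq_le (hQn : Q ∈ Polynomial.degreeLT ℝ n) (hQ0 : Q ≠ 0)
    {t : Finset ℝ} (ht : ∀ x ∈ t, 0 < x) :
    ∑ x ∈ t, Q.rootMultiplicity (x ^ 2 / 2) ≤ n - 1 := by
  classical
  have hsq : InjOn (fun x : ℝ => x ^ 2 / 2) (t : Set ℝ) := by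
    intro x hx y hy he
    have : x ^ 2 = y ^ 2 := by simp only at he; linarith
    exact (pow_left_inj₀ (ht x hx).le (ht y hy).le two_ne_zero).1 this
  rw [← Finset.sum_image (f := fun h => Q.rootMultiplicity h) hsq]
  exact sum_rootMultiplicity_le hQn hQ0 _

/-- Finitely many local counts cover the compact interval of radii. The labelling of orbits is
injective because distinct closed orbits are disjoint. At each centre the local total is bounded by
a root multiplicity of `Q`, and these sum to at most `n - 1`. -/
theorem exists_finset_isClosedOrbit (h0 : 0 < lam) (h1 : lam < 1)
    (hQn : Q ∈ Polynomial.degreeLT ℝ n) (hQ0 : Q ≠ 0) (hQ : ∀ r : ℝ,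
      ∫ θ in (0 : ℝ)..(2 * Real.pi), radialPart lam n a b (r * Real.cos θ, r * Real.sin θ)
        = r ^ 2 * Q.eval (r ^ 2 / 2)) {c d : ℝ} (hc : 0 < c) (hcd : c ≤ d) :
    ∃ ε₀ > 0, ∀ ε : ℝ, 0 < |ε| → |ε| < ε₀ →
      ∃ (L : Finset (Set (ℝ × ℝ))) (m : Set (ℝ × ℝ) → ℕ),
        (∀ Γ, Γ ∈ L ↔ IsClosedOrbit (field lam n a b ε) Γ ∧ Γ ⊆ subannulus lam c d) ∧
        (∀ Γ ∈ L, HasMultiplicity (field lam n a b ε) Γ (m Γ)) ∧ ∑ Γ ∈ L, m Γ ≤ n - 1 := by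
  have hcpos : 0 < √(2 * c) := Real.sqrt_pos.2 (by linarith)
  have hKle : √(2 * c) ≤ √(2 * d) := Real.sqrt_le_sqrt (by linarith)
  have hloc := fun (ρ₀ : ℝ) (hρ₀ : 0 < ρ₀) => exists_local_sum_multiplicity_le h0 h1 hQ0 hQ hρ₀
  choose! δ hδ hloc using hloc
  obtain ⟨t, htK, hcover⟩ := (isCompact_Icc (a := √(2 * c)) (b := √(2 * d))).elim_nhds_subcover
    (fun x => Metric.ball x (δ x))
    fun x hx => Metric.ball_mem_nhds x (hδ x (hcpos.trans_le hx.1))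
  have htpos : ∀ x ∈ t, 0 < x := fun x hx => hcpos.trans_le (htK x hx).1
  have htne : t.Nonempty := by
    obtain ⟨x, hx, -⟩ := mem_iUnion₂.1 (hcover (left_mem_Icc.2 hKle))
    exact ⟨x, hx⟩
  -- The smallest `δ` of the cover serves all centres, both for `ε` and for closeness to the
  -- section.
  obtain ⟨x₁, hx₁, hmin⟩ := t.exists_min_image δ htne
  have hδ₁ := hδ x₁ (htpos x₁ hx₁)
  obtain ⟨ε₁, hε₁, hsec⟩ := exists_isSectionSolution h0 h1 n a b hc (hc.le.trans hcd) hδ₁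
  refine ⟨min ε₁ (δ x₁), lt_min hε₁ hδ₁, fun ε hε0 hε => ?_⟩
  have hX := contDiff_field lam n a b ε (m := 1)
  have hloc' : ∀ x ∈ t, _ := fun x hx => hloc x (htpos x hx) ε (abs_pos.1 hε0)
    ((hε.trans_le (min_le_right _ _)).trans_le (hmin x hx))
  choose! Z ord hsum hZ using hloc'
  have hexists : ∀ Γ, IsClosedOrbit (field lam n a b ε) Γ ∧ Γ ⊆ subannulus lam c d →
      ∃ p : ℝ × ℝ, p ∈ t.product (t.biUnion Z) ∧ p.2 ∈ Z p.1 ∧ ofComplex lam (p.2 : ℂ) ∈ Γ ∧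
        HasMultiplicity (field lam n a b ε) Γ (ord p.1 p.2) := by
    rintro Γ ⟨hΓ, hsub⟩
    obtain ⟨γ, T, ρ, rfl, hρ, hγ⟩ := hsec ε (hε.trans_le (min_le_left _ _)) Γ hΓ hsub
    obtain ⟨x, hx, hball⟩ := mem_iUnion₂.1 (hcover hρ)
    rw [Metric.mem_ball, Real.dist_eq] at hball
    obtain ⟨hρZ, hmult⟩ := hZ x hx γ T ρ hball (hγ.mono (hmin x hx))
    refine ⟨(x, ρ), Finset.mem_product.2 ⟨hx, Finset.mem_biUnion.2 ⟨x, hx, hρZ⟩⟩, hρZ, ⟨0, ?_⟩,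
      hmult⟩
    rw [← hγ.start, ofComplex_toComplex h0 h1]
  choose! p hpmem hpZ hpΓ hpm using hexists
  set S := {Γ | IsClosedOrbit (field lam n a b ε) Γ ∧ Γ ⊆ subannulus lam c d} with hS
  have hinj : InjOn p S := fun Γ hΓ Γ' hΓ' he =>
    hΓ.1.eq_of_mem hX hΓ'.1 (hpΓ Γ hΓ) (by rw [he]; exact hpΓ Γ' hΓ')
  have hfin : S.Finite := Set.Finite.of_injOn (t := ↑(t.product (t.biUnion Z)))
    (fun Γ hΓ => hpmem Γ hΓ) hinj (Finset.finite_toSet _)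
  refine ⟨hfin.toFinset, fun Γ => ord (p Γ).1 (p Γ).2, fun Γ => hfin.mem_toFinset,
    fun Γ hΓ => hpm Γ (hfin.mem_toFinset.1 hΓ), ?_⟩
  refine (sum_le_sum_sum_of_injOn ord (t := t) (Z := Z) (p := p)
    (fun Γ hΓ Γ' hΓ' => hinj (hfin.mem_toFinset.1 hΓ) (hfin.mem_toFinset.1 hΓ'))
    fun Γ hΓ => ?_).trans ((Finset.sum_le_sum hsum).trans (sum_rootMultiplicity_sq_le hQn hQ0 htpos))
  have hΓ' := hfin.mem_toFinset.1 hΓ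
  exact ⟨(Finset.mem_product.1 (hpmem Γ hΓ')).1, hpZ Γ hΓ'⟩

theorem IsClosedOrbit.isCompact {X : ℝ × ℝ → ℝ × ℝ} {Γ : Set (ℝ × ℝ)} (h : IsClosedOrbit X Γ) :
    IsCompact Γ := by
  obtain ⟨γ, T, hγ, rfl⟩ := h
  exact hγ.2.2.1.compact_of_continuous hγ.2.1.ne' hγ.continuous

theorem continuous_ham (lam : ℝ) : Continuous (ham lam) := by
  unfold ham
  fun_prop

/-- If a larger subannulus contains only finitely many closed orbits, then all of those in the
smaller one are limit cycles. -/
theorem isLimitCycle_of_finite {X : ℝ × ℝ → ℝ × ℝ} (hX : ContDiff ℝ 1 X) {c c' d d' : ℝ}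
    (hc : c' < c) (hd : d < d') {L : Finset (Set (ℝ × ℝ))}
    (hL : ∀ Γ, Γ ∈ L ↔ IsClosedOrbit X Γ ∧ Γ ⊆ subannulus lam c' d') {Γ : Set (ℝ × ℝ)}
    (hΓ : IsClosedOrbit X Γ) (hsub : Γ ⊆ subannulus lam c d) : IsLimitCycle X Γ := by
  classical
  refine ⟨hΓ, {p | c' < ham lam p} ∩ {p | ham lam p < d'} ∩ (⋃ Γ' ∈ L.erase Γ, Γ')ᶜ, ?_, ?_, ?_⟩
  · refine ((isOpen_lt continuous_const (continuous_ham lam)).inter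
      (isOpen_lt (continuous_ham lam) continuous_const)).inter (IsClosed.isOpen_compl (self := ?_))
    refine (L.erase Γ).finite_toSet.isClosed_biUnion fun Γ' hΓ' => ?_
    exact ((hL Γ').1 (Finset.mem_of_mem_erase hΓ')).1.isCompact.isClosed
  · intro p hp
    refine ⟨⟨hc.trans_le (hsub hp).1, (hsub hp).2.trans_lt hd⟩, fun hp' => ?_⟩
    obtain ⟨Γ', hΓ', hpΓ'⟩ := mem_iUnion₂.1 hp'
    exact Finset.ne_of_mem_erase hΓ'
      (((hL Γ').1 (Finset.mem_of_mem_erase hΓ')).1.eq_of_mem hX hΓ hpΓ' hp)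
  · intro Γ' hΓ' hU
    by_contra hne
    have hmem : Γ' ∈ L.erase Γ := Finset.mem_erase.2
      ⟨hne, (hL Γ').2 ⟨hΓ', fun p hp => ⟨(hU hp).1.1.le, (hU hp).1.2.le⟩⟩⟩
    obtain ⟨γ, T, -, rfl⟩ := hΓ'
    exact (hU ⟨0, rfl⟩).2 (mem_iUnion₂.2 ⟨range γ, hmem, ⟨0, rfl⟩⟩)

theorem exists_finset_isLimitCycle (h0 : 0 < lam) (h1 : lam < 1)
    (hQn : Q ∈ Polynomial.degreeLT ℝ n) (hQ0 : Q ≠ 0) (hQ : ∀ r : ℝ,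
      ∫ θ in (0 : ℝ)..(2 * Real.pi), radialPart lam n a b (r * Real.cos θ, r * Real.sin θ)
        = r ^ 2 * Q.eval (r ^ 2 / 2)) {c d : ℝ} (hc : 0 < c) (hcd : c ≤ d) :
    ∃ ε₀ > 0, ∀ ε : ℝ, 0 < |ε| → |ε| < ε₀ →
      ∃ (L : Finset (Set (ℝ × ℝ))) (m : Set (ℝ × ℝ) → ℕ),
        (∀ Γ, Γ ∈ L ↔ IsLimitCycle (field lam n a b ε) Γ ∧ Γ ⊆ subannulus lam c d) ∧
        (∀ Γ, IsClosedOrbit (field lam n a b ε) Γ → Γ ⊆ subannulus lam c d → Γ ∈ L) ∧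
        (∀ Γ ∈ L, HasMultiplicity (field lam n a b ε) Γ (m Γ)) ∧ ∑ Γ ∈ L, m Γ ≤ n - 1 := by
  obtain ⟨ε₁, hε₁, key₁⟩ := exists_finset_isClosedOrbit h0 h1 hQn hQ0 hQ hc hcd
  -- An orbit touching the boundary of the subannulus must also be isolated from orbits outside, so
  -- finiteness is needed on a larger subannulus.
  obtain ⟨ε₂, hε₂, key₂⟩ := exists_finset_isClosedOrbit h0 h1 hQn hQ0 hQ (half_pos hc)
    (show c / 2 ≤ d + 1 by linarith)
  refine ⟨min ε₁ ε₂, lt_min hε₁ hε₂, fun ε hε0 hε => ?_⟩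
  obtain ⟨L, m, hL, hm, hsum⟩ := key₁ ε hε0 (hε.trans_le (min_le_left _ _))
  obtain ⟨L', -, hL', -⟩ := key₂ ε hε0 (hε.trans_le (min_le_right _ _))
  refine ⟨L, m, fun Γ => ⟨fun h => ?_, fun h => (hL Γ).2 ⟨h.1.1, h.2⟩⟩,
    fun Γ h h' => (hL Γ).2 ⟨h, h'⟩, hm, hsum⟩
  obtain ⟨h, h'⟩ := (hL Γ).1 h
  exact ⟨isLimitCycle_of_finite (contDiff_field lam n a b ε) (by linarith) (by linarith) hL' h h',
    h'⟩

theorem HasMultiplicity.pos {X : ℝ × ℝ → ℝ × ℝ} {Γ : Set (ℝ × ℝ)} {m : ℕ}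
    (h : HasMultiplicity X Γ m) : 0 < m := by
  obtain ⟨γ, T, v, P, -, -, hP, hm⟩ := h
  rw [Nat.pos_iff_ne_zero]
  rintro rfl
  exact hm.2.2 (by simp [hP.2.1])

end

section

/-! ### Existence of limit cycles near simple zeros -/

variable {lam : ℝ} {n : ℕ} {a b : ℕ → ℕ → ℝ} {Q : Polynomial ℝ}

/-- The first bound keeps `‖z‖` between `√(2h) / 2` and `3 √(2h) / 2`, hence `H` between `h / 4` and
`9h / 4`. The second makes orbits near different roots distinct. -/
theorem exists_radius_separating {s : Finset ℝ} (hs : ∀ h ∈ s, 0 < h) :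
    ∃ r > 0, ∀ h ∈ s, r < √(2 * h) / 2 ∧
      ∀ h' ∈ s, h ≠ h' → 2 * r < |√(2 * h) - √(2 * h')| := by
  have ev : ∀ u : ℝ, 0 < u → ∀ᶠ r : ℝ in 𝓝[>] 0, r < u := fun u hu =>
    nhdsWithin_le_nhds (eventually_lt_nhds hu)
  have key : ∀ᶠ r : ℝ in 𝓝[>] 0, 0 < r ∧ ∀ h ∈ s, r < √(2 * h) / 2 ∧
      ∀ h' ∈ s, h ≠ h' → 2 * r < |√(2 * h) - √(2 * h')| := by
    refine (eventually_mem_nhdsWithin).and (s.eventually_all.2 fun h hh => ?_)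
    have hpos := hs h hh
    refine (ev _ (half_pos (Real.sqrt_pos.2 (by linarith)))).and (s.eventually_all.2 fun h' hh' => ?_)
    have hpos' := hs h' hh'
    by_cases hne : h = h'
    · exact Eventually.of_forall fun r hne' => absurd hne hne'
    have : 0 < |√(2 * h) - √(2 * h')| / 2 := by
      refine half_pos (abs_pos.2 (sub_ne_zero.2 fun he => hne ?_))
      rw [Real.sqrt_inj (by linarith) (by linarith)] at he
      linarith
    filter_upwards [ev _ this] with r hr _
    linarith
  obtain ⟨r, hr, h⟩ := key.exists
  exact ⟨r, hr, h⟩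

theorem exists_injOn_isClosedOrbit (h0 : 0 < lam) (h1 : lam < 1) (hQ0 : Q ≠ 0) (hQ : ∀ r : ℝ,
      ∫ θ in (0 : ℝ)..(2 * Real.pi), radialPart lam n a b (r * Real.cos θ, r * Real.sin θ)
        = r ^ 2 * Q.eval (r ^ 2 / 2)) {s : Finset ℝ} (hs : ∀ h ∈ s, 0 < h)
    (hsQ : ∀ h ∈ s, Q.rootMultiplicity h = 1) :
    ∃ δ > 0, ∀ ε : ℝ, |ε| < δ → ∃ G : ℝ → Set (ℝ × ℝ), InjOn G s ∧
      ∀ h ∈ s, IsClosedOrbit (field lam n a b ε) (G h) ∧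
        ∀ p ∈ G h, h / 4 ≤ ham lam p ∧ ham lam p ≤ 9 * h / 4 := by
  obtain ⟨r, hr, hsep⟩ := exists_radius_separating hs
  have key : ∀ h ∈ s, ∀ᶠ ε : ℝ in 𝓝 0, ∃ Γ, IsClosedOrbit (field lam n a b ε) Γ ∧
      ∀ p ∈ Γ, |‖toComplex lam p‖ - √(2 * h)| < r := by
    intro h hh
    have hpos := hs h hh
    obtain ⟨O, T, D, hR⟩ := exists_isLocalReturn (angularVelocity_pos h0 h1) one_ne_zero
      (contDiff_complexPerturbation_comp (lam := lam) (n := n) (a := a) (b := b) _)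
      (Real.sqrt_pos.2 (show 0 < 2 * h by linarith)) hr
    have hord := hR.hasZeroOfOrder h0 h1 hQ0 hQ
    rw [Real.sq_sqrt (by linarith), mul_div_cancel_left₀ _ two_ne_zero, hsQ h hh] at hord
    obtain ⟨δ, hδ, hΓ⟩ := hR.exists_isClosedOrbit h0 h1 hord
    filter_upwards [Metric.ball_mem_nhds 0 hδ] with ε hε
    exact hΓ ε (by rwa [Metric.mem_ball, Real.dist_eq, sub_zero] at hε)
  obtain ⟨δ, hδ, hG⟩ := Metric.eventually_nhds_iff_ball.1 (s.eventually_all.2 key)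
  refine ⟨δ, hδ, fun ε hε => ?_⟩
  have hG' := hG ε (by rwa [Metric.mem_ball, Real.dist_eq, sub_zero])
  choose! G hGc hGp using hG'
  refine ⟨G, fun h hh h' hh' he => ?_, fun h hh => ⟨hGc h hh, fun p hp => ?_⟩⟩
  · by_contra hne
    obtain ⟨γ, T, -, hγ⟩ := hGc h hh
    have hp : γ 0 ∈ G h := by rw [hγ]; exact ⟨0, rfl⟩
    have e1 := hGp h hh _ hp
    have e2 := hGp h' hh' _ (he ▸ hp)
    have e3 := (hsep h hh).2 h' hh' hne
    have := abs_sub_le √(2 * h) ‖toComplex lam (γ 0)‖ √(2 * h')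
    rw [abs_sub_comm] at e1
    linarith
  · have e1 := abs_lt.1 (hGp h hh p hp)
    have e2 := (hsep h hh).1
    have e3 := Real.sq_sqrt (show 0 ≤ 2 * h by linarith [hs h hh])
    have e4 := norm_toComplex_sq h0 h1 p
    have e5 := norm_nonneg (toComplex lam p)
    have e6 := Real.sqrt_nonneg (2 * h)
    have e7 : (√(2 * h) / 2) ^ 2 ≤ ‖toComplex lam p‖ ^ 2 :=
      pow_le_pow_left₀ (by linarith) (by linarith) 2
    have e8 : ‖toComplex lam p‖ ^ 2 ≤ (3 * √(2 * h) / 2) ^ 2 :=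
      pow_le_pow_left₀ e5 (by linarith) 2
    constructor <;> nlinarith

/-- From above, every multiplicity is at least 1 and they sum to at most `n - 1`. From below, each
of the `n - 1` simple roots yields its own closed orbit, and all closed orbits in the subannulus
belong to `L`. -/
theorem exists_finset_isLimitCycle_card_eq (h0 : 0 < lam) (h1 : lam < 1)
    (hQn : Q ∈ Polynomial.degreeLT ℝ n) (hQ0 : Q ≠ 0) (hQ : ∀ r : ℝ,
      ∫ θ in (0 : ℝ)..(2 * Real.pi), radialPart lam n a b (r * Real.cos θ, r * Real.sin θ)
        = r ^ 2 * Q.eval (r ^ 2 / 2)) {s : Finset ℝ} (hs : ∀ h ∈ s, 1 ≤ h ∧ h ≤ n)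
    (hsQ : ∀ h ∈ s, Q.rootMultiplicity h = 1) (hcard : s.card = n - 1) {c d : ℝ} (hc : 0 < c)
    (hc' : c ≤ 1 / 4) (hd : 1 + 9 * n / 4 ≤ d) :
    ∃ ε₀ > 0, ∀ ε : ℝ, 0 < |ε| → |ε| < ε₀ →
      ∃ L : Finset (Set (ℝ × ℝ)), L.card = n - 1 ∧
        ∀ Γ, Γ ∈ L ↔ IsLimitCycle (field lam n a b ε) Γ ∧ Γ ⊆ subannulus lam c d := by
  classical
  have hn : (0 : ℝ) ≤ n := n.cast_nonneg
  obtain ⟨ε₁, hε₁, key⟩ := exists_finset_isLimitCycle h0 h1 hQn hQ0 hQ hc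
    (show c ≤ d by linarith)
  obtain ⟨ε₂, hε₂, hG⟩ := exists_injOn_isClosedOrbit h0 h1 hQ0 hQ
    (fun h hh => one_pos.trans_le (hs h hh).1) hsQ
  refine ⟨min ε₁ ε₂, lt_min hε₁ hε₂, fun ε hε0 hε => ?_⟩
  obtain ⟨L, m, hL, hL', hm, hsum⟩ := key ε hε0 (hε.trans_le (min_le_left _ _))
  obtain ⟨G, hinj, hG⟩ := hG ε (hε.trans_le (min_le_right _ _))
  refine ⟨L, le_antisymm ?_ ?_, hL⟩
  · refine le_trans ?_ hsum
    rw [Finset.card_eq_sum_ones]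
    exact Finset.sum_le_sum fun Γ hΓ => (hm Γ hΓ).pos
  · rw [← hcard, ← Finset.card_image_of_injOn hinj]
    refine Finset.card_le_card fun Γ hΓ => ?_
    obtain ⟨h, hh, rfl⟩ := Finset.mem_image.1 hΓ
    refine hL' _ (hG h hh).1 fun p hp => ?_
    have := (hG h hh).2 p hp
    have := hs h hh
    constructor <;> linarith

/-- A polynomial with given simple roots and no others. -/
theorem exists_polynomial_simple_roots {n : ℕ} (hn : n ≠ 0) :
    ∃ Q ∈ Polynomial.degreeLT ℝ n, Q ≠ 0 ∧ Q.roots.toFinset.card = n - 1 ∧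
      ∀ h ∈ Q.roots.toFinset, (1 ≤ h ∧ h ≤ n) ∧ Q.rootMultiplicity h = 1 := by
  classical
  set s : Finset ℝ := (Finset.range (n - 1)).image fun i : ℕ => (i + 1 : ℝ) with hs
  have hcard : s.card = n - 1 := by
    rw [hs, Finset.card_image_of_injective, Finset.card_range]
    intro i j h
    simpa using h
  have hroots := Polynomial.roots_prod_X_sub_C s
  have htoF : (∏ x ∈ s, (Polynomial.X - Polynomial.C x)).roots.toFinset = s := by
    rw [hroots, Finset.val_toFinset]
  have hmonic : (∏ x ∈ s, (Polynomial.X - Polynomial.C x)).Monic :=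
    Polynomial.monic_prod_of_monic _ _ fun x _ => Polynomial.monic_X_sub_C x
  refine ⟨∏ x ∈ s, (Polynomial.X - Polynomial.C x), ?_, hmonic.ne_zero, ?_, ?_⟩
  · rw [Polynomial.mem_degreeLT, Polynomial.degree_eq_natDegree hmonic.ne_zero,
      Polynomial.natDegree_finsetProd_X_sub_C_eq_card, hcard, Nat.cast_lt]
    omega
  · rw [htoF, hcard]
  · intro h hh
    rw [htoF] at hh
    refine ⟨?_, ?_⟩
    · obtain ⟨i, hi, rfl⟩ := Finset.mem_image.1 hh
      have h2 : i + 1 ≤ n := by have := Finset.mem_range.1 hi; omega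
      have h3 : (i : ℝ) + 1 ≤ n := by exact_mod_cast h2
      exact ⟨by linarith [i.cast_nonneg (α := ℝ)], h3⟩
    · rw [← Polynomial.count_roots, hroots]
      exact Multiset.count_eq_one_of_mem s.nodup hh

end

end IsochronousCubic

end

/-! ### The theorem -/

open IsochronousCubic in
theorem theorem1p2 (lam : ℝ) (hlam0 : 0 < lam) (hlam1 : lam < 1) :
    (∀ n : ℕ, 2 ≤ n →
      -- the upper bound, for perturbations whose Abelian integral does not vanish identically
      (∀ a b : ℕ → ℕ → ℝ, (∃ h, 0 < h ∧ abelianIntegral lam n a b h ≠ 0) →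
        (∃ (Z : Finset ℝ) (m : ℝ → ℕ),
          (∀ h, h ∈ Z ↔ 0 < h ∧ abelianIntegral lam n a b h = 0) ∧
          (∀ h ∈ Z, HasZeroOfOrder (abelianIntegral lam n a b) h (m h)) ∧
          ∑ h ∈ Z, m h ≤ n - 1) ∧
        (∀ c d : ℝ, 0 < c → c ≤ d → ∃ ε₀ > 0, ∀ ε : ℝ, 0 < |ε| → |ε| < ε₀ →
          ∃ (L : Finset (Set (ℝ × ℝ))) (m : Set (ℝ × ℝ) → ℕ),
            (∀ Γ, Γ ∈ L ↔ IsLimitCycle (field lam n a b ε) Γ ∧ Γ ⊆ subannulus lam c d) ∧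
            (∀ Γ ∈ L, HasMultiplicity (field lam n a b ε) Γ (m Γ)) ∧
            ∑ Γ ∈ L, m Γ ≤ n - 1)) ∧
      -- the upper bound is attained
      (∃ a b : ℕ → ℕ → ℝ,
        (∃ Z : Finset ℝ, Z.card = n - 1 ∧
          (∀ h, h ∈ Z ↔ 0 < h ∧ abelianIntegral lam n a b h = 0) ∧
          (∀ h ∈ Z, HasZeroOfOrder (abelianIntegral lam n a b) h 1)) ∧
        (∃ c₀ d₀ : ℝ, 0 < c₀ ∧ c₀ ≤ d₀ ∧ ∀ c d : ℝ, 0 < c → c ≤ c₀ → d₀ ≤ d →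
          ∃ ε₀ > 0, ∀ ε : ℝ, 0 < |ε| → |ε| < ε₀ →
            ∃ L : Finset (Set (ℝ × ℝ)), L.card = n - 1 ∧
              ∀ Γ, Γ ∈ L ↔ IsLimitCycle (field lam n a b ε) Γ ∧ Γ ⊆ subannulus lam c d))) ∧
    -- linear perturbations produce no limit cycle
    (∀ (a b : ℕ → ℕ → ℝ) (ε : ℝ), ¬ ∃ Γ, IsLimitCycle (field lam 1 a b ε) Γ) := by
  refine ⟨fun n hn => ⟨?_, ?_⟩, fun a b ε ⟨Γ, hΓ⟩ => not_isLimitCycle_linear lam a b ε Γ hΓ⟩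
  · rintro a b ⟨h, hh, hI⟩
    obtain ⟨-, Q, hQn, hQ⟩ := hasMoments_radialPart (lam := lam) n a b
    have hQ0 : Q ≠ 0 := by
      rintro rfl
      exact hI (by rw [exists_abelianIntegral_polynomial hlam0 hlam1 n a b hQ hh.le]; simp)
    obtain ⟨hZ, hord⟩ := abelianIntegral_zeros hlam0 hlam1 hQ0 hQ
    refine ⟨⟨_, Q.rootMultiplicity, hZ, fun h hh => hord h ((hZ h).1 hh).1,
      sum_rootMultiplicity_le hQn hQ0 _⟩, fun c d hc hcd => ?_⟩
    obtain ⟨ε₀, hε₀, key⟩ := exists_finset_isLimitCycle hlam0 hlam1 hQn hQ0 hQ hc hcd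
    refine ⟨ε₀, hε₀, fun ε h1 h2 => ?_⟩
    obtain ⟨L, m, hL, -, hm, hsum⟩ := key ε h1 h2
    exact ⟨L, m, hL, hm, hsum⟩
  · obtain ⟨Q, hQn, hQ0, hcard, hs⟩ := exists_polynomial_simple_roots (n := n) (by omega)
    obtain ⟨b, hQ⟩ := exists_radialPart_moments_eq hlam0 hlam1 hQn
    obtain ⟨hZ, hord⟩ := abelianIntegral_zeros hlam0 hlam1 hQ0 hQ
    have hfilter : Q.roots.toFinset.filter (0 < ·) = Q.roots.toFinset :=
      Finset.filter_true_of_mem fun h hh => one_pos.trans_le (hs h hh).1.1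
    rw [hfilter] at hZ
    -- The roots lie in `[1, n]` and the orbits in `h / 4 ≤ H ≤ 9h / 4`, whence `c₀ = 1 / 4`; the
    -- summand 1 in `d₀` ensures `c₀ ≤ d₀` for any `n`.
    refine ⟨0, b, ⟨_, hcard, hZ, fun h hh => ?_⟩, 1 / 4, 1 + 9 * n / 4, by norm_num, ?_, ?_⟩
    · rw [← (hs h hh).2]
      exact hord h ((hZ h).1 hh).1
    · linarith [n.cast_nonneg (α := ℝ)]
    · exact fun c d hc hc' hd => exists_finset_isLimitCycle_card_eq hlam0 hlam1 hQn hQ0 hQ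
        (fun h hh => (hs h hh).1) (fun h hh => (hs h hh).2) hcard hc hc' hd
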